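/- Let $k$ be a field. A coquasi-bialgebra is a coassociative counital $k$-coalgebra $(H,\Delta,\varepsilon)$ with coalgebra morphisms $m:H\otimes H\to H$ (written $hg$) and $u:k\to H$ (with $u(1)=1_H$) and a convolution invertible $\omega\in(H\otimes H\otimes H)^*$ such that, in Sweedler notation, for all $h,g,l,t\in H$, $$h_1(g_1l_1)\,\omega(h_2,g_2,l_2)=\omega(h_1,g_1,l_1)\,(h_2g_2)l_2,\qquad 1_Hh=h1_H=h,\qquad \omega(h,1_H,g)=\varepsilon(h)\varepsilon(g),$$ $$\omega(h_1,g_1,l_1t_1)\,\omega(h_2g_2,l_2,t_2)=\omega(g_1,l_1,t_1)\,\omega(h_1,g_2l_2,t_2)\,\omega(h_2,g_3,l_3).$$ A coquasi-Hopf algebra is a coquasi-bialgebra $H$ with a coalgebra antihomomorphism $S:H\to H$ (the antipode) and $\alpha,\beta\in H^*$ such that $S(h_1)\alpha(h_2)h_3=\alpha(h)1_H$, $h_1\beta(h_2)S(h_3)=\beta(h)1_H$ and $$\omega(h_1\beta(h_2),S(h_3),\alpha(h_4)h_5)=\varepsilon(h)=\omega^{-1}(S(h_1),\alpha(h_2)h_3\beta(h_4),S(h_5)).$$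 A right $H$-comodule algebra is a right $H$-comodule $A$, with coaction $\rho_A(a)=a_0\otimes a_1$, together with $H$-colinear multiplication and unit (so $\rho_A(ab)=a_0b_0\otimes a_1b_1$ and $\rho_A(1_A)=1_A\otimes 1_H$) such that $1_Aa=a=a1_A$ and $(ab)c=a_0(b_0c_0)\,\omega(a_1,b_1,c_1)$. For a right $H$-comodule $M$ put $M^{coH}=\{m\in M:\rho_M(m)=m\otimes 1_H\}$; then $B=A^{coH}$ is an associative unital $k$-algebra under the multiplication of $A$. Let $\mathcal M_B$ be the category of right $B$-modules, and let $\mathcal M_A^H$ be the category of relative right $(H,A)$-Hopf modules: right $H$-comodules $M$ with an action $m\otimes a\mapsto ma$ such that $(ma)b=m_0(a_0b_0)\,\omega(m_1,a_1,b_1)$, $m1_A=m$ and $\rho_M(ma)=m_0a_0\otimes m_1a_1$; morphisms are the $H$-colinear maps that respect the action. For $M\in\mathcal M_A^H$ the space $M^{coH}$ is a right $B$-module, and for $N\in\mathcal M_B$ the space $N\otimes_BA$ is in $\mathcal M_A^H$ by $\rho(n\otimes_Ba)=(n\otimes_Ba_0)\otimes a_1$ and $(n\otimes_Ba)a'=n\otimes_Baa'$.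 This gives the coinvariants functor $(-)^{coH}:\mathcal M_A^H\to\mathcal M_B$ and the induction functor $(-)\otimes_BA:\mathcal M_B\to\mathcal M_A^H$. **Theorem (affineness criterion).** Let $H$ be a coquasi-Hopf algebra over $k$ with bijective antipode, let $A$ be a right $H$-comodule algebra, and let $B=A^{coH}$. Assume that (1) there exists a total integral $\gamma:H\to A$, that is, a $k$-linear right $H$-colinear map with $\gamma(1_H)=1_A$; (2) the canonical map $$can:A\otimes_BA\to A\otimes H,\qquad can(a\otimes_Bb)=a_0b_0\otimes\omega^{-1}(a_1,b_1\beta(b_2),S(b_3))\,b_4$$ is surjective. Then the functor of coinvariants and the induction functor form a pair of inverse equivalences between $\mathcal M_A^H$ and $\mathcal M_B$. More precisely, the natural maps $u_N:N\to(N\otimes_BA)^{coH}$, $u_N(n)=n\otimes_B1_A$, and $\varepsilon_M:M^{coH}\otimes_BA\to M$, $\varepsilon_M(m\otimes_Ba)=ma$, are isomorphisms for all $N\in\mathcal M_B$ and $M\in\mathcal M_A^H$. -/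

import Mathlib

open CategoryTheory
open scoped TensorProduct

namespace CoquasiHopf

noncomputable section

/-! ### Coquasi-bialgebras and coquasi-Hopf algebras -/

section Convolution

variable {k C V : Type*} [Field k] [AddCommGroup C] [Module k C] [Coalgebra k C]
  [AddCommGroup V] [Module k V]

/-- The map `c ↦ f(c₁) F(c₂)`. -/
def convL (f : C →ₗ[k] k) (F : C →ₗ[k] V) : C →ₗ[k] V :=
  (TensorProduct.lid k V).toLinearMap ∘ₗ TensorProduct.map f F ∘ₗ Coalgebra.comul

/-- The map `c ↦ F(c₁) f(c₂)`. -/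
def convR (F : C →ₗ[k] V) (f : C →ₗ[k] k) : C →ₗ[k] V :=
  (TensorProduct.rid k V).toLinearMap ∘ₗ TensorProduct.map F f ∘ₗ Coalgebra.comul

/-- The iterated comultiplication `c ↦ c₁ ⊗ (c₂ ⊗ c₃)`. -/
def comul₃ (k C : Type*) [Field k] [AddCommGroup C] [Module k C] [Coalgebra k C] :
    C →ₗ[k] C ⊗[k] (C ⊗[k] C) :=
  LinearMap.lTensor C Coalgebra.comul ∘ₗ Coalgebra.comul

end Convolution

/-- A coquasi-bialgebra: a coassociative counital coalgebra with a multiplication and a unit that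
are coalgebra morphisms, and a convolution invertible `ω ∈ (H ⊗ H ⊗ H)^*`.  The convolution
algebra of functionals on a coalgebra `C` is `WithConv (C →ₗ[k] k)`. -/
class CoquasiBialgebra (k H : Type*) [Field k] [AddCommGroup H] [Module k H]
    [Coalgebra k H] where
  /-- The multiplication, a morphism of coalgebras. -/
  mulHom : H ⊗[k] H →ₗc[k] H
  /-- The unit element. -/
  one : H
  /-- The unit map `c ↦ c • one` is a morphism of coalgebras. -/
  one_groupLike : IsGroupLikeElem k one
  /-- The reassociator, a unit of the convolution algebra. -/
  omegaUnit : (WithConv (H ⊗[k] (H ⊗[k] H) →ₗ[k] k))ˣ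
  one_mul : ∀ h : H, mulHom (one ⊗ₜ[k] h) = h
  mul_one : ∀ h : H, mulHom (h ⊗ₜ[k] one) = h
  /-- `h₁(g₁k₁) ω(h₂,g₂,k₂) = ω(h₁,g₁,k₁) (h₂g₂)k₂`. -/
  mul_assoc :
    convR (mulHom.toLinearMap ∘ₗ LinearMap.lTensor H mulHom.toLinearMap) omegaUnit.val.ofConv =
      convL omegaUnit.val.ofConv
        (mulHom.toLinearMap ∘ₗ LinearMap.rTensor H mulHom.toLinearMap ∘ₗ
          (TensorProduct.assoc k H H H).symm.toLinearMap)
  /-- `ω(h₁,g₁,k₁l₁) ω(h₂g₂,k₂,l₂) = ω(g₁,k₁,l₁) ω(h₁,g₂k₂,l₂) ω(h₂,g₃,k₃)`, as an identity of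
  convolution products of functionals on `H ⊗ (H ⊗ (H ⊗ H))`. -/
  cocycle :
    WithConv.toConv (omegaUnit.val.ofConv ∘ₗ
        LinearMap.lTensor H (LinearMap.lTensor H mulHom.toLinearMap)) *
      WithConv.toConv (omegaUnit.val.ofConv ∘ₗ LinearMap.rTensor (H ⊗[k] H) mulHom.toLinearMap ∘ₗ
        (TensorProduct.assoc k H H (H ⊗[k] H)).symm.toLinearMap) =
    WithConv.toConv ((TensorProduct.lid k k).toLinearMap ∘ₗ
        TensorProduct.map Coalgebra.counit omegaUnit.val.ofConv) *
      WithConv.toConv (omegaUnit.val.ofConv ∘ₗ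
        LinearMap.lTensor H (LinearMap.rTensor H mulHom.toLinearMap ∘ₗ
          (TensorProduct.assoc k H H H).symm.toLinearMap)) *
      WithConv.toConv (omegaUnit.val.ofConv ∘ₗ
        LinearMap.lTensor H (LinearMap.lTensor H ((TensorProduct.rid k H).toLinearMap ∘ₗ
          LinearMap.lTensor H Coalgebra.counit)))
  /-- `ω(h,1,g) = ε(h) ε(g)`. -/
  omega_one : ∀ h g : H, omegaUnit.val.ofConv (h ⊗ₜ[k] (one ⊗ₜ[k] g)) =
    Coalgebra.counit (R := k) h * Coalgebra.counit (R := k) g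

section Bialgebra

variable (k H : Type*) [Field k] [AddCommGroup H] [Module k H] [Coalgebra k H]
  [CoquasiBialgebra k H]

/-- The multiplication `h ⊗ g ↦ hg` of `H`. -/
def mulH : H ⊗[k] H →ₗ[k] H := (CoquasiBialgebra.mulHom (k := k) (H := H)).toLinearMap

/-- The unit element of `H`. -/
def oneH : H := CoquasiBialgebra.one k

/-- The reassociator `ω`. -/
def omega : H ⊗[k] (H ⊗[k] H) →ₗ[k] k :=
  (CoquasiBialgebra.omegaUnit (k := k) (H := H)).val.ofConv

/-- The convolution inverse `ω⁻¹` of the reassociator. -/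
def omegaInv : H ⊗[k] (H ⊗[k] H) →ₗ[k] k :=
  ((CoquasiBialgebra.omegaUnit (k := k) (H := H))⁻¹).val.ofConv

end Bialgebra

/-- A coquasi-Hopf algebra: a coquasi-bialgebra with a coalgebra antihomomorphism `S` and
functionals `α`, `β`. -/
class CoquasiHopfAlgebra (k H : Type*) [Field k] [AddCommGroup H] [Module k H]
    [Coalgebra k H] extends CoquasiBialgebra k H where
  S : H →ₗ[k] H
  α : H →ₗ[k] k
  β : H →ₗ[k] k
  counit_S : Coalgebra.counit ∘ₗ S = (Coalgebra.counit : H →ₗ[k] k)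
  /-- `Δ(S(h)) = S(h₂) ⊗ S(h₁)`. -/
  comul_S : Coalgebra.comul ∘ₗ S =
    (TensorProduct.comm k H H).toLinearMap ∘ₗ TensorProduct.map S S ∘ₗ Coalgebra.comul
  /-- `S(h₁) α(h₂) h₃ = α(h) 1`. -/
  S_alpha_id : ∀ h : H,
    mulH k H (TensorProduct.map S (convL α LinearMap.id) (Coalgebra.comul h)) = α h • oneH k H
  /-- `h₁ β(h₂) S(h₃) = β(h) 1`. -/
  id_beta_S : ∀ h : H,
    mulH k H (TensorProduct.map LinearMap.id (convL β S) (Coalgebra.comul h)) = β h • oneH k H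
  /-- `ω(h₁ β(h₂), S(h₃), α(h₄) h₅) = ε(h)`. -/
  omega_S : ∀ h : H,
    omega k H (TensorProduct.map (convR LinearMap.id β)
      (TensorProduct.map S (convL α LinearMap.id)) (comul₃ k H h)) = Coalgebra.counit (R := k) h
  /-- `ω⁻¹(S(h₁), α(h₂) h₃ β(h₄), S(h₅)) = ε(h)`. -/
  omegaInv_S : ∀ h : H,
    omegaInv k H (TensorProduct.map S
      (TensorProduct.map (convR (convL α LinearMap.id) β) S) (comul₃ k H h)) =
      Coalgebra.counit (R := k) h

/-! ### Comodules, comodule algebras and relative Hopf modules -/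

/-- A right comodule over a coalgebra. -/
class RightComodule (k H M : Type*) [Field k] [AddCommGroup H] [Module k H] [Coalgebra k H]
    [AddCommGroup M] [Module k M] where
  /-- The coaction `m ↦ m₀ ⊗ m₁`. -/
  coact : M →ₗ[k] M ⊗[k] H
  coassoc : (TensorProduct.assoc k M H H).toLinearMap ∘ₗ LinearMap.rTensor H coact ∘ₗ coact =
    LinearMap.lTensor M Coalgebra.comul ∘ₗ coact
  counit_coact : (TensorProduct.rid k M).toLinearMap ∘ₗ
    LinearMap.lTensor M Coalgebra.counit ∘ₗ coact = LinearMap.id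

/-- The coaction `ρ_M : m ↦ m₀ ⊗ m₁` of a right comodule. -/
def rho (k H M : Type*) [Field k] [AddCommGroup H] [Module k H] [Coalgebra k H]
    [AddCommGroup M] [Module k M] [RightComodule k H M] : M →ₗ[k] M ⊗[k] H :=
  RightComodule.coact

theorem counit_rho {k H U : Type*} [Field k] [AddCommGroup H] [Module k H] [Coalgebra k H]
    [AddCommGroup U] [Module k U] [RightComodule k H U] (u : U) :
    TensorProduct.rid k U (LinearMap.lTensor U Coalgebra.counit (rho k H U u)) = u :=
  LinearMap.congr_fun (RightComodule.counit_coact (k := k) (H := H) (M := U)) u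

section Monoidal

variable (k H : Type*) [Field k] [AddCommGroup H] [Module k H] [Coalgebra k H]
  [CoquasiBialgebra k H]
variable (U V W : Type*) [AddCommGroup U] [Module k U] [RightComodule k H U]
  [AddCommGroup V] [Module k V] [RightComodule k H V]
  [AddCommGroup W] [Module k W] [RightComodule k H W]

/-- The codiagonal coaction `u ⊗ v ↦ (u₀ ⊗ v₀) ⊗ u₁v₁` on a tensor product of comodules. -/
def codiag : U ⊗[k] V →ₗ[k] (U ⊗[k] V) ⊗[k] H :=
  LinearMap.lTensor (U ⊗[k] V) (mulH k H) ∘ₗ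
    (TensorProduct.tensorTensorTensorComm k U H V H).toLinearMap ∘ₗ
    TensorProduct.map (rho k H U) (rho k H V)

/-- The map `((u ⊗ h) ⊗ (v ⊗ g)) ⊗ (w ⊗ l) ↦ ω(h,g,l) u ⊗ (v ⊗ w)`. -/
def omegaContract : ((U ⊗[k] H) ⊗[k] (V ⊗[k] H)) ⊗[k] (W ⊗[k] H) →ₗ[k] U ⊗[k] (V ⊗[k] W) :=
  (TensorProduct.rid k (U ⊗[k] (V ⊗[k] W))).toLinearMap ∘ₗ
    TensorProduct.map (TensorProduct.assoc k U V W).toLinearMap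
      (omega k H ∘ₗ (TensorProduct.assoc k H H H).toLinearMap) ∘ₗ
    (TensorProduct.tensorTensorTensorComm k (U ⊗[k] V) (H ⊗[k] H) W H).toLinearMap ∘ₗ
    LinearMap.rTensor (W ⊗[k] H) (TensorProduct.tensorTensorTensorComm k U H V H).toLinearMap

/-- The reassociator `(u ⊗ v) ⊗ w ↦ ω(u₁,v₁,w₁) u₀ ⊗ (v₀ ⊗ w₀)` of the monoidal category of right
`H`-comodules. -/
def reassociator : (U ⊗[k] V) ⊗[k] W →ₗ[k] U ⊗[k] (V ⊗[k] W) :=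
  omegaContract k H U V W ∘ₗ
    TensorProduct.map (TensorProduct.map (rho k H U) (rho k H V)) (rho k H W)

end Monoidal

/-- A right `H`-comodule algebra: an algebra in the monoidal category of right `H`-comodules. -/
class ComoduleAlgebra (k H A : Type*) [Field k] [AddCommGroup H] [Module k H] [Coalgebra k H]
    [CoquasiBialgebra k H] [AddCommGroup A] [Module k A] extends RightComodule k H A where
  mul : A ⊗[k] A →ₗ[k] A
  one : A
  one_mul : ∀ a : A, mul (one ⊗ₜ[k] a) = a
  mul_one : ∀ a : A, mul (a ⊗ₜ[k] one) = a
  /-- The multiplication is colinear. -/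
  coact_mul : rho k H A ∘ₗ mul = LinearMap.rTensor H mul ∘ₗ codiag k H A A
  /-- The unit is colinear. -/
  coact_one : rho k H A one = one ⊗ₜ[k] oneH k H
  /-- `(ab)c = a₀(b₀c₀) ω(a₁,b₁,c₁)`. -/
  mul_assoc : mul ∘ₗ LinearMap.rTensor A mul =
    mul ∘ₗ LinearMap.lTensor A mul ∘ₗ reassociator k H A A A

section AlgebraOps

variable (k H A : Type*) [Field k] [AddCommGroup H] [Module k H] [Coalgebra k H]
  [CoquasiBialgebra k H] [AddCommGroup A] [Module k A] [ComoduleAlgebra k H A]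

/-- The multiplication `a ⊗ b ↦ ab` of a comodule algebra. -/
def mulA : A ⊗[k] A →ₗ[k] A := ComoduleAlgebra.mul (H := H)

/-- The unit element of a comodule algebra. -/
def oneA : A := ComoduleAlgebra.one k H

end AlgebraOps

/-- A relative right `(H, A)`-Hopf module: a right module over `A` in the monoidal category of
right `H`-comodules. -/
class HopfModule (k H A M : Type*) [Field k] [AddCommGroup H] [Module k H] [Coalgebra k H]
    [CoquasiBialgebra k H] [AddCommGroup A] [Module k A] [ComoduleAlgebra k H A]
    [AddCommGroup M] [Module k M] extends RightComodule k H M where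
  act : M ⊗[k] A →ₗ[k] M
  act_one : ∀ m : M, act (m ⊗ₜ[k] oneA k H A) = m
  /-- `ρ(ma) = m₀a₀ ⊗ m₁a₁`. -/
  coact_act : rho k H M ∘ₗ act = LinearMap.rTensor H act ∘ₗ codiag k H M A
  /-- `(ma)b = m₀(a₀b₀) ω(m₁,a₁,b₁)`. -/
  act_act : act ∘ₗ LinearMap.rTensor A act =
    act ∘ₗ LinearMap.lTensor M (mulA k H A) ∘ₗ reassociator k H M A A

/-- The action `m ⊗ a ↦ ma` of a relative Hopf module. -/
def actM (k H A M : Type*) [Field k] [AddCommGroup H] [Module k H] [Coalgebra k H]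
    [CoquasiBialgebra k H] [AddCommGroup A] [Module k A] [ComoduleAlgebra k H A]
    [AddCommGroup M] [Module k M] [HopfModule k H A M] : M ⊗[k] A →ₗ[k] M :=
  HopfModule.act (H := H)

/-- The comodule algebra `A` is a relative Hopf module over itself. -/
instance instHopfModuleSelf (k H A : Type*) [Field k] [AddCommGroup H] [Module k H]
    [Coalgebra k H] [CoquasiBialgebra k H] [AddCommGroup A] [Module k A]
    [ComoduleAlgebra k H A] : HopfModule k H A A where
  act := mulA k H A
  act_one := ComoduleAlgebra.mul_one (H := H)
  coact_act := ComoduleAlgebra.coact_mul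
  act_act := ComoduleAlgebra.mul_assoc

/-- The coinvariants `{m | ρ(m) = m ⊗ 1}` of a right comodule. -/
def coinvariants (k H M : Type*) [Field k] [AddCommGroup H] [Module k H] [Coalgebra k H]
    [CoquasiBialgebra k H] [AddCommGroup M] [Module k M] [RightComodule k H M] :
    Submodule k M where
  carrier := {m | rho k H M m = m ⊗ₜ[k] oneH k H}
  add_mem' := by
    intro a b ha hb
    simp only [Set.mem_ofPred_eq] at ha hb ⊢
    rw [map_add, ha, hb, TensorProduct.add_tmul]
  zero_mem' := by simp
  smul_mem' := by
    intro c a ha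
    simp only [Set.mem_ofPred_eq] at ha ⊢
    rw [map_smul, ha, TensorProduct.smul_tmul']

/-! ### The ring of coinvariants and its right modules of coinvariants -/

section Coinvariants

variable {k H : Type*} [Field k] [AddCommGroup H] [Module k H] [Coalgebra k H]
  [CoquasiBialgebra k H]

theorem mulH_one_one : mulH k H (oneH k H ⊗ₜ[k] oneH k H) = oneH k H :=
  CoquasiBialgebra.one_mul _

theorem omega_middle (h g : H) : omega k H (h ⊗ₜ[k] (oneH k H ⊗ₜ[k] g)) =
    Coalgebra.counit (R := k) h * Coalgebra.counit (R := k) g :=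
  CoquasiBialgebra.omega_one h g

/-- The coalgebra morphism `c ↦ 1 ⊗ c`. -/
def oneTensor (k H C : Type*) [Field k] [AddCommGroup H] [Module k H] [Coalgebra k H]
    [CoquasiBialgebra k H] [AddCommGroup C] [Module k C] [Coalgebra k C] :
    C →ₗc[k] H ⊗[k] C where
  toLinearMap := TensorProduct.mk k H C (oneH k H)
  counit_comp := by
    ext c
    have h1 : Coalgebra.counit (R := k) (oneH k H) = 1 :=
      CoquasiBialgebra.one_groupLike.counit_eq_one
    simp [h1]
  map_comp_comul := by
    ext c
    have h1 : Coalgebra.comul (R := k) (oneH k H) = oneH k H ⊗ₜ[k] oneH k H :=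
      CoquasiBialgebra.one_groupLike.comul_eq_tmul_self
    simp only [LinearMap.comp_apply, TensorProduct.mk_apply, TensorProduct.comul_tmul, h1]
    generalize Coalgebra.comul (R := k) c = x
    induction x with
    | zero => simp
    | add x y hx hy => simp only [map_add, TensorProduct.tmul_add, hx, hy]
    | tmul x y => rfl

open WithConv in
theorem omega_oneTensor :
    toConv (omega k H ∘ₗ (oneTensor k H (H ⊗[k] H)).toLinearMap) = 1 := by
  set f := toConv (omega k H ∘ₗ (oneTensor k H (H ⊗[k] H)).toLinearMap) with hf
  have hunit : IsUnit f := by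
    let u := CoquasiBialgebra.omegaUnit (k := k) (H := H)
    have key : ∀ a b : WithConv (H ⊗[k] (H ⊗[k] H) →ₗ[k] k), a * b = 1 →
        toConv (a.ofConv ∘ₗ (oneTensor k H (H ⊗[k] H)).toLinearMap) *
          toConv (b.ofConv ∘ₗ (oneTensor k H (H ⊗[k] H)).toLinearMap) = 1 := by
      intro a b hab
      have := LinearMap.convMul_comp_coalgHom_distrib a b (oneTensor k H (H ⊗[k] H))
      rw [hab] at this
      apply WithConv.ofConv_injective
      rw [← this]
      show (Algebra.linearMap k k ∘ₗ Coalgebra.counit) ∘ₗ _ = Algebra.linearMap k k ∘ₗ _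
      rw [LinearMap.comp_assoc]
      congr 1
      exact (oneTensor k H (H ⊗[k] H)).counit_comp
    exact ⟨⟨f, _, key _ _ u.mul_inv, key _ _ u.inv_mul⟩, rfl⟩
  have hc1 : Coalgebra.counit (R := k) (oneH k H) = 1 :=
    CoquasiBialgebra.one_groupLike.counit_eq_one
  have hm : ∀ x y : H, Coalgebra.counit (R := k) (mulH k H (x ⊗ₜ[k] y)) =
      Coalgebra.counit (R := k) x * Coalgebra.counit (R := k) y := by
    intro x y
    have := LinearMap.congr_fun
      (CoquasiBialgebra.mulHom (k := k) (H := H)).counit_comp (x ⊗ₜ[k] y)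
    refine this.trans ?_
    simp [mul_comm]
  let i : H ⊗[k] H →ₗc[k] H ⊗[k] (H ⊗[k] (H ⊗[k] H)) :=
    (oneTensor k H (H ⊗[k] (H ⊗[k] H))).comp (oneTensor k H (H ⊗[k] H))
  have cut : ∀ a b : WithConv (H ⊗[k] (H ⊗[k] (H ⊗[k] H)) →ₗ[k] k),
      toConv ((a * b).ofConv ∘ₗ i.toLinearMap) =
        toConv (a.ofConv ∘ₗ i.toLinearMap) * toConv (b.ofConv ∘ₗ i.toLinearMap) := fun a b =>
    congrArg toConv (LinearMap.convMul_comp_coalgHom_distrib a b i)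
  have hcoc := congrArg (fun z => toConv (z.ofConv ∘ₗ i.toLinearMap))
    (CoquasiBialgebra.cocycle (k := k) (H := H))
  simp only [cut] at hcoc
  have ext2 : ∀ (a b : WithConv (H ⊗[k] H →ₗ[k] k)),
      (∀ x y, a.ofConv (x ⊗ₜ[k] y) = b.ofConv (x ⊗ₜ[k] y)) → a = b := by
    intro a b h
    apply WithConv.ofConv_injective
    exact TensorProduct.ext' h
  have hone : ∀ x y : H, (1 : WithConv (H ⊗[k] H →ₗ[k] k)).ofConv (x ⊗ₜ[k] y) =
      Coalgebra.counit (R := k) x * Coalgebra.counit (R := k) y := by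
    intro x y
    show algebraMap k k (Coalgebra.counit (R := k) (x ⊗ₜ[k] y)) = _
    simp [mul_comm]
  have h1m : ∀ x : H, mulH k H (oneH k H ⊗ₜ[k] x) = x := CoquasiBialgebra.one_mul
  have e : f = f * f := by
    refine Eq.trans ?_ (hcoc.trans ?_)
    · rw [← one_mul f]
      congr 1
      · apply ext2
        intro x y
        rw [hone]
        exact (omega_middle (oneH k H) (mulH k H (x ⊗ₜ[k] y))).trans (by rw [hc1, one_mul, hm]) |>.symm
      · apply ext2
        intro x y
        exact congrArg (fun z => omega k H (z ⊗ₜ[k] (x ⊗ₜ[k] y))) mulH_one_one.symm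
    · conv_rhs => rw [← mul_one (f * f)]
      congr 1
      · congr 1
        · apply ext2
          intro x y
          show Coalgebra.counit (R := k) (oneH k H) •
            omega k H (oneH k H ⊗ₜ[k] (x ⊗ₜ[k] y)) = _
          rw [hc1, one_smul]
          rfl
        · apply ext2
          intro x y
          exact congrArg (fun z => omega k H (oneH k H ⊗ₜ[k] (z ⊗ₜ[k] y))) (h1m x)
      · apply ext2
        intro x y
        rw [hone]
        show omega k H (oneH k H ⊗ₜ[k] (oneH k H ⊗ₜ[k]
          (Coalgebra.counit (R := k) y • x))) = _
        rw [omega_middle, hc1, one_mul, map_smul, smul_eq_mul, mul_comm]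
  exact (hunit.mul_left_cancel (e.symm.trans (mul_one f).symm))

/-- `ω(1,h,g) = ε(h) ε(g)`. -/
theorem omega_left (h g : H) : omega k H (oneH k H ⊗ₜ[k] (h ⊗ₜ[k] g)) =
    Coalgebra.counit (R := k) h * Coalgebra.counit (R := k) g := by
  have := congrArg (fun z => z.ofConv (h ⊗ₜ[k] g)) (omega_oneTensor (k := k) (H := H))
  refine this.trans ?_
  show algebraMap k k (Coalgebra.counit (R := k) (h ⊗ₜ[k] g)) = _
  simp [mul_comm]

theorem mem_coinvariants {M : Type*} [AddCommGroup M] [Module k M] [RightComodule k H M]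
    {m : M} : m ∈ coinvariants k H M ↔ rho k H M m = m ⊗ₜ[k] oneH k H := Iff.rfl

section Contract

variable {U V W : Type*} [AddCommGroup U] [Module k U] [RightComodule k H U]
  [AddCommGroup V] [Module k V] [RightComodule k H V]
  [AddCommGroup W] [Module k W] [RightComodule k H W]

theorem reassociator_middle (u : U) {v : V} (hv : v ∈ coinvariants k H V) (w : W) :
    reassociator k H U V W ((u ⊗ₜ[k] v) ⊗ₜ[k] w) = u ⊗ₜ[k] (v ⊗ₜ[k] w) := by
  have key : ∀ (X : U ⊗[k] H) (Y : W ⊗[k] H),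
      omegaContract k H U V W ((X ⊗ₜ[k] (v ⊗ₜ[k] oneH k H)) ⊗ₜ[k] Y) =
        TensorProduct.rid k U (LinearMap.lTensor U Coalgebra.counit X) ⊗ₜ[k]
          (v ⊗ₜ[k] TensorProduct.rid k W (LinearMap.lTensor W Coalgebra.counit Y)) := by
    intro X Y
    induction X with
    | zero => simp
    | add X X' h h' => simp only [TensorProduct.add_tmul, map_add, h, h']
    | tmul u h =>
      induction Y with
      | zero => simp
      | add Y Y' h h' => simp only [TensorProduct.tmul_add, map_add, h, h']
      | tmul w g =>
        show omega k H (h ⊗ₜ[k] (oneH k H ⊗ₜ[k] g)) • (u ⊗ₜ[k] (v ⊗ₜ[k] w)) = _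
        rw [omega_middle]
        simp only [LinearMap.lTensor_tmul, TensorProduct.rid_tmul, TensorProduct.tmul_smul,
          ← TensorProduct.smul_tmul', smul_smul, mul_comm]
  show omegaContract k H U V W ((rho k H U u ⊗ₜ[k] rho k H V v) ⊗ₜ[k] rho k H W w) = _
  rw [mem_coinvariants.1 hv, key, counit_rho, counit_rho]

theorem reassociator_left {u : U} (hu : u ∈ coinvariants k H U) (v : V) (w : W) :
    reassociator k H U V W ((u ⊗ₜ[k] v) ⊗ₜ[k] w) = u ⊗ₜ[k] (v ⊗ₜ[k] w) := by
  have key : ∀ (X : V ⊗[k] H) (Y : W ⊗[k] H),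
      omegaContract k H U V W (((u ⊗ₜ[k] oneH k H) ⊗ₜ[k] X) ⊗ₜ[k] Y) =
        u ⊗ₜ[k] (TensorProduct.rid k V (LinearMap.lTensor V Coalgebra.counit X) ⊗ₜ[k]
          TensorProduct.rid k W (LinearMap.lTensor W Coalgebra.counit Y)) := by
    intro X Y
    induction X with
    | zero => simp
    | add X X' h h' => simp only [TensorProduct.add_tmul, TensorProduct.tmul_add, map_add, h, h']
    | tmul v h =>
      induction Y with
      | zero => simp
      | add Y Y' h h' => simp only [TensorProduct.tmul_add, map_add, h, h']
      | tmul w g =>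
        show omega k H (oneH k H ⊗ₜ[k] (h ⊗ₜ[k] g)) • (u ⊗ₜ[k] (v ⊗ₜ[k] w)) = _
        rw [omega_left]
        simp only [LinearMap.lTensor_tmul, TensorProduct.rid_tmul, TensorProduct.tmul_smul,
          ← TensorProduct.smul_tmul', smul_smul, mul_comm]
  show omegaContract k H U V W ((rho k H U u ⊗ₜ[k] rho k H V v) ⊗ₜ[k] rho k H W w) = _
  rw [mem_coinvariants.1 hu, key, counit_rho, counit_rho]

end Contract

variable {A : Type*} [AddCommGroup A] [Module k A] [ComoduleAlgebra k H A]
variable {M : Type*} [AddCommGroup M] [Module k M] [HopfModule k H A M]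

theorem actM_one (m : M) : actM k H A M (m ⊗ₜ[k] oneA k H A) = m := HopfModule.act_one m

theorem actM_actM (m : M) (a b : A) : actM k H A M (actM k H A M (m ⊗ₜ[k] a) ⊗ₜ[k] b) =
    actM k H A M (LinearMap.lTensor M (mulA k H A)
      (reassociator k H M A A ((m ⊗ₜ[k] a) ⊗ₜ[k] b))) :=
  LinearMap.congr_fun (HopfModule.act_act (k := k) (H := H) (A := A) (M := M))
    ((m ⊗ₜ[k] a) ⊗ₜ[k] b)

theorem actM_actM_coinv (m : M) {b : A} (hb : b ∈ coinvariants k H A) (a : A) :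
    actM k H A M (actM k H A M (m ⊗ₜ[k] b) ⊗ₜ[k] a) =
      actM k H A M (m ⊗ₜ[k] mulA k H A (b ⊗ₜ[k] a)) := by
  rw [actM_actM, reassociator_middle m hb a]
  rfl

theorem rho_actM (m : M) (a : A) : rho k H M (actM k H A M (m ⊗ₜ[k] a)) =
    LinearMap.rTensor H (actM k H A M) (codiag k H M A (m ⊗ₜ[k] a)) :=
  LinearMap.congr_fun (HopfModule.coact_act (k := k) (H := H) (A := A) (M := M)) (m ⊗ₜ[k] a)

theorem actM_mem {m : M} (hm : m ∈ coinvariants k H M) {b : A} (hb : b ∈ coinvariants k H A) :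
    actM k H A M (m ⊗ₜ[k] b) ∈ coinvariants k H M := by
  rw [mem_coinvariants, rho_actM]
  show LinearMap.rTensor H (actM k H A M) (LinearMap.lTensor (M ⊗[k] A) (mulH k H)
    (TensorProduct.tensorTensorTensorComm k M H A H (rho k H M m ⊗ₜ[k] rho k H A b))) = _
  rw [mem_coinvariants.1 hm, mem_coinvariants.1 hb]
  show actM k H A M (m ⊗ₜ[k] b) ⊗ₜ[k] mulH k H (oneH k H ⊗ₜ[k] oneH k H) = _
  rw [mulH_one_one]

theorem oneA_mem : oneA k H A ∈ coinvariants k H A := ComoduleAlgebra.coact_one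

theorem mulA_mem {a b : A} (ha : a ∈ coinvariants k H A) (hb : b ∈ coinvariants k H A) :
    mulA k H A (a ⊗ₜ[k] b) ∈ coinvariants k H A :=
  actM_mem (A := A) (M := A) ha hb

/-- `(ab)c = a(bc)` when `b` is coinvariant. -/
theorem mulA_assoc_middle (a : A) {b : A} (hb : b ∈ coinvariants k H A) (c : A) :
    mulA k H A (mulA k H A (a ⊗ₜ[k] b) ⊗ₜ[k] c) =
      mulA k H A (a ⊗ₜ[k] mulA k H A (b ⊗ₜ[k] c)) :=
  actM_actM_coinv (A := A) (M := A) a hb c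

/-- `(ab)c = a(bc)` when `a` is coinvariant. -/
theorem mulA_assoc_left {a : A} (ha : a ∈ coinvariants k H A) (b c : A) :
    mulA k H A (mulA k H A (a ⊗ₜ[k] b) ⊗ₜ[k] c) =
      mulA k H A (a ⊗ₜ[k] mulA k H A (b ⊗ₜ[k] c)) := by
  refine (actM_actM (k := k) (H := H) (A := A) (M := A) a b c).trans ?_
  rw [reassociator_left ha b c]
  rfl

/-- The coinvariants `B` of a comodule algebra form an associative ring with unit, with the
multiplication of `A`. -/
instance instRingCoinvariants : Ring (coinvariants k H A) :=
  { (inferInstance : AddCommGroup (coinvariants k H A)) with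
    mul := fun a b => ⟨mulA k H A (a.1 ⊗ₜ[k] b.1), mulA_mem a.2 b.2⟩
    one := ⟨oneA k H A, oneA_mem⟩
    left_distrib := fun a b c => Subtype.ext <| by
      show mulA k H A (a.1 ⊗ₜ[k] (b.1 + c.1)) = _
      rw [TensorProduct.tmul_add, map_add]; rfl
    right_distrib := fun a b c => Subtype.ext <| by
      show mulA k H A ((a.1 + b.1) ⊗ₜ[k] c.1) = _
      rw [TensorProduct.add_tmul, map_add]; rfl
    zero_mul := fun a => Subtype.ext <| by
      show mulA k H A ((0 : A) ⊗ₜ[k] a.1) = 0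
      rw [TensorProduct.zero_tmul, map_zero]
    mul_zero := fun a => Subtype.ext <| by
      show mulA k H A (a.1 ⊗ₜ[k] (0 : A)) = 0
      rw [TensorProduct.tmul_zero, map_zero]
    mul_assoc := fun a b c => Subtype.ext (mulA_assoc_middle a.1 b.2 c.1)
    one_mul := fun a => Subtype.ext (ComoduleAlgebra.one_mul (H := H) a.1)
    mul_one := fun a => Subtype.ext (ComoduleAlgebra.mul_one (H := H) a.1) }

theorem coe_mul (a b : coinvariants k H A) :
    ((a * b : coinvariants k H A) : A) = mulA k H A (a.1 ⊗ₜ[k] b.1) := rfl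

theorem coe_one : ((1 : coinvariants k H A) : A) = oneA k H A := rfl

/-- `B` is a `k`-algebra, with the scalar multiplication of `A`. -/
instance instAlgebraCoinvariants : Algebra k (coinvariants k H A) :=
  Algebra.ofModule
    (fun c a b => Subtype.ext <| by
      show mulA k H A ((c • a.1) ⊗ₜ[k] b.1) = c • mulA k H A (a.1 ⊗ₜ[k] b.1)
      rw [← TensorProduct.smul_tmul', map_smul])
    (fun c a b => Subtype.ext <| by
      show mulA k H A (a.1 ⊗ₜ[k] (c • b.1)) = c • mulA k H A (a.1 ⊗ₜ[k] b.1)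
      rw [TensorProduct.tmul_smul, map_smul])

/-- Every relative Hopf module is a right `B`-module by restriction of the action of `A`. -/
instance instModuleHopf : Module (coinvariants k H A)ᵐᵒᵖ M where
  smul b m := actM k H A M (m ⊗ₜ[k] b.unop.1)
  one_smul m := actM_one m
  mul_smul b c m := (actM_actM_coinv m c.unop.2 b.unop.1).symm
  smul_zero b := by
    show actM k H A M ((0 : M) ⊗ₜ[k] b.unop.1) = 0
    rw [TensorProduct.zero_tmul, map_zero]
  smul_add b m n := by
    show actM k H A M ((m + n) ⊗ₜ[k] b.unop.1) = _
    rw [TensorProduct.add_tmul, map_add]; rfl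
  add_smul b c m := by
    show actM k H A M (m ⊗ₜ[k] (b.unop.1 + c.unop.1)) = _
    rw [TensorProduct.tmul_add, map_add]; rfl
  zero_smul m := by
    show actM k H A M (m ⊗ₜ[k] (0 : A)) = 0
    rw [TensorProduct.tmul_zero, map_zero]

theorem op_smul_def (b : (coinvariants k H A)ᵐᵒᵖ) (m : M) :
    b • m = actM k H A M (m ⊗ₜ[k] b.unop.1) := rfl

instance instTowerHopf : IsScalarTower k (coinvariants k H A)ᵐᵒᵖ M where
  smul_assoc c b m := by
    show actM k H A M (m ⊗ₜ[k] (c • b.unop.1)) = c • actM k H A M (m ⊗ₜ[k] b.unop.1)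
    rw [TensorProduct.tmul_smul, map_smul]

/-- The coinvariants `M^{coH}` of a relative Hopf module form a right `B`-module. -/
instance instModuleCoinvariants :
    Module (coinvariants k H A)ᵐᵒᵖ (coinvariants k H M) where
  smul b m := ⟨b • m.1, actM_mem m.2 b.unop.2⟩
  one_smul m := Subtype.ext (one_smul _ m.1)
  mul_smul b c m := Subtype.ext (mul_smul b c m.1)
  smul_zero b := Subtype.ext (smul_zero b)
  smul_add b m n := Subtype.ext (smul_add b m.1 n.1)
  add_smul b c m := Subtype.ext (add_smul b c m.1)
  zero_smul m := Subtype.ext (zero_smul _ m.1)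

theorem coe_op_smul (b : (coinvariants k H A)ᵐᵒᵖ) (m : coinvariants k H M) :
    ((b • m : coinvariants k H M) : M) = b • (m : M) := rfl

end Coinvariants

/-! ### Induction `N ↦ N ⊗_B A` -/

section Induced

variable (k H : Type*) [Field k] [AddCommGroup H] [Module k H] [Coalgebra k H]
  [CoquasiBialgebra k H]
variable (A : Type*) [AddCommGroup A] [Module k A] [ComoduleAlgebra k H A]
variable (N : Type*) [AddCommGroup N] [Module k N] [Module (coinvariants k H A)ᵐᵒᵖ N]

/-- The subspace of `N ⊗ A` spanned by the elements `nb ⊗ a - n ⊗ ba` with `b ∈ B`. -/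
def balancing : Submodule k (N ⊗[k] A) :=
  Submodule.span k {x | ∃ (n : N) (b : coinvariants k H A) (a : A),
    x = (MulOpposite.op b • n) ⊗ₜ[k] a - n ⊗ₜ[k] mulA k H A (b.1 ⊗ₜ[k] a)}

/-- The tensor product `N ⊗_B A` of a right `B`-module `N` with the left `B`-module `A`. -/
abbrev TensorB := (N ⊗[k] A) ⧸ balancing k H A N

/-- The canonical projection `N ⊗ A → N ⊗_B A`, `n ⊗ a ↦ n ⊗_B a`. -/
def tensorBMk : N ⊗[k] A →ₗ[k] TensorB k H A N := (balancing k H A N).mkQ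

variable {k H A N}

theorem tensorBMk_balanced (n : N) (b : coinvariants k H A) (a : A) :
    tensorBMk k H A N ((MulOpposite.op b • n) ⊗ₜ[k] a) =
      tensorBMk k H A N (n ⊗ₜ[k] mulA k H A (b.1 ⊗ₜ[k] a)) :=
  (Submodule.Quotient.eq _).2 (Submodule.subset_span ⟨n, b, a, rfl⟩)

/-- A balanced linear map on `N ⊗ A` descends to `N ⊗_B A`. -/
def tensorBLift {P : Type*} [AddCommGroup P] [Module k P] (f : N ⊗[k] A →ₗ[k] P)
    (hf : ∀ (n : N) (b : coinvariants k H A) (a : A),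
      f ((MulOpposite.op b • n) ⊗ₜ[k] a) = f (n ⊗ₜ[k] mulA k H A (b.1 ⊗ₜ[k] a))) :
    TensorB k H A N →ₗ[k] P :=
  (balancing k H A N).liftQ f <| Submodule.span_le.2 <| by
    rintro _ ⟨n, b, a, rfl⟩
    show f _ = 0
    rw [map_sub, hf, sub_self]

@[simp]
theorem tensorBLift_mk {P : Type*} [AddCommGroup P] [Module k P] (f : N ⊗[k] A →ₗ[k] P)
    (hf : ∀ (n : N) (b : coinvariants k H A) (a : A),
      f ((MulOpposite.op b • n) ⊗ₜ[k] a) = f (n ⊗ₜ[k] mulA k H A (b.1 ⊗ₜ[k] a)))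
    (x : N ⊗[k] A) : tensorBLift f hf (tensorBMk k H A N x) = f x := rfl

theorem tensorB_ext {P : Type*} [AddCommGroup P] [Module k P] {f g : TensorB k H A N →ₗ[k] P}
    (h : ∀ (n : N) (a : A),
      f (tensorBMk k H A N (n ⊗ₜ[k] a)) = g (tensorBMk k H A N (n ⊗ₜ[k] a))) : f = g :=
  Submodule.linearMap_qext _ (TensorProduct.ext' h)

/-- For coinvariant `b`, `ρ(ba) = ba₀ ⊗ a₁`. -/
theorem rho_mul_coinv (b : coinvariants k H A) (a : A) :
    rho k H A (mulA k H A (b.1 ⊗ₜ[k] a)) =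
      LinearMap.rTensor H (mulA k H A ∘ₗ TensorProduct.mk k A A b.1) (rho k H A a) := by
  refine (rho_actM (k := k) (H := H) (A := A) (M := A) b.1 a).trans ?_
  show LinearMap.rTensor H (mulA k H A) (LinearMap.lTensor (A ⊗[k] A) (mulH k H)
    (TensorProduct.tensorTensorTensorComm k A H A H (rho k H A b.1 ⊗ₜ[k] rho k H A a))) = _
  rw [mem_coinvariants.1 b.2]
  generalize rho k H A a = X
  induction X with
  | zero => simp
  | add X Y hX hY => simp only [TensorProduct.tmul_add, map_add, hX, hY]
  | tmul x h =>
    show mulA k H A (b.1 ⊗ₜ[k] x) ⊗ₜ[k] mulH k H (oneH k H ⊗ₜ[k] h) = _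
    rw [show mulH k H (oneH k H ⊗ₜ[k] h) = h from CoquasiBialgebra.one_mul h]
    rfl

/-- For coinvariant `b`, `ρ(ab) = a₀b ⊗ a₁`. -/
theorem rho_mul_coinv_right (a : A) (b : coinvariants k H A) :
    rho k H A (mulA k H A (a ⊗ₜ[k] b.1)) =
      LinearMap.rTensor H (mulA k H A ∘ₗ (TensorProduct.mk k A A).flip b.1) (rho k H A a) := by
  refine (rho_actM (k := k) (H := H) (A := A) (M := A) a b.1).trans ?_
  show LinearMap.rTensor H (mulA k H A) (LinearMap.lTensor (A ⊗[k] A) (mulH k H)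
    (TensorProduct.tensorTensorTensorComm k A H A H (rho k H A a ⊗ₜ[k] rho k H A b.1))) = _
  rw [mem_coinvariants.1 b.2]
  generalize rho k H A a = X
  induction X with
  | zero => simp
  | add X Y hX hY => simp only [TensorProduct.add_tmul, map_add, hX, hY]
  | tmul x h =>
    show mulA k H A (x ⊗ₜ[k] b.1) ⊗ₜ[k] mulH k H (h ⊗ₜ[k] oneH k H) = _
    rw [show mulH k H (h ⊗ₜ[k] oneH k H) = h from CoquasiBialgebra.mul_one h]
    rfl

variable (k H A N)

/-- The coaction `n ⊗_B a ↦ (n ⊗_B a₀) ⊗ a₁` on `N ⊗_B A`. -/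
def tensorBCoact : TensorB k H A N →ₗ[k] TensorB k H A N ⊗[k] H :=
  tensorBLift (LinearMap.rTensor H (tensorBMk k H A N) ∘ₗ
      (TensorProduct.assoc k N A H).symm.toLinearMap ∘ₗ LinearMap.lTensor N (rho k H A)) <| by
    intro n b a
    simp only [LinearMap.comp_apply, LinearMap.lTensor_tmul, rho_mul_coinv]
    generalize rho k H A a = X
    induction X with
    | zero => simp
    | add X Y hX hY => simp only [TensorProduct.tmul_add, map_add, hX, hY]
    | tmul x h =>
      exact congrArg (fun z => z ⊗ₜ[k] h) (tensorBMk_balanced n b x)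

/-- The action `(n ⊗_B a) ⊗ a' ↦ n ⊗_B aa'` on `N ⊗_B A`. -/
def tensorBAct : TensorB k H A N ⊗[k] A →ₗ[k] TensorB k H A N :=
  TensorProduct.lift <|
    tensorBLift (TensorProduct.curry (tensorBMk k H A N ∘ₗ LinearMap.lTensor N (mulA k H A) ∘ₗ
      (TensorProduct.assoc k N A A).toLinearMap)) <| by
    intro n b a
    ext c
    show tensorBMk k H A N ((MulOpposite.op b • n) ⊗ₜ[k] mulA k H A (a ⊗ₜ[k] c)) =
      tensorBMk k H A N (n ⊗ₜ[k] mulA k H A (mulA k H A (b.1 ⊗ₜ[k] a) ⊗ₜ[k] c))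
    rw [tensorBMk_balanced, mulA_assoc_left b.2]

variable {k H A N}

theorem tensorBCoact_mk (n : N) (a : A) :
    tensorBCoact k H A N (tensorBMk k H A N (n ⊗ₜ[k] a)) =
      LinearMap.rTensor H (tensorBMk k H A N ∘ₗ TensorProduct.mk k N A n) (rho k H A a) := by
  show LinearMap.rTensor H (tensorBMk k H A N)
    ((TensorProduct.assoc k N A H).symm (n ⊗ₜ[k] rho k H A a)) = _
  generalize rho k H A a = X
  induction X with
  | zero => simp
  | add X Y hX hY => simp only [TensorProduct.tmul_add, map_add, hX, hY]
  | tmul x h => rfl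

theorem tensorBAct_mk (n : N) (a c : A) :
    tensorBAct k H A N (tensorBMk k H A N (n ⊗ₜ[k] a) ⊗ₜ[k] c) =
      tensorBMk k H A N (n ⊗ₜ[k] mulA k H A (a ⊗ₜ[k] c)) := rfl

instance instRightComoduleTensorB : RightComodule k H (TensorB k H A N) where
  coact := tensorBCoact k H A N
  coassoc := by
    apply tensorB_ext
    intro n a
    simp only [LinearMap.comp_apply, tensorBCoact_mk]
    have hA := LinearMap.congr_fun (RightComodule.coassoc (k := k) (H := H) (M := A)) a
    let φ : A →ₗ[k] TensorB k H A N := tensorBMk k H A N ∘ₗ TensorProduct.mk k N A n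
    have h1 := congrArg (LinearMap.rTensor (H ⊗[k] H) φ) hA
    have e1 : ∀ X : A ⊗[k] H, (TensorProduct.assoc k (TensorB k H A N) H H)
        (LinearMap.rTensor H (tensorBCoact k H A N) (LinearMap.rTensor H φ X)) =
        LinearMap.rTensor (H ⊗[k] H) φ (TensorProduct.assoc k A H H
          (LinearMap.rTensor H (rho k H A) X)) := by
      intro X
      induction X with
      | zero => simp
      | add X Y hX hY => simp only [map_add, hX, hY]
      | tmul x h =>
        show (TensorProduct.assoc k (TensorB k H A N) H H)
          (tensorBCoact k H A N (tensorBMk k H A N (n ⊗ₜ[k] x)) ⊗ₜ[k] h) =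
          LinearMap.rTensor (H ⊗[k] H) φ (TensorProduct.assoc k A H H (rho k H A x ⊗ₜ[k] h))
        rw [tensorBCoact_mk]
        generalize rho k H A x = Y
        induction Y with
        | zero => simp
        | add X Y hX hY => simp only [TensorProduct.add_tmul, map_add, hX, hY]
        | tmul y g => rfl
    have e2 : ∀ X : A ⊗[k] H, LinearMap.lTensor (TensorB k H A N) Coalgebra.comul
        (LinearMap.rTensor H φ X) =
        LinearMap.rTensor (H ⊗[k] H) φ (LinearMap.lTensor A Coalgebra.comul X) := by
      intro X
      induction X with
      | zero => simp
      | add X Y hX hY => simp only [map_add, hX, hY]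
      | tmul x h => rfl
    exact (e1 _).trans (h1.trans (e2 _).symm)
  counit_coact := by
    apply tensorB_ext
    intro n a
    simp only [LinearMap.comp_apply, tensorBCoact_mk]
    let φ : A →ₗ[k] TensorB k H A N := tensorBMk k H A N ∘ₗ TensorProduct.mk k N A n
    have e : ∀ X : A ⊗[k] H, TensorProduct.rid k (TensorB k H A N)
        (LinearMap.lTensor (TensorB k H A N) Coalgebra.counit (LinearMap.rTensor H φ X)) =
        φ (TensorProduct.rid k A (LinearMap.lTensor A Coalgebra.counit X)) := by
      intro X
      induction X with
      | zero => simp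
      | add X Y hX hY => simp only [map_add, hX, hY]
      | tmul x h => simp
    refine (e _).trans ?_
    rw [counit_rho]
    rfl

theorem rho_tensorB (n : N) (a : A) :
    rho k H (TensorB k H A N) (tensorBMk k H A N (n ⊗ₜ[k] a)) =
      LinearMap.rTensor H (tensorBMk k H A N ∘ₗ TensorProduct.mk k N A n) (rho k H A a) :=
  tensorBCoact_mk n a

/-- `N ⊗_B A` is a relative Hopf module. -/
instance instHopfModuleTensorB : HopfModule k H A (TensorB k H A N) where
  act := tensorBAct k H A N
  act_one := by
    intro x
    have : tensorBAct k H A N ∘ₗ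
        (TensorProduct.mk k (TensorB k H A N) A).flip (oneA k H A) = LinearMap.id := by
      apply tensorB_ext
      intro n a
      show tensorBMk k H A N (n ⊗ₜ[k] mulA k H A (a ⊗ₜ[k] oneA k H A)) = _
      rw [show mulA k H A (a ⊗ₜ[k] oneA k H A) = a from ComoduleAlgebra.mul_one (H := H) a]
      rfl
    exact LinearMap.congr_fun this x
  coact_act := by
    apply TensorProduct.ext'
    intro x c
    obtain ⟨y, rfl⟩ := Submodule.mkQ_surjective _ x
    induction y with
    | zero => simp
    | add y z hy hz => simp only [TensorProduct.add_tmul, map_add, hy, hz]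
    | tmul n a =>
    let φ : A →ₗ[k] TensorB k H A N := tensorBMk k H A N ∘ₗ TensorProduct.mk k N A n
    show rho k H (TensorB k H A N) (tensorBMk k H A N (n ⊗ₜ[k] mulA k H A (a ⊗ₜ[k] c))) =
      LinearMap.rTensor H (tensorBAct k H A N) (LinearMap.lTensor _ (mulH k H)
        (TensorProduct.tensorTensorTensorComm k _ H A H
          (rho k H (TensorB k H A N) (tensorBMk k H A N (n ⊗ₜ[k] a)) ⊗ₜ[k] rho k H A c)))
    rw [rho_tensorB, rho_tensorB]
    have hA : rho k H A (mulA k H A (a ⊗ₜ[k] c)) = LinearMap.rTensor H (mulA k H A)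
        (LinearMap.lTensor (A ⊗[k] A) (mulH k H)
          (TensorProduct.tensorTensorTensorComm k A H A H (rho k H A a ⊗ₜ[k] rho k H A c))) :=
      rho_actM (k := k) (H := H) (A := A) (M := A) a c
    rw [hA]
    generalize rho k H A a = X
    generalize rho k H A c = Y
    induction X with
    | zero => simp
    | add X X' hX hX' => simp only [TensorProduct.add_tmul, map_add, hX, hX']
    | tmul x h =>
      induction Y with
      | zero => simp
      | add Y Y' hY hY' => simp only [TensorProduct.tmul_add, map_add, hY, hY']
      | tmul y g => rfl
  act_act := by
    apply TensorProduct.ext_threefold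
    intro x b c
    have : ∀ (n : N) (a : A),
        tensorBAct k H A N (tensorBAct k H A N
          (tensorBMk k H A N (n ⊗ₜ[k] a) ⊗ₜ[k] b) ⊗ₜ[k] c) =
        tensorBAct k H A N (LinearMap.lTensor (TensorB k H A N) (mulA k H A)
          (reassociator k H (TensorB k H A N) A A
            ((tensorBMk k H A N (n ⊗ₜ[k] a) ⊗ₜ[k] b) ⊗ₜ[k] c))) := by
      intro n a
      let φ : A →ₗ[k] TensorB k H A N := tensorBMk k H A N ∘ₗ TensorProduct.mk k N A n
      have h1 : tensorBAct k H A N (tensorBAct k H A N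
          (tensorBMk k H A N (n ⊗ₜ[k] a) ⊗ₜ[k] b) ⊗ₜ[k] c) =
          φ (mulA k H A (LinearMap.lTensor A (mulA k H A)
            (reassociator k H A A A ((a ⊗ₜ[k] b) ⊗ₜ[k] c)))) :=
        congrArg φ (actM_actM (k := k) (H := H) (A := A) (M := A) a b c)
      rw [h1]
      show φ (mulA k H A (LinearMap.lTensor A (mulA k H A)
          (omegaContract k H A A A ((rho k H A a ⊗ₜ[k] rho k H A b) ⊗ₜ[k] rho k H A c)))) =
        tensorBAct k H A N (LinearMap.lTensor (TensorB k H A N) (mulA k H A)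
          (omegaContract k H (TensorB k H A N) A A
            ((rho k H (TensorB k H A N) (tensorBMk k H A N (n ⊗ₜ[k] a)) ⊗ₜ[k]
              rho k H A b) ⊗ₜ[k] rho k H A c)))
      rw [rho_tensorB]
      generalize rho k H A a = X
      generalize rho k H A b = Y
      generalize rho k H A c = Z
      induction X with
      | zero => simp
      | add X X' hX hX' => simp only [TensorProduct.add_tmul, map_add, hX, hX']
      | tmul x h =>
        induction Y with
        | zero => simp
        | add Y Y' hY hY' =>
          simp only [TensorProduct.add_tmul, TensorProduct.tmul_add, map_add, hY, hY']
        | tmul y g =>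
          induction Z with
          | zero => simp
          | add Z Z' hZ hZ' => simp only [TensorProduct.tmul_add, map_add, hZ, hZ']
          | tmul z l =>
            show φ (mulA k H A (LinearMap.lTensor A (mulA k H A)
              (omega k H (h ⊗ₜ[k] (g ⊗ₜ[k] l)) • (x ⊗ₜ[k] (y ⊗ₜ[k] z))))) =
              tensorBAct k H A N (LinearMap.lTensor (TensorB k H A N) (mulA k H A)
                (omega k H (h ⊗ₜ[k] (g ⊗ₜ[k] l)) • (φ x ⊗ₜ[k] (y ⊗ₜ[k] z))))
            simp only [map_smul]
            rfl
    obtain ⟨y, rfl⟩ := Submodule.mkQ_surjective _ x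
    induction y with
    | zero => simp
    | add y z hy hz => simp only [TensorProduct.add_tmul, map_add, hy, hz]
    | tmul n a => exact this n a

end Induced

/-! ### The canonical map and total integrals -/

section Galois

variable (k H : Type*) [Field k] [AddCommGroup H] [Module k H] [Coalgebra k H]
  [CoquasiHopfAlgebra k H]

/-- The antipode `S` of a coquasi-Hopf algebra. -/
def antipode : H →ₗ[k] H := CoquasiHopfAlgebra.S

/-- The functional `β` of a coquasi-Hopf algebra. -/
def beta : H →ₗ[k] k := CoquasiHopfAlgebra.β

/-- The map `h ⊗ g ↦ ω⁻¹(h, g₁ β(g₂), S(g₃)) g₄`. -/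
def canTwist : H ⊗[k] H →ₗ[k] H :=
  (TensorProduct.lid k H).toLinearMap ∘ₗ
    LinearMap.rTensor H (omegaInv k H) ∘ₗ
    (TensorProduct.assoc k H (H ⊗[k] H) H).symm.toLinearMap ∘ₗ
    LinearMap.lTensor H ((TensorProduct.assoc k H H H).symm.toLinearMap ∘ₗ
      TensorProduct.map (convR LinearMap.id (beta k H)) (LinearMap.rTensor H (antipode k H)) ∘ₗ
      comul₃ k H)

variable (A : Type*) [AddCommGroup A] [Module k A] [ComoduleAlgebra k H A]

/-- The map `a ⊗ b ↦ a₀b₀ ⊗ ω⁻¹(a₁, b₁ β(b₂), S(b₃)) b₄` on `A ⊗ A`. -/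
def canPre : A ⊗[k] A →ₗ[k] A ⊗[k] H :=
  TensorProduct.map (mulA k H A) (canTwist k H) ∘ₗ
    (TensorProduct.tensorTensorTensorComm k A H A H).toLinearMap ∘ₗ
    TensorProduct.map (rho k H A) (rho k H A)

/-- The canonical (Galois) map `can : A ⊗_B A → A ⊗ H`,
`a ⊗_B b ↦ a₀b₀ ⊗ ω⁻¹(a₁, b₁ β(b₂), S(b₃)) b₄`. -/
def can : TensorB k H A A →ₗ[k] A ⊗[k] H :=
  tensorBLift (canPre k H A) <| by
    intro a b c
    show TensorProduct.map (mulA k H A) (canTwist k H)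
        (TensorProduct.tensorTensorTensorComm k A H A H
          (rho k H A (mulA k H A (a ⊗ₜ[k] b.1)) ⊗ₜ[k] rho k H A c)) =
      TensorProduct.map (mulA k H A) (canTwist k H)
        (TensorProduct.tensorTensorTensorComm k A H A H
          (rho k H A a ⊗ₜ[k] rho k H A (mulA k H A (b.1 ⊗ₜ[k] c))))
    rw [rho_mul_coinv, rho_mul_coinv_right]
    generalize rho k H A a = X
    generalize rho k H A c = Y
    induction X with
    | zero => simp
    | add X X' hX hX' => simp only [TensorProduct.add_tmul, map_add, hX, hX']
    | tmul x h =>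
      induction Y with
      | zero => simp
      | add Y Y' hY hY' => simp only [TensorProduct.tmul_add, map_add, hY, hY']
      | tmul y g =>
        exact congrArg (fun z => z ⊗ₜ[k] canTwist k H (h ⊗ₜ[k] g)) (mulA_assoc_middle x b.2 y)

end Galois

/-- A total integral: a colinear map `γ : H → A` with `γ(1) = 1`, where `H` is a right comodule
over itself by the comultiplication. -/
structure IsTotalIntegral (k H A : Type*) [Field k] [AddCommGroup H] [Module k H] [Coalgebra k H]
    [CoquasiBialgebra k H] [AddCommGroup A] [Module k A] [ComoduleAlgebra k H A]
    (γ : H →ₗ[k] A) : Prop where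
  colinear : rho k H A ∘ₗ γ = LinearMap.rTensor H γ ∘ₗ Coalgebra.comul
  map_one : γ (oneH k H) = oneA k H A

/-! ### The category of relative Hopf modules, coinvariants and induction -/

section Categories

universe w

/-- The category `M_A^H` of relative right `(H, A)`-Hopf modules. -/
structure HopfModuleCat (k H A : Type*) [Field k] [AddCommGroup H] [Module k H] [Coalgebra k H]
    [CoquasiBialgebra k H] [AddCommGroup A] [Module k A] [ComoduleAlgebra k H A] where
  of ::
  carrier : Type w
  [addCommGroup : AddCommGroup carrier]
  [module : Module k carrier]
  [hopfModule : HopfModule k H A carrier]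

attribute [instance] HopfModuleCat.addCommGroup HopfModuleCat.module HopfModuleCat.hopfModule

variable {k H A : Type*} [Field k] [AddCommGroup H] [Module k H] [Coalgebra k H]
  [CoquasiBialgebra k H] [AddCommGroup A] [Module k A] [ComoduleAlgebra k H A]

/-- Morphisms of relative Hopf modules: colinear maps that respect the action of `A`. -/
@[ext]
structure HopfModuleHom (M N : HopfModuleCat.{w} k H A) where
  toLinearMap : M.carrier →ₗ[k] N.carrier
  colinear : rho k H N.carrier ∘ₗ toLinearMap =
    LinearMap.rTensor H toLinearMap ∘ₗ rho k H M.carrier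
  map_act : toLinearMap ∘ₗ actM k H A M.carrier =
    actM k H A N.carrier ∘ₗ LinearMap.rTensor A toLinearMap

instance instCategoryHopfModuleCat : Category (HopfModuleCat.{w} k H A) where
  Hom M N := HopfModuleHom M N
  id M :=
    { toLinearMap := LinearMap.id
      colinear := by rw [LinearMap.rTensor_id]; rfl
      map_act := by rw [LinearMap.rTensor_id]; rfl }
  comp f g :=
    { toLinearMap := g.toLinearMap ∘ₗ f.toLinearMap
      colinear := by
        rw [LinearMap.rTensor_comp, LinearMap.comp_assoc, ← f.colinear, ← LinearMap.comp_assoc,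
          g.colinear, LinearMap.comp_assoc]
      map_act := by
        rw [LinearMap.rTensor_comp, LinearMap.comp_assoc, f.map_act, ← LinearMap.comp_assoc,
          g.map_act, LinearMap.comp_assoc] }

/-- The underlying linear map of a morphism of relative Hopf modules. -/
def HopfModuleCat.lin {M N : HopfModuleCat.{w} k H A} (f : M ⟶ N) :
    M.carrier →ₗ[k] N.carrier :=
  HopfModuleHom.toLinearMap f

theorem HopfModuleCat.lin_mem {M N : HopfModuleCat.{w} k H A} (f : M ⟶ N) {m : M.carrier}
    (hm : m ∈ coinvariants k H M.carrier) :
    HopfModuleCat.lin f m ∈ coinvariants k H N.carrier := by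
  refine (LinearMap.congr_fun (HopfModuleHom.colinear f) m).trans ?_
  rw [LinearMap.comp_apply, mem_coinvariants.1 hm]
  rfl

theorem HopfModuleCat.lin_act {M N : HopfModuleCat.{w} k H A} (f : M ⟶ N) (m : M.carrier)
    (a : A) : HopfModuleCat.lin f (actM k H A M.carrier (m ⊗ₜ[k] a)) =
      actM k H A N.carrier (HopfModuleCat.lin f m ⊗ₜ[k] a) :=
  LinearMap.congr_fun (HopfModuleHom.map_act f) (m ⊗ₜ[k] a)

variable (k H A) in
/-- The functor of coinvariants `M ↦ M^{coH}` from relative Hopf modules to right `B`-modules,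
which are modules over the opposite ring of `B`. -/
def coinvariantsFunctor :
    HopfModuleCat.{w} k H A ⥤ ModuleCat.{w} (coinvariants k H A)ᵐᵒᵖ where
  obj M := ModuleCat.of _ (coinvariants k H M.carrier)
  map f := ModuleCat.ofHom
    { toFun := fun m => ⟨HopfModuleCat.lin f m.1, HopfModuleCat.lin_mem f m.2⟩
      map_add' := fun x y => Subtype.ext (map_add _ x.1 y.1)
      map_smul' := fun b x => Subtype.ext (HopfModuleCat.lin_act f x.1 b.unop.1) }
  map_id _ := rfl
  map_comp _ _ := rfl

end Categories

section Induction

open scoped ModuleCat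

universe v w

variable (k H : Type*) (A : Type v) [Field k] [AddCommGroup H] [Module k H] [Coalgebra k H]
  [CoquasiBialgebra k H] [AddCommGroup A] [Module k A] [ComoduleAlgebra k H A]

/-- The relative Hopf module `N ⊗_B A` induced by a right `B`-module `N`; the `k`-linear structure
on `N` is the one that comes from `k → B`. -/
def inducedObj (N : ModuleCat.{max v w} (coinvariants k H A)ᵐᵒᵖ) :
    HopfModuleCat.{max v w} k H A :=
  HopfModuleCat.of (TensorB k H A N)

variable {k H A} in
/-- The element `n ⊗_B a` of the induced module `N ⊗_B A`. -/
def inducedMk (N : ModuleCat.{max v w} (coinvariants k H A)ᵐᵒᵖ) (n : N) (a : A) :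
    (inducedObj.{v, w} k H A N).carrier :=
  tensorBMk k H A N (n ⊗ₜ[k] a)

variable {k H A} in
/-- The map `n ⊗_B a ↦ f(n) ⊗_B a`. -/
def inducedMap {N P : ModuleCat.{max v w} (coinvariants k H A)ᵐᵒᵖ} (f : N ⟶ P) :
    inducedObj.{v, w} k H A N ⟶ inducedObj.{v, w} k H A P :=
  let φ : N →ₗ[k] P := f.hom.restrictScalars k
  let F : TensorB k H A N →ₗ[k] TensorB k H A P :=
    tensorBLift (tensorBMk k H A P ∘ₗ LinearMap.rTensor A φ) (by
      intro n b a
      show tensorBMk k H A P (f.hom (MulOpposite.op b • n) ⊗ₜ[k] a) =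
        tensorBMk k H A P (f.hom n ⊗ₜ[k] mulA k H A (b.1 ⊗ₜ[k] a))
      rw [map_smul, tensorBMk_balanced])
  HopfModuleHom.mk (M := inducedObj.{v, w} k H A N) (N := inducedObj.{v, w} k H A P) F
    (by
      apply tensorB_ext
      intro n a
      show rho k H (TensorB k H A P) (tensorBMk k H A P (φ n ⊗ₜ[k] a)) =
        LinearMap.rTensor H F (rho k H (TensorB k H A N) (tensorBMk k H A N (n ⊗ₜ[k] a)))
      rw [rho_tensorB, rho_tensorB]
      exact LinearMap.congr_fun (LinearMap.rTensor_comp H F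
        (tensorBMk k H A N ∘ₗ TensorProduct.mk k N A n)) (rho k H A a))
    (by
      have h : F ∘ₗ actM k H A (TensorB k H A N) =
          actM k H A (TensorB k H A P) ∘ₗ LinearMap.rTensor A F := by
        apply TensorProduct.ext'
        intro x c
        obtain ⟨y, rfl⟩ := Submodule.mkQ_surjective _ x
        induction y with
        | zero => simp
        | add y z hy hz => simp only [TensorProduct.add_tmul, map_add, hy, hz]
        | tmul n a => rfl
      exact h)

/-- The induction functor `N ↦ N ⊗_B A` from right `B`-modules to relative Hopf modules. -/
def inductionFunctor :
    ModuleCat.{max v w} (coinvariants k H A)ᵐᵒᵖ ⥤ HopfModuleCat.{max v w} k H A where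
  obj N := inducedObj.{v, w} k H A N
  map f := inducedMap.{v, w} f
  map_id N := by
    apply HopfModuleHom.ext
    apply tensorB_ext
    intro n a
    rfl
  map_comp f g := by
    apply HopfModuleHom.ext
    apply tensorB_ext
    intro n a
    rfl

end Induction

end

end CoquasiHopf

universe u₁ u₂ v w

/-! A total integral makes every relative Hopf module a retract, in a natural way, of something
cofree. For `m` in `M` the map `f_m(h) = m₀ γ(S(m₄)h₁) ω(m₁β(m₂), S(m₃), h₂)` (`cofreeAct`) is
colinear from `H` to `M` (`rho_cofreeAct`), it is compatible with morphisms of Hopf modules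
(`map_cofreeAct`), and `m` is recovered as `∑ α(m₁) f_{m₀}(m₂)` (`sw_cofreeAct`). The reassociator
factor is exactly what corrects the missing associativity of `H`.

Unit. The element `f_m(1)` is coinvariant and equals `β(1)m` if `m` already is; moreover `β(1)α(1) =
1`, so `β(1)` can be inverted. For `M = A` this gives a left `B`-linear map `t : A → B` with `t(1) =
β(1)` (`trace`). The map `n ⊗ a ↦ n t(a)` inverts `u_N` from the left up to the scalar `β(1)`,
whence injectivity. Naturality gives `f_{n ⊗ a}(1) = n t(a) ⊗ 1`, so every coinvariant of `N ⊗_B A`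
has the form `n ⊗ 1`.

Counit. For a colinear `f : H → M` and `x` in `A`, the element `t_f(x) = f(S⁻¹(x₂)) β(S⁻¹(x₁)) x₀`
is coinvariant (`translate_mem`). The central fact is `sw_translate_act`: if `can` sends `∑ x ⊗ y`
to `1 ⊗ h`, then `∑ t_f(x) y = f(h)`. It is checked after applying the map `m ↦ m₀ ⊗ β(m₁)m₂`, which
is injective (`betaCoact_injective`). The image of `t_f(x) y` depends on `x ⊗ y` only through `can(x
⊗ y)`. Two computations show this: `mid_omega_eq`, a consequence of the cocycle identity, and
`leftCoact_canPre`, which transports the coaction of the left tensor factor along `can`.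

Now choose `∑ x ⊗ y` over `1 ⊗ h`, linearly in `h`. With `h = m₂`, the retraction formula becomes `m
= ∑ α(m₁) t_{f_{m₀}}(x) y`, so `ε_M` is surjective, and replacing the product by `⊗_B` suggests an
inverse. That it is also a left inverse follows from the same formula in the Hopf module `M^{coH}
⊗_B A`, whose coinvariants are known from the unit half, together with naturality of `t_f`
(`counitMap_bijective`). -/

namespace CoquasiHopf

/-! ### Sweedler notation as finite sums, with linearity checked by `fun_prop` -/

section Sweedler

set_option linter.unusedSectionVars false

variable {k U V W X : Type*} [Field k] [AddCommGroup U] [Module k U] [AddCommGroup V] [Module k V]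
  [AddCommGroup W] [Module k W] [AddCommGroup X] [Module k X]

/-- Linearity of a map, as a predicate that `fun_prop` can check. -/
@[fun_prop]
structure Lin (k : Type*) {U V : Type*} [Field k] [AddCommGroup U] [Module k U]
    [AddCommGroup V] [Module k V] (f : U → V) : Prop where
  isLinearMap : IsLinearMap k f

/-- The linear map with a given linear underlying function. -/
def Lin.toLin {f : U → V} (hf : Lin k f) : U →ₗ[k] V := hf.isLinearMap.mk' f

theorem Lin.toLin_apply {f : U → V} (hf : Lin k f) (u : U) : hf.toLin u = f u := rfl

theorem Lin.map_add {f : U → V} (hf : Lin k f) (x y : U) : f (x + y) = f x + f y :=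
  hf.isLinearMap.map_add x y

theorem Lin.map_smul {f : U → V} (hf : Lin k f) (c : k) (x : U) : f (c • x) = c • f x :=
  hf.isLinearMap.map_smul c x

theorem Lin.map_zero {f : U → V} (hf : Lin k f) : f 0 = 0 := hf.isLinearMap.map_zero

@[fun_prop]
theorem Lin.id : Lin k (fun x : U => x) := ⟨⟨fun _ _ => rfl, fun _ _ => rfl⟩⟩

@[fun_prop]
theorem Lin.comp {f : V → W} {g : U → V} (hf : Lin k f) (hg : Lin k g) :
    Lin k (fun x => f (g x)) :=
  ⟨⟨fun x y => by rw [hg.map_add, hf.map_add], fun c x => by rw [hg.map_smul, hf.map_smul]⟩⟩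

@[fun_prop]
theorem Lin.apply (L : V →ₗ[k] W) {g : U → V} (hg : Lin k g) : Lin k (fun x => L (g x)) :=
  ⟨⟨fun x y => by rw [hg.map_add, _root_.map_add], fun c x => by
    rw [hg.map_smul, _root_.map_smul]⟩⟩

@[fun_prop]
theorem Lin.equiv (L : V ≃ₗ[k] W) {g : U → V} (hg : Lin k g) : Lin k (fun x => L (g x)) :=
  Lin.apply L.toLinearMap hg

@[fun_prop]
theorem Lin.smul_right (c : k) {g : U → V} (hg : Lin k g) : Lin k (fun x => c • g x) :=
  ⟨⟨fun x y => by rw [hg.map_add, smul_add], fun d x => by rw [hg.map_smul, smul_comm]⟩⟩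

@[fun_prop]
theorem Lin.smul_left {g : U → k} (hg : Lin k g) (w : V) : Lin k (fun x => g x • w) :=
  ⟨⟨fun x y => by rw [hg.map_add, add_smul], fun d x => by rw [hg.map_smul, smul_assoc]⟩⟩

@[fun_prop]
theorem Lin.mul_right (c : k) {g : U → k} (hg : Lin k g) : Lin k (fun x => c * g x) :=
  hg.smul_right c

@[fun_prop]
theorem Lin.mul_left {g : U → k} (hg : Lin k g) (c : k) : Lin k (fun x => g x * c) :=
  hg.smul_left c

@[fun_prop]
theorem Lin.tmul_left {g : U → V} (hg : Lin k g) (w : W) : Lin k (fun x => g x ⊗ₜ[k] w) :=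
  ⟨⟨fun x y => by rw [hg.map_add, TensorProduct.add_tmul], fun d x => by
    rw [hg.map_smul, TensorProduct.smul_tmul']⟩⟩

@[fun_prop]
theorem Lin.tmul_right (w : W) {g : U → V} (hg : Lin k g) : Lin k (fun x => w ⊗ₜ[k] g x) :=
  ⟨⟨fun x y => by rw [hg.map_add, TensorProduct.tmul_add], fun d x => by
    rw [hg.map_smul, TensorProduct.tmul_smul]⟩⟩

/-- A chosen decomposition of a tensor into pure tensors. -/
noncomputable def pureTensors (t : U ⊗[k] V) : Multiset (U × V) :=
  (TensorProduct.exists_multiset t).choose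

theorem sum_pureTensors (t : U ⊗[k] V) :
    ((pureTensors t).map fun p => p.1 ⊗ₜ[k] p.2).sum = t :=
  (TensorProduct.exists_multiset t).choose_spec.symm

/-- The Sweedler sum `∑ F(u, v)` over a tensor `t = ∑ u ⊗ v`. -/
noncomputable def sw (t : U ⊗[k] V) (F : U → V → W) : W :=
  ((pureTensors t).map fun p => F p.1 p.2).sum

theorem sw_congr {t : U ⊗[k] V} {F G : U → V → W} (h : ∀ u v, F u v = G u v) :
    sw t F = sw t G := by
  have : F = G := funext fun u => funext (h u)
  rw [this]

theorem map_sw {f : W → X} (hf : Lin k f) (t : U ⊗[k] V) (F : U → V → W) :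
    f (sw t F) = sw t fun u v => f (F u v) := by
  unfold sw
  rw [← hf.toLin_apply, map_multiset_sum, Multiset.map_map]
  rfl

theorem sw_tmul_self (t : U ⊗[k] V) : (sw t fun u v => u ⊗ₜ[k] v) = t := sum_pureTensors t

/-- For bilinear `F` the choice of decomposition behind `sw` does not matter. The summand of `sw` is
nevertheless a bare function, so that nested sums can be written freely; linearity in each variable
is demanded only where independence of the decomposition is used. -/
theorem sw_eq_lift (t : U ⊗[k] V) (F : U →ₗ[k] V →ₗ[k] W) :
    (sw t fun u v => F u v) = TensorProduct.lift F t := by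
  conv_rhs => rw [← sw_tmul_self t]
  rw [map_sw (f := fun z => TensorProduct.lift F z) (by fun_prop)]
  rfl

/-- The bilinear map with a given bilinear underlying function. -/
def bilin {F : U → V → W} (h₁ : ∀ v, Lin k fun u => F u v) (h₂ : ∀ u, Lin k fun v => F u v) :
    U →ₗ[k] V →ₗ[k] W :=
  LinearMap.mk₂ k F (fun x y v => (h₁ v).map_add x y) (fun c x v => (h₁ v).map_smul c x)
    (fun u x y => (h₂ u).map_add x y) (fun c u x => (h₂ u).map_smul c x)

@[fun_prop]
theorem Lin.sw_left {F : U → V → W} {t : X → U ⊗[k] V} (ht : Lin k t)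
    (h₁ : ∀ v, Lin k fun u => F u v) (h₂ : ∀ u, Lin k fun v => F u v) :
    Lin k fun x => sw (t x) F := by
  have : (fun x => sw (t x) F) = fun x => TensorProduct.lift (bilin h₁ h₂) (t x) :=
    funext fun x => sw_eq_lift (t x) (bilin h₁ h₂)
  rw [this]
  fun_prop

@[fun_prop]
theorem Lin.sw_right {F : X → U → V → W} (t : U ⊗[k] V) (hF : ∀ u v, Lin k fun x => F x u v) :
    Lin k fun x => sw t (F x) := by
  refine ⟨⟨fun x y => ?_, fun c x => ?_⟩⟩
  · unfold sw
    rw [← Multiset.sum_map_add]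
    exact congrArg _ (Multiset.map_congr rfl fun p _ => (hF p.1 p.2).map_add x y)
  · unfold sw
    refine Eq.trans ?_ (Multiset.smul_sum (r := c) (s := (pureTensors t).map
      fun p => F x p.1 p.2)).symm
    rw [Multiset.map_map]
    exact congrArg _ (Multiset.map_congr rfl fun p _ => (hF p.1 p.2).map_smul c x)

theorem sw_tmul {F : U → V → W} (h₁ : ∀ v, Lin k fun u => F u v)
    (h₂ : ∀ u, Lin k fun v => F u v) (u : U) (v : V) : sw (u ⊗ₜ[k] v) F = F u v :=
  (sw_eq_lift (u ⊗ₜ[k] v) (bilin h₁ h₂)).trans (TensorProduct.lift.tmul u v)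

theorem sw_sw {X Y : Type*} [AddCommGroup X] [Module k X] [AddCommGroup Y] [Module k Y]
    {F : U → V → W} (h₁ : ∀ v, Lin k fun u => F u v) (h₂ : ∀ u, Lin k fun v => F u v)
    (t : X ⊗[k] Y) (G : X → Y → U ⊗[k] V) :
    sw (sw t G) F = sw t fun x y => sw (G x y) F :=
  map_sw (f := fun z => sw z F) (by fun_prop) t G

/-- Both sides are finite double sums over fixed decompositions, so no linearity is needed. -/
theorem sw_comm {X Y : Type*} [AddCommGroup X] [Module k X] [AddCommGroup Y] [Module k Y]
    (t : U ⊗[k] V) (s : X ⊗[k] Y) (F : U → V → X → Y → W) :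
    (sw t fun u v => sw s fun x y => F u v x y) = sw s fun x y => sw t fun u v => F u v x y := by
  unfold sw
  exact Multiset.sum_map_sum_map _ _

theorem smul_sw (c : k) (t : U ⊗[k] V) (F : U → V → W) :
    c • sw t F = sw t fun u v => c • F u v :=
  map_sw (f := fun z => c • z) (by fun_prop) t F

theorem sw_smul (t : U ⊗[k] V) (F : U → V → k) (w : W) :
    sw t F • w = sw t fun u v => F u v • w :=
  map_sw (f := fun z => z • w) (by fun_prop) t F

theorem mul_sw (c : k) (t : U ⊗[k] V) (F : U → V → k) :
    c * sw t F = sw t fun u v => c * F u v :=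
  map_sw (f := fun z => c * z) (by fun_prop) t F

theorem sw_mul (t : U ⊗[k] V) (F : U → V → k) (c : k) :
    sw t F * c = sw t fun u v => F u v * c :=
  map_sw (f := fun z => z * c) (by fun_prop) t F

theorem linearMap_sw (L : W →ₗ[k] X) (t : U ⊗[k] V) (F : U → V → W) :
    L (sw t F) = sw t fun u v => L (F u v) :=
  map_sw (f := fun z => L z) (by fun_prop) t F

theorem sw_tmul_left (t : U ⊗[k] V) (F : U → V → W) (x : X) :
    sw t F ⊗ₜ[k] x = sw t fun u v => F u v ⊗ₜ[k] x :=
  map_sw (f := fun z => z ⊗ₜ[k] x) (by fun_prop) t F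

theorem sw_tmul_right (t : U ⊗[k] V) (F : U → V → W) (x : X) :
    x ⊗ₜ[k] sw t F = sw t fun u v => x ⊗ₜ[k] F u v :=
  map_sw (f := fun z => x ⊗ₜ[k] z) (by fun_prop) t F

variable {U' V' : Type*} [AddCommGroup U'] [Module k U'] [AddCommGroup V'] [Module k V']

theorem sw_map (f : U →ₗ[k] U') (g : V →ₗ[k] V') (t : U ⊗[k] V) {F : U' → V' → W}
    (h₁ : ∀ v, Lin k fun u => F u v) (h₂ : ∀ u, Lin k fun v => F u v) :
    sw (TensorProduct.map f g t) F = sw t fun u v => F (f u) (g v) := by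
  conv_lhs => rw [← sw_tmul_self t]
  rw [map_sw (f := fun z => sw (TensorProduct.map f g z) F) (by fun_prop)]
  exact sw_congr fun u v => by rw [TensorProduct.map_tmul, sw_tmul h₁ h₂]

section Coalgebra

variable {C : Type*} [AddCommGroup C] [Module k C] [Coalgebra k C]

/-- Read from left to right this moves every further splitting to the right leg. As a rewriting rule
it normalises iterated comultiplications, so two bracketings agree once both are rewritten; the
intermediate sums in later proofs are chosen to make this happen. -/
theorem sw_coassoc {F : C → C → C → W} (h₁ : ∀ b c, Lin k fun a => F a b c)
    (h₂ : ∀ a c, Lin k fun b => F a b c) (h₃ : ∀ a b, Lin k fun c => F a b c) (x : C) :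
    (sw (Coalgebra.comul (R := k) x) fun u c => sw (Coalgebra.comul (R := k) u) fun a b =>
        F a b c) =
      sw (Coalgebra.comul (R := k) x) fun a v => sw (Coalgebra.comul (R := k) v) fun b c =>
        F a b c := by
  let G : C ⊗[k] (C ⊗[k] C) → W := fun z => sw z fun a w => sw w fun b c => F a b c
  have hG : Lin k G := by fun_prop
  have h := congrArg G (Coalgebra.coassoc_apply (R := k) x)
  conv at h => congr <;> rw [← sw_tmul_self (Coalgebra.comul (R := k) x)]
  simp only [linearMap_sw, LinearMap.rTensor_tmul, LinearMap.lTensor_tmul] at h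
  rw [map_sw (f := fun z => G (TensorProduct.assoc k C C C z)) (by fun_prop),
    map_sw hG] at h
  refine Eq.trans (sw_congr fun u c => ?_) (h.trans (sw_congr fun a v => ?_))
  · conv_rhs => rw [← sw_tmul_self (Coalgebra.comul (R := k) u)]
    rw [map_sw (f := fun z => G (TensorProduct.assoc k C C C (z ⊗ₜ[k] c))) (by fun_prop)]
    refine sw_congr fun a b => ?_
    rw [TensorProduct.assoc_tmul]
    show _ = sw _ _
    simp (disch := fun_prop) only [sw_tmul]
  · show sw _ _ = _
    simp (disch := fun_prop) only [sw_tmul]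

theorem sw_counit_left {F : C → W} (hF : Lin k F) (x : C) :
    (sw (Coalgebra.comul (R := k) x) fun a b => Coalgebra.counit (R := k) a • F b) = F x := by
  have h := congrArg (fun z => sw z fun (c : k) b => c • F b) (Coalgebra.rTensor_counit_comul (R := k) x)
  simp (disch := fun_prop) only [sw_tmul, one_smul] at h
  rw [← h]
  simp (disch := fun_prop) only [LinearMap.rTensor, sw_map, LinearMap.id_apply]

theorem sw_counit_right {F : C → W} (hF : Lin k F) (x : C) :
    (sw (Coalgebra.comul (R := k) x) fun a b => Coalgebra.counit (R := k) b • F a) = F x := by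
  have h := congrArg (fun z => sw z fun b (c : k) => c • F b) (Coalgebra.lTensor_counit_comul (R := k) x)
  simp (disch := fun_prop) only [sw_tmul, one_smul] at h
  rw [← h]
  simp (disch := fun_prop) only [LinearMap.lTensor, sw_map, LinearMap.id_apply]

theorem sw_comul_tmul {D : Type*} [AddCommGroup D] [Module k D] [Coalgebra k D]
    {F : C ⊗[k] D → C ⊗[k] D → W} (h₁ : ∀ v, Lin k fun u => F u v)
    (h₂ : ∀ u, Lin k fun v => F u v) (x : C) (y : D) :
    sw (Coalgebra.comul (R := k) (x ⊗ₜ[k] y)) F =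
      sw (Coalgebra.comul (R := k) x) fun x₁ x₂ => sw (Coalgebra.comul (R := k) y) fun y₁ y₂ =>
        F (x₁ ⊗ₜ[k] y₁) (x₂ ⊗ₜ[k] y₂) := by
  let e := TensorProduct.AlgebraTensorModule.tensorTensorTensorComm k k k k C C D D
  rw [TensorProduct.comul_tmul]
  change sw (e _) F = _
  conv_lhs => rw [← sw_tmul_self (Coalgebra.comul (R := k) x),
    ← sw_tmul_self (Coalgebra.comul (R := k) y)]
  simp only [sw_tmul_left, sw_tmul_right]
  have he : Lin k fun z => sw (e z) F := by fun_prop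
  refine (map_sw he _ _).trans (Eq.trans (sw_congr fun y₁ y₂ => (map_sw he _ _).trans
    (sw_congr fun x₁ x₂ => ?_)) (sw_comm _ _ _))
  show sw ((x₁ ⊗ₜ[k] y₁) ⊗ₜ[k] (x₂ ⊗ₜ[k] y₂)) F = _
  exact sw_tmul (F := F) h₁ h₂ (x₁ ⊗ₜ[k] y₁) (x₂ ⊗ₜ[k] y₂)

end Coalgebra

section Comodule

variable {H : Type*} [AddCommGroup H] [Module k H] [Coalgebra k H]
  {M : Type*} [AddCommGroup M] [Module k M] [RightComodule k H M]

theorem sw_rho_coassoc {F : M → H → H → W} (h₁ : ∀ b c, Lin k fun a => F a b c)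
    (h₂ : ∀ a c, Lin k fun b => F a b c) (h₃ : ∀ a b, Lin k fun c => F a b c) (x : M) :
    (sw (rho k H M x) fun u c => sw (rho k H M u) fun a b => F a b c) =
      sw (rho k H M x) fun a v => sw (Coalgebra.comul (R := k) v) fun b c => F a b c := by
  let G : M ⊗[k] (H ⊗[k] H) → W := fun z => sw z fun a w => sw w fun b c => F a b c
  have hG : Lin k G := by fun_prop
  have h := congrArg G (LinearMap.congr_fun (RightComodule.coassoc (k := k) (H := H) (M := M)) x)
  change G (TensorProduct.assoc k M H H (LinearMap.rTensor H (rho k H M) (rho k H M x))) =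
    G (LinearMap.lTensor M Coalgebra.comul (rho k H M x)) at h
  conv at h => congr <;> rw [← sw_tmul_self (rho k H M x)]
  simp only [linearMap_sw, LinearMap.rTensor_tmul, LinearMap.lTensor_tmul] at h
  rw [map_sw (f := fun z => G (TensorProduct.assoc k M H H z)) (by fun_prop),
    map_sw hG] at h
  refine Eq.trans (sw_congr fun u c => ?_) (h.trans (sw_congr fun a v => ?_))
  · conv_rhs => rw [← sw_tmul_self (rho k H M u)]
    rw [map_sw (f := fun z => G (TensorProduct.assoc k M H H (z ⊗ₜ[k] c))) (by fun_prop)]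
    refine sw_congr fun a b => ?_
    rw [TensorProduct.assoc_tmul]
    show _ = sw _ _
    simp (disch := fun_prop) only [sw_tmul]
  · show sw _ _ = _
    simp (disch := fun_prop) only [sw_tmul]

theorem sw_rho_counit {F : M → W} (hF : Lin k F) (x : M) :
    (sw (rho k H M x) fun a b => Coalgebra.counit (R := k) b • F a) = F x := by
  conv_rhs => rw [← counit_rho (k := k) (H := H) x, ← sw_tmul_self (rho k H M x)]
  rw [map_sw (f := fun z => F (TensorProduct.rid k M (LinearMap.lTensor M Coalgebra.counit z)))
    (by fun_prop)]
  refine sw_congr fun a b => ?_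
  rw [LinearMap.lTensor_tmul, TensorProduct.rid_tmul, hF.map_smul]

end Comodule

end Sweedler

/-! ### The axioms of `H`, `A` and `M` in Sweedler form -/

section BialgebraSweedler

set_option linter.unusedSectionVars false

variable {k H W : Type*} [Field k] [AddCommGroup H] [Module k H] [Coalgebra k H]
  [AddCommGroup W] [Module k W]

local notation "Δ" => Coalgebra.comul (R := k)
local notation "ϵ" => Coalgebra.counit (R := k)
local notation "μ(" a "," b ")" => mulH k H (a ⊗ₜ[k] b)
local notation "ω(" a "," b "," c ")" => omega k H (a ⊗ₜ[k] (b ⊗ₜ[k] c))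
local notation "ω⁻(" a "," b "," c ")" => omegaInv k H (a ⊗ₜ[k] (b ⊗ₜ[k] c))

section Coalgebra

variable {C : Type*} [AddCommGroup C] [Module k C] [Coalgebra k C]

theorem convL_apply (f : C →ₗ[k] k) (F : C →ₗ[k] W) (c : C) :
    convL f F c = sw (Δ c) fun a b => f a • F b := by
  conv_lhs => simp only [convL, LinearMap.comp_apply]; rw [← sw_tmul_self (Δ c)]
  simp only [linearMap_sw]
  rfl

theorem convR_apply (F : C →ₗ[k] W) (f : C →ₗ[k] k) (c : C) :
    convR F f c = sw (Δ c) fun a b => f b • F a := by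
  conv_lhs => simp only [convR, LinearMap.comp_apply]; rw [← sw_tmul_self (Δ c)]
  simp only [linearMap_sw]
  rfl

theorem comul₃_apply (c : C) :
    comul₃ k C c = sw (Δ c) fun a b => a ⊗ₜ[k] Δ b := by
  conv_lhs => simp only [comul₃, LinearMap.comp_apply]; rw [← sw_tmul_self (Δ c)]
  simp only [linearMap_sw]
  rfl

theorem convMul_ofConv_apply (φ ψ : WithConv (C →ₗ[k] k)) (c : C) :
    (φ * ψ).ofConv c = sw (Δ c) fun x y => φ.ofConv x * ψ.ofConv y := by
  refine (LinearMap.convMul_apply φ ψ c).trans ?_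
  conv_lhs => rw [← sw_tmul_self (Δ c)]
  simp only [linearMap_sw]
  rfl

end Coalgebra

section Bialgebra

variable [CoquasiBialgebra k H]

theorem sw_comul_mul {F : H → H → W} (h₁ : ∀ v, Lin k fun u => F u v)
    (h₂ : ∀ u, Lin k fun v => F u v) (a b : H) :
    sw (Δ (μ(a, b))) F =
      sw (Δ a) fun a₁ a₂ => sw (Δ b) fun b₁ b₂ => F (μ(a₁, b₁)) (μ(a₂, b₂)) := by
  have h := LinearMap.congr_fun
    (CoquasiBialgebra.mulHom (k := k) (H := H)).map_comp_comul (a ⊗ₜ[k] b)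
  have h' : Δ (μ(a, b)) = TensorProduct.map (mulH k H) (mulH k H) (Δ (a ⊗ₜ[k] b)) := h.symm
  rw [h', sw_map _ _ _ h₁ h₂]
  exact sw_comul_tmul (by fun_prop) (by fun_prop) a b

theorem counit_mul (a b : H) : ϵ (μ(a, b)) = ϵ a * ϵ b := by
  refine (LinearMap.congr_fun
    (CoquasiBialgebra.mulHom (k := k) (H := H)).counit_comp (a ⊗ₜ[k] b)).trans ?_
  simp [mul_comm]

variable (k H) in
theorem comul_one : Δ (oneH k H) = oneH k H ⊗ₜ[k] oneH k H :=
  CoquasiBialgebra.one_groupLike.comul_eq_tmul_self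

variable (k H) in
theorem counit_one : ϵ (oneH k H) = 1 :=
  CoquasiBialgebra.one_groupLike.counit_eq_one

theorem one_mulH (a : H) : μ(oneH k H, a) = a := CoquasiBialgebra.one_mul a

theorem mulH_one (a : H) : μ(a, oneH k H) = a := CoquasiBialgebra.mul_one a

/-- Sweedler form of the convolution product of two functionals on a triple tensor product. -/
theorem convMul_tmul₃ (φ ψ : WithConv (H ⊗[k] (H ⊗[k] H) →ₗ[k] k)) (a b c : H) :
    (φ * ψ).ofConv (a ⊗ₜ[k] (b ⊗ₜ[k] c)) =
      sw (Δ a) fun a₁ a₂ => sw (Δ b) fun b₁ b₂ => sw (Δ c) fun c₁ c₂ =>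
        φ.ofConv (a₁ ⊗ₜ[k] (b₁ ⊗ₜ[k] c₁)) * ψ.ofConv (a₂ ⊗ₜ[k] (b₂ ⊗ₜ[k] c₂)) := by
  rw [convMul_ofConv_apply, sw_comul_tmul (by fun_prop) (by fun_prop)]
  refine sw_congr fun a₁ a₂ => ?_
  rw [sw_comul_tmul (by fun_prop) (by fun_prop)]

theorem convMul_tmul₄ (φ ψ : WithConv (H ⊗[k] (H ⊗[k] (H ⊗[k] H)) →ₗ[k] k)) (a b c d : H) :
    (φ * ψ).ofConv (a ⊗ₜ[k] (b ⊗ₜ[k] (c ⊗ₜ[k] d))) =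
      sw (Δ a) fun a₁ a₂ => sw (Δ b) fun b₁ b₂ => sw (Δ c) fun c₁ c₂ => sw (Δ d) fun d₁ d₂ =>
        φ.ofConv (a₁ ⊗ₜ[k] (b₁ ⊗ₜ[k] (c₁ ⊗ₜ[k] d₁))) *
          ψ.ofConv (a₂ ⊗ₜ[k] (b₂ ⊗ₜ[k] (c₂ ⊗ₜ[k] d₂))) := by
  rw [convMul_ofConv_apply, sw_comul_tmul (by fun_prop) (by fun_prop)]
  refine sw_congr fun a₁ a₂ => ?_
  rw [sw_comul_tmul (by fun_prop) (by fun_prop)]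
  refine sw_congr fun b₁ b₂ => ?_
  rw [sw_comul_tmul (by fun_prop) (by fun_prop)]

theorem convOne_tmul₃ (a b c : H) :
    (1 : WithConv (H ⊗[k] (H ⊗[k] H) →ₗ[k] k)).ofConv (a ⊗ₜ[k] (b ⊗ₜ[k] c)) =
      ϵ a * (ϵ b * ϵ c) := by
  show algebraMap k k (ϵ (a ⊗ₜ[k] (b ⊗ₜ[k] c))) = _
  simp [mul_comm]

theorem sw_mul_assoc (a b c : H) :
    (sw (Δ a) fun a₁ a₂ => sw (Δ b) fun b₁ b₂ => sw (Δ c) fun c₁ c₂ =>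
        ω(a₂, b₂, c₂) • μ(a₁, μ(b₁, c₁))) =
      sw (Δ a) fun a₁ a₂ => sw (Δ b) fun b₁ b₂ => sw (Δ c) fun c₁ c₂ =>
        ω(a₁, b₁, c₁) • μ(μ(a₂, b₂), c₂) := by
  have h := LinearMap.congr_fun (CoquasiBialgebra.mul_assoc (k := k) (H := H))
    (a ⊗ₜ[k] (b ⊗ₜ[k] c))
  rw [convR_apply, convL_apply] at h
  simp (disch := fun_prop) only [sw_comul_tmul] at h
  exact h

theorem sw_omegaInv_omega (a b c : H) :
    (sw (Δ a) fun a₁ a₂ => sw (Δ b) fun b₁ b₂ => sw (Δ c) fun c₁ c₂ =>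
        ω⁻(a₁, b₁, c₁) * ω(a₂, b₂, c₂)) = ϵ a * (ϵ b * ϵ c) :=
  (convMul_tmul₃ _ _ a b c).symm.trans ((congrArg (fun z => z.ofConv (a ⊗ₜ[k] (b ⊗ₜ[k] c)))
    (Units.inv_mul (CoquasiBialgebra.omegaUnit (k := k) (H := H)))).trans (convOne_tmul₃ a b c))

end Bialgebra

section Hopf

variable [CoquasiHopfAlgebra k H]

local notation "S" => antipode k H
local notation "β" => beta k H

variable (k H) in
/-- The functional `α` of a coquasi-Hopf algebra. -/
def alpha : H →ₗ[k] k := CoquasiHopfAlgebra.α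

local notation "α" => alpha k H

theorem sw_comul_antipode {F : H → H → W} (h₁ : ∀ v, Lin k fun u => F u v)
    (h₂ : ∀ u, Lin k fun v => F u v) (a : H) :
    sw (Δ (S a)) F = sw (Δ a) fun a₁ a₂ => F (S a₂) (S a₁) := by
  have h : Δ (S a) = TensorProduct.comm k H H (TensorProduct.map S S (Δ a)) :=
    LinearMap.congr_fun (CoquasiHopfAlgebra.comul_S (k := k) (H := H)) a
  rw [h]
  conv_lhs => rw [← sw_tmul_self (Δ a)]
  simp only [linearMap_sw, TensorProduct.map_tmul]
  rw [map_sw (f := fun z => sw (TensorProduct.comm k H H z) F) (by fun_prop)]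
  refine sw_congr fun x y => ?_
  rw [TensorProduct.comm_tmul, sw_tmul h₁ h₂]

theorem counit_antipode (a : H) : ϵ (S a) = ϵ a :=
  LinearMap.congr_fun (CoquasiHopfAlgebra.counit_S (k := k) (H := H)) a

theorem sw_antipode_alpha (a : H) :
    (sw (Δ a) fun x r => sw (Δ r) fun y z => α y • μ(S x, z)) = α a • oneH k H := by
  refine Eq.trans ?_ (CoquasiHopfAlgebra.S_alpha_id (k := k) (H := H) a)
  conv_rhs => rw [← sw_tmul_self (Δ a)]
  simp only [linearMap_sw, TensorProduct.map_tmul, convL_apply, sw_tmul_right,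
    TensorProduct.tmul_smul, map_smul]
  rfl

theorem sw_beta_antipode (a : H) :
    (sw (Δ a) fun x r => sw (Δ r) fun y z => β y • μ(x, S z)) = β a • oneH k H := by
  refine Eq.trans ?_ (CoquasiHopfAlgebra.id_beta_S (k := k) (H := H) a)
  conv_rhs => rw [← sw_tmul_self (Δ a)]
  simp only [linearMap_sw, TensorProduct.map_tmul, convL_apply, sw_tmul_right,
    TensorProduct.tmul_smul, map_smul]
  rfl

/-- `ω(h₁ β(h₂), S(h₃), α(h₄) h₅) = ε(h)`. -/
theorem sw_omega_antipode (a : H) :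
    (sw (Δ a) fun a₁ r => sw (Δ r) fun a₂ s => sw (Δ s) fun a₃ t => sw (Δ t) fun a₄ a₅ =>
      β a₂ * (α a₄ * ω(a₁, S a₃, a₅))) = ϵ a := by
  refine Eq.trans ?_ (CoquasiHopfAlgebra.omega_S (k := k) (H := H) a)
  rw [comul₃_apply]
  simp only [linearMap_sw, TensorProduct.map_tmul, convR_apply]
  trans sw (Δ a) fun x y => sw (Δ x) fun a₁ a₂ => sw (Δ y) fun a₃ t => sw (Δ t) fun a₄ a₅ =>
      β a₂ * (α a₄ * ω(a₁, S a₃, a₅))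
  · simp (disch := fun_prop) only [sw_coassoc]
  · refine sw_congr fun x y => ?_
    conv_rhs => rw [← sw_tmul_self (Δ y)]
    simp only [linearMap_sw, TensorProduct.map_tmul, convL_apply, sw_tmul_right, sw_tmul_left,
      TensorProduct.tmul_smul, ← TensorProduct.smul_tmul', map_smul, smul_sw]
    simp only [sw_comm _ (Δ x)]
    refine sw_congr fun a₁ a₂ => sw_congr fun a₃ t => sw_congr fun a₄ a₅ => ?_
    exact mul_left_comm _ _ _

end Hopf

section Comodule

variable [CoquasiBialgebra k H] {A : Type*} [AddCommGroup A] [Module k A] [ComoduleAlgebra k H A]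
variable {M : Type*} [AddCommGroup M] [Module k M] [HopfModule k H A M]

theorem linearMap_tmul {U V X Y : Type*} [AddCommGroup U] [Module k U]
    [AddCommGroup V] [Module k V] [AddCommGroup X] [Module k X] [AddCommGroup Y] [Module k Y]
    (L : (U ⊗[k] V) ⊗[k] (X ⊗[k] Y) →ₗ[k] W) (s : U ⊗[k] V) (t : X ⊗[k] Y) :
    L (s ⊗ₜ[k] t) = sw s fun u v => sw t fun x y => L ((u ⊗ₜ[k] v) ⊗ₜ[k] (x ⊗ₜ[k] y)) := by
  conv_lhs => rw [← sw_tmul_self s]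
  rw [map_sw (f := fun z => L (z ⊗ₜ[k] t)) (by fun_prop)]
  refine sw_congr fun u v => ?_
  conv_lhs => rw [← sw_tmul_self t]
  rw [map_sw (f := fun z => L ((u ⊗ₜ[k] v) ⊗ₜ[k] z)) (by fun_prop)]

theorem codiag_tmul {U V : Type*} [AddCommGroup U] [Module k U] [RightComodule k H U]
    [AddCommGroup V] [Module k V] [RightComodule k H V] (u : U) (v : V) :
    codiag k H U V (u ⊗ₜ[k] v) = sw (rho k H U u) fun u₀ u₁ => sw (rho k H V v) fun v₀ v₁ =>
      (u₀ ⊗ₜ[k] v₀) ⊗ₜ[k] μ(u₁, v₁) := by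
  exact linearMap_tmul (LinearMap.lTensor (U ⊗[k] V) (mulH k H) ∘ₗ
    (TensorProduct.tensorTensorTensorComm k U H V H).toLinearMap) _ _

theorem reassociator_tmul {U V X : Type*} [AddCommGroup U] [Module k U] [RightComodule k H U]
    [AddCommGroup V] [Module k V] [RightComodule k H V]
    [AddCommGroup X] [Module k X] [RightComodule k H X] (u : U) (v : V) (x : X) :
    reassociator k H U V X ((u ⊗ₜ[k] v) ⊗ₜ[k] x) =
      sw (rho k H U u) fun u₀ u₁ => sw (rho k H V v) fun v₀ v₁ => sw (rho k H X x) fun x₀ x₁ =>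
        ω(u₁, v₁, x₁) • (u₀ ⊗ₜ[k] (v₀ ⊗ₜ[k] x₀)) := by
  have h : ∀ z : (U ⊗[k] H) ⊗[k] (V ⊗[k] H), omegaContract k H U V X (z ⊗ₜ[k] rho k H X x) =
      sw (rho k H X x) fun x₀ x₁ => omegaContract k H U V X (z ⊗ₜ[k] (x₀ ⊗ₜ[k] x₁)) := by
    intro z
    conv_lhs => rw [← sw_tmul_self (rho k H X x)]
    rw [map_sw (f := fun t => omegaContract k H U V X (z ⊗ₜ[k] t)) (Lin.apply (omegaContract k H U V X) (Lin.tmul_right z Lin.id))]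
  refine (linearMap_tmul (omegaContract k H U V X ∘ₗ (TensorProduct.mk k _ _).flip
    (rho k H X x)) (rho k H U u) (rho k H V v)).trans ?_
  exact sw_congr fun u₀ u₁ => sw_congr fun v₀ v₁ => h _

theorem rho_act (m : M) (a : A) :
    rho k H M (actM k H A M (m ⊗ₜ[k] a)) =
      sw (rho k H M m) fun m₀ m₁ => sw (rho k H A a) fun a₀ a₁ =>
        actM k H A M (m₀ ⊗ₜ[k] a₀) ⊗ₜ[k] μ(m₁, a₁) := by
  rw [rho_actM, codiag_tmul]
  simp only [linearMap_sw, LinearMap.rTensor_tmul]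

theorem act_act (m : M) (a b : A) :
    actM k H A M (actM k H A M (m ⊗ₜ[k] a) ⊗ₜ[k] b) =
      sw (rho k H M m) fun m₀ m₁ => sw (rho k H A a) fun a₀ a₁ => sw (rho k H A b) fun b₀ b₁ =>
        ω(m₁, a₁, b₁) • actM k H A M (m₀ ⊗ₜ[k] mulA k H A (a₀ ⊗ₜ[k] b₀)) := by
  rw [actM_actM, reassociator_tmul]
  simp only [linearMap_sw, map_smul, LinearMap.lTensor_tmul]

end Comodule

end BialgebraSweedler

/-! ### Consequences of quasi-associativity, the cocycle identity and the antipode axioms -/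

section HopfIdentities

set_option linter.unusedSectionVars false

variable {k H W : Type*} [Field k] [AddCommGroup H] [Module k H] [Coalgebra k H]
  [AddCommGroup W] [Module k W]

local notation "Δ" => Coalgebra.comul (R := k)
local notation "ϵ" => Coalgebra.counit (R := k)
local notation "μ(" a "," b ")" => mulH k H (a ⊗ₜ[k] b)
local notation "ω(" a "," b "," c ")" => omega k H (a ⊗ₜ[k] (b ⊗ₜ[k] c))
local notation "ω⁻(" a "," b "," c ")" => omegaInv k H (a ⊗ₜ[k] (b ⊗ₜ[k] c))

/-- The sum `∑ f(c₂) F(c₁, c₃)`. -/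
noncomputable def mid (f : H →ₗ[k] k) (c : H) (F : H → H → W) : W :=
  sw (Δ c) fun x r => sw (Δ r) fun y z => f y • F x z

@[fun_prop]
theorem Lin.mid_left {X : Type*} [AddCommGroup X] [Module k X] (f : H →ₗ[k] k) {c : X → H}
    (hc : Lin k c) {F : H → H → W} (h₁ : ∀ v, Lin k fun u => F u v)
    (h₂ : ∀ u, Lin k fun v => F u v) : Lin k fun x => mid f (c x) F := by
  unfold mid
  fun_prop

@[fun_prop]
theorem Lin.mid_right {X : Type*} [AddCommGroup X] [Module k X] (f : H →ₗ[k] k) (c : H)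
    {F : X → H → H → W} (hF : ∀ u v, Lin k fun x => F x u v) : Lin k fun x => mid f c (F x) := by
  unfold mid
  fun_prop

theorem mid_congr {f : H →ₗ[k] k} {c : H} {F G : H → H → W} (h : ∀ u v, F u v = G u v) :
    mid f c F = mid f c G := by
  have : F = G := funext fun u => funext (h u)
  rw [this]

theorem map_mid {X : Type*} [AddCommGroup X] [Module k X] {L : W → X} (hL : Lin k L)
    (f : H →ₗ[k] k) (c : H) (F : H → H → W) : L (mid f c F) = mid f c fun x z => L (F x z) := by
  simp only [mid, map_sw hL, hL.map_smul]

theorem sw_mid {U V : Type*} [AddCommGroup U] [Module k U] [AddCommGroup V] [Module k V]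
    (t : U ⊗[k] V) (f : H →ₗ[k] k) (c : H) (F : U → V → H → H → W) :
    (sw t fun u v => mid f c (F u v)) = mid f c fun x z => sw t fun u v => F u v x z := by
  unfold mid
  rw [sw_comm]
  refine sw_congr fun x r => ?_
  rw [sw_comm]
  simp only [smul_sw]

theorem smul_mid (a : k) (f : H →ₗ[k] k) (c : H) (F : H → H → W) :
    a • mid f c F = mid f c fun x z => a • F x z :=
  map_mid (L := fun w => a • w) (by fun_prop) f c F

theorem mid_smul (f : H →ₗ[k] k) (c : H) (F : H → H → k) (w : W) :
    mid f c F • w = mid f c fun x z => F x z • w :=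
  map_mid (L := fun a => a • w) (by fun_prop) f c F

theorem mul_mid (a : k) (f : H →ₗ[k] k) (c : H) (F : H → H → k) :
    a * mid f c F = mid f c fun x z => a * F x z :=
  map_mid (L := fun w => a * w) (by fun_prop) f c F

/-- Coassociativity for five legs of `c`, with `f` on the third: the two outermost legs are pulled
out and `f` stays between the two inner ones. This exposes the inner pair to collapsing identities
such as `mid_beta`. -/
theorem mid_split (f : H →ₗ[k] k) (c : H) {G : H → H → H → H → W}
    (h₁ : ∀ x y z, Lin k fun t => G t x y z) (h₂ : ∀ x y z, Lin k fun t => G x t y z)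
    (h₃ : ∀ x y z, Lin k fun t => G x y t z) (h₄ : ∀ x y z, Lin k fun t => G x y z t) :
    (mid f c fun x z => sw (Δ x) fun x₁ x₂ => sw (Δ z) fun z₁ z₂ => G x₁ x₂ z₁ z₂) =
      sw (Δ c) fun x₁ r => sw (Δ r) fun s z₂ => mid f s fun x₂ z₁ => G x₁ x₂ z₁ z₂ := by
  trans sw (Δ c) fun x r => sw (Δ x) fun x₁ x₂ => sw (Δ r) fun y z => sw (Δ z) fun z₁ z₂ =>
    f y • G x₁ x₂ z₁ z₂
  · unfold mid
    refine sw_congr fun x r => ?_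
    rw [sw_comm]
    simp only [smul_sw]
  · simp (disch := fun_prop) only [mid, sw_coassoc]

section Bialgebra

variable [CoquasiBialgebra k H]

/-- In `ω⁻¹ * ω = ε` at `(h, 1, g)` the factor `ω` is already trivial. -/
theorem omegaInv_middle (h g : H) : ω⁻(h, oneH k H, g) = ϵ h * ϵ g := by
  have e := sw_omegaInv_omega (k := k) h (oneH k H) g
  rw [counit_one, one_mul] at e
  rw [← e]
  simp (disch := fun_prop) only [comul_one, sw_tmul, omega_middle]
  have h₁ : ∀ x y : H, (sw (Δ g) fun c₁ c₂ => ω⁻(x, oneH k H, c₁) * (ϵ y * ϵ c₂)) =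
      ϵ y • ω⁻(x, oneH k H, g) := by
    intro x y
    rw [← sw_counit_right (k := k) (F := fun z => ω⁻(x, oneH k H, z)) (by fun_prop) g, smul_sw]
    refine sw_congr fun a b => ?_
    simp only [smul_eq_mul]
    ring
  simp only [h₁]
  exact (sw_counit_right (k := k) (F := fun z => ω⁻(z, oneH k H, g)) (by fun_prop) h).symm

open WithConv

variable (k H) in
/-- The functional `h ⊗ g ⊗ l ⊗ t ↦ φ(h, g, lt)`. -/
noncomputable def mulThree (φ : H ⊗[k] (H ⊗[k] H) →ₗ[k] k) :
    WithConv (H ⊗[k] (H ⊗[k] (H ⊗[k] H)) →ₗ[k] k) :=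
  toConv (φ ∘ₗ LinearMap.lTensor H (LinearMap.lTensor H (mulH k H)))

variable (k H) in
/-- The functional `h ⊗ g ⊗ l ⊗ t ↦ φ(h, gl, t)`. -/
noncomputable def mulTwo (φ : H ⊗[k] (H ⊗[k] H) →ₗ[k] k) :
    WithConv (H ⊗[k] (H ⊗[k] (H ⊗[k] H)) →ₗ[k] k) :=
  toConv (φ ∘ₗ LinearMap.lTensor H (LinearMap.rTensor H (mulH k H) ∘ₗ
          (TensorProduct.assoc k H H H).symm.toLinearMap))

variable (k H) in
/-- The functional `h ⊗ g ⊗ l ⊗ t ↦ φ(hg, l, t)`. -/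
noncomputable def mulOne (φ : H ⊗[k] (H ⊗[k] H) →ₗ[k] k) :
    WithConv (H ⊗[k] (H ⊗[k] (H ⊗[k] H)) →ₗ[k] k) :=
  toConv (φ ∘ₗ LinearMap.rTensor (H ⊗[k] H) (mulH k H) ∘ₗ
        (TensorProduct.assoc k H H (H ⊗[k] H)).symm.toLinearMap)

variable (k H) in
/-- The functional `h ⊗ g ⊗ l ⊗ t ↦ ε(h) φ(g, l, t)`. -/
noncomputable def counitOne (φ : H ⊗[k] (H ⊗[k] H) →ₗ[k] k) :
    WithConv (H ⊗[k] (H ⊗[k] (H ⊗[k] H)) →ₗ[k] k) :=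
  toConv ((TensorProduct.lid k k).toLinearMap ∘ₗ TensorProduct.map Coalgebra.counit φ)

variable (k H) in
/-- The functional `h ⊗ g ⊗ l ⊗ t ↦ φ(h, g, l) ε(t)`. -/
noncomputable def counitFour (φ : H ⊗[k] (H ⊗[k] H) →ₗ[k] k) :
    WithConv (H ⊗[k] (H ⊗[k] (H ⊗[k] H)) →ₗ[k] k) :=
  toConv (φ ∘ₗ LinearMap.lTensor H (LinearMap.lTensor H ((TensorProduct.rid k H).toLinearMap ∘ₗ
          LinearMap.lTensor H Coalgebra.counit)))

variable (φ : H ⊗[k] (H ⊗[k] H) →ₗ[k] k) (h g l t : H)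

theorem mulThree_apply : (mulThree k H φ).ofConv (h ⊗ₜ[k] (g ⊗ₜ[k] (l ⊗ₜ[k] t))) =
    φ (h ⊗ₜ[k] (g ⊗ₜ[k] μ(l, t))) := rfl

theorem mulTwo_apply : (mulTwo k H φ).ofConv (h ⊗ₜ[k] (g ⊗ₜ[k] (l ⊗ₜ[k] t))) =
    φ (h ⊗ₜ[k] (μ(g, l) ⊗ₜ[k] t)) := rfl

theorem mulOne_apply : (mulOne k H φ).ofConv (h ⊗ₜ[k] (g ⊗ₜ[k] (l ⊗ₜ[k] t))) =
    φ (μ(h, g) ⊗ₜ[k] (l ⊗ₜ[k] t)) := rfl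

theorem counitOne_apply : (counitOne k H φ).ofConv (h ⊗ₜ[k] (g ⊗ₜ[k] (l ⊗ₜ[k] t))) =
    ϵ h * φ (g ⊗ₜ[k] (l ⊗ₜ[k] t)) := rfl

theorem counitFour_apply : (counitFour k H φ).ofConv (h ⊗ₜ[k] (g ⊗ₜ[k] (l ⊗ₜ[k] t))) =
    ϵ t * φ (h ⊗ₜ[k] (g ⊗ₜ[k] l)) := by
  show φ (h ⊗ₜ[k] (g ⊗ₜ[k] (ϵ t • l))) = _
  simp only [TensorProduct.tmul_smul, map_smul, smul_eq_mul]

variable (k H) in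
theorem cocycle_conv : mulThree k H (omega k H) * mulOne k H (omega k H) =
    counitOne k H (omega k H) * mulTwo k H (omega k H) * counitFour k H (omega k H) :=
  CoquasiBialgebra.cocycle (k := k) (H := H)

theorem ext₄ {φ ψ : WithConv (H ⊗[k] (H ⊗[k] (H ⊗[k] H)) →ₗ[k] k)}
    (e : ∀ h g l t : H, φ.ofConv (h ⊗ₜ[k] (g ⊗ₜ[k] (l ⊗ₜ[k] t))) =
      ψ.ofConv (h ⊗ₜ[k] (g ⊗ₜ[k] (l ⊗ₜ[k] t)))) : φ = ψ := by
  apply WithConv.ofConv_injective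
  ext h g l t
  exact e h g l t

theorem convOne_tmul₄ (a b c d : H) :
    (1 : WithConv (H ⊗[k] (H ⊗[k] (H ⊗[k] H)) →ₗ[k] k)).ofConv
      (a ⊗ₜ[k] (b ⊗ₜ[k] (c ⊗ₜ[k] d))) = ϵ a * (ϵ b * (ϵ c * ϵ d)) := by
  show algebraMap k k (ϵ (a ⊗ₜ[k] (b ⊗ₜ[k] (c ⊗ₜ[k] d)))) = _
  simp [mul_comm]

theorem sw_counit_counit (a : H) :
    (sw (Δ a) fun a₁ a₂ => ϵ a₁ * ϵ a₂) = ϵ a :=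
  sw_counit_left (F := fun z => ϵ z) (by fun_prop) a

-- Multiplication is a coalgebra morphism, so pulling functionals back along it preserves
-- convolution inverses.
variable (k H) in
theorem mulTwo_inv : mulTwo k H (omegaInv k H) * mulTwo k H (omega k H) = 1 := by
  apply ext₄
  intro h g l t
  have e := sw_omegaInv_omega (k := k) h (μ(g, l)) t
  simp (disch := fun_prop) only [sw_comul_mul, counit_mul] at e
  simp only [convMul_tmul₄, mulTwo_apply, convOne_tmul₄, e]
  ring

variable (k H) in
theorem counitOne_inv : counitOne k H (omegaInv k H) * counitOne k H (omega k H) = 1 := by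
  apply ext₄
  intro h g l t
  simp only [convMul_tmul₄, counitOne_apply, convOne_tmul₄]
  rw [← sw_omegaInv_omega (k := k) g l t, ← sw_counit_counit h, sw_mul]
  refine sw_congr fun h₁ h₂ => ?_
  simp only [mul_sw]
  refine sw_congr fun g₁ g₂ => sw_congr fun l₁ l₂ => sw_congr fun t₁ t₂ => ?_
  ring

-- The cocycle identity solved for its last factor.
variable (k H) in
theorem counitFour_omega : counitFour k H (omega k H) =
    mulTwo k H (omegaInv k H) * counitOne k H (omegaInv k H) *
      (mulThree k H (omega k H) * mulOne k H (omega k H)) := by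
  rw [cocycle_conv, mul_assoc (counitOne k H (omega k H)), mul_assoc (mulTwo k H (omegaInv k H)),
    ← mul_assoc (counitOne k H (omegaInv k H)), counitOne_inv, one_mul, ← mul_assoc, mulTwo_inv,
    one_mul]

theorem sw_sw_counit_right {F : H → H → k} (h₁ : ∀ v, Lin k fun u => F u v)
    (h₂ : ∀ u, Lin k fun v => F u v) (h g : H) :
    (sw (Δ h) fun a₁ a₂ => sw (Δ g) fun b₁ b₂ => F a₁ b₁ * (ϵ a₂ * ϵ b₂)) = F h g := by
  rw [← sw_counit_right (F := fun z => F z g) (by fun_prop) h]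
  refine sw_congr fun a₁ a₂ => ?_
  rw [← sw_counit_right (F := fun z => F a₁ z) (by fun_prop) g, smul_sw]
  refine sw_congr fun b₁ b₂ => ?_
  simp only [smul_eq_mul]
  ring

theorem sw_sw_counit_left {F : H → H → k} (h₁ : ∀ v, Lin k fun u => F u v)
    (h₂ : ∀ u, Lin k fun v => F u v) (h g : H) :
    (sw (Δ h) fun a₁ a₂ => sw (Δ g) fun b₁ b₂ => (ϵ a₁ * ϵ b₁) * F a₂ b₂) = F h g := by
  rw [← sw_counit_left (F := fun z => F z g) (by fun_prop) h]
  refine sw_congr fun a₁ a₂ => ?_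
  rw [← sw_counit_left (F := fun z => F a₂ z) (by fun_prop) g, smul_sw]
  refine sw_congr fun b₁ b₂ => ?_
  simp only [smul_eq_mul]
  ring

/-- `ω(h, g, 1) = ε(h) ε(g)`. -/
theorem omega_right : ω(h, g, oneH k H) = ϵ h * ϵ g := by
  -- At `(h, g, 1, 1)` the cocycle identity says that `ω(-, -, 1)` is idempotent under convolution.
  -- Being invertible as well, it must be the counit.
  have e : ∀ h g : H, (sw (Δ h) fun h₁ h₂ => sw (Δ g) fun g₁ g₂ =>
      ω(h₁, g₁, oneH k H) * ω(h₂, g₂, oneH k H)) = ω(h, g, oneH k H) := by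
    intro h g
    have e := congrArg (fun z => z.ofConv (h ⊗ₜ[k] (g ⊗ₜ[k] (oneH k H ⊗ₜ[k] oneH k H))))
      (cocycle_conv k H)
    simp (disch := fun_prop) only [convMul_tmul₄, comul_one, sw_tmul, mulThree_apply,
      mulOne_apply, counitOne_apply, mulTwo_apply, counitFour_apply, mulH_one, omega_middle,
      counit_one, one_mul, mul_one, counit_mul, sw_sw_counit_right, sw_sw_counit_left] at e
    exact e.symm
  have e' : ∀ h g : H, (sw (Δ h) fun h₁ h₂ => sw (Δ g) fun g₁ g₂ =>
      ω⁻(h₁, g₁, oneH k H) * ω(h₂, g₂, oneH k H)) = ϵ h * ϵ g := by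
    intro h g
    have e' := sw_omegaInv_omega (k := k) h g (oneH k H)
    simp (disch := fun_prop) only [comul_one, sw_tmul, counit_one, mul_one] at e'
    exact e'
  trans sw (Δ h) fun h₁ h₂ => sw (Δ g) fun g₁ g₂ => (sw (Δ h₁) fun a₁ a₂ => sw (Δ g₁) fun b₁ b₂ =>
      ω⁻(a₁, b₁, oneH k H) * ω(a₂, b₂, oneH k H)) * ω(h₂, g₂, oneH k H)
  · simp (disch := fun_prop) only [e', sw_sw_counit_left]
  trans sw (Δ h) fun h₁ h₂ => sw (Δ h₁) fun a₁ a₂ => sw (Δ g) fun g₁ g₂ => sw (Δ g₁) fun b₁ b₂ =>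
      ω⁻(a₁, b₁, oneH k H) * (ω(a₂, b₂, oneH k H) * ω(h₂, g₂, oneH k H))
  · refine sw_congr fun h₁ h₂ => ?_
    rw [sw_comm]
    simp only [sw_mul, mul_assoc]
  · simp (disch := fun_prop) only [sw_coassoc]
    rw [← e']
    refine sw_congr fun h₁ h₂ => ?_
    rw [sw_comm]
    refine sw_congr fun g₁ g₂ => ?_
    rw [← e h₂ g₂]
    simp only [mul_sw]

/-- From `F * w = w * G` one gets `w⁻¹ * F = G * w⁻¹`: both sides equal `w⁻¹ * (F * w) * w⁻¹`.
Applied to `ω`, this moves the reassociator to the other side of the quasi-associativity law. -/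
theorem conv_inv_comm {C : Type*} [AddCommGroup C] [Module k C] [Coalgebra k C]
    {w w' : WithConv (C →ₗ[k] k)} (h₁ : w' * w = 1) (h₂ : w * w' = 1) {F G : C →ₗ[k] W}
    (e : ∀ c, (sw (Δ c) fun a b => w.ofConv b • F a) = sw (Δ c) fun a b => w.ofConv a • G b)
    (c : C) : (sw (Δ c) fun a b => w'.ofConv a • F b) = sw (Δ c) fun a b => w'.ofConv b • G a := by
  have h₁' : ∀ c : C, (sw (Δ c) fun x y => w'.ofConv x * w.ofConv y) = ϵ c := fun c => by
    rw [← convMul_ofConv_apply, h₁]; rfl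
  have h₂' : ∀ c : C, (sw (Δ c) fun x y => w.ofConv x * w'.ofConv y) = ϵ c := fun c => by
    rw [← convMul_ofConv_apply, h₂]; rfl
  trans sw (Δ c) fun a r => sw (Δ r) fun s d => (w'.ofConv a * w'.ofConv d) •
    sw (Δ s) fun x y => w.ofConv y • F x
  · trans sw (Δ c) fun a r => sw (Δ r) fun x s => (w'.ofConv a * sw (Δ s) fun u v =>
      w.ofConv u * w'.ofConv v) • F x
    · refine sw_congr fun a r => ?_
      rw [← sw_counit_right (F := fun z => w'.ofConv a • F z) (by fun_prop) r]
      refine sw_congr fun x s => ?_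
      rw [h₂', smul_smul, mul_comm]
    · simp (disch := fun_prop) only [mul_sw, sw_smul, smul_sw, sw_coassoc, smul_smul]
      refine sw_congr fun _ _ => sw_congr fun _ _ => sw_congr fun _ _ => ?_
      ring_nf
  · trans sw (Δ c) fun r d => sw (Δ r) fun u y => (w'.ofConv d * sw (Δ u) fun a x =>
      w'.ofConv a * w.ofConv x) • G y
    · simp (disch := fun_prop) only [e, mul_sw, sw_smul, smul_sw, sw_coassoc, smul_smul]
      refine sw_congr fun _ _ => sw_congr fun _ _ => sw_congr fun _ _ => ?_
      ring_nf
    · refine sw_congr fun r d => ?_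
      rw [← sw_counit_left (F := fun z => w'.ofConv d • G z) (by fun_prop) r]
      refine sw_congr fun x s => ?_
      rw [h₁', smul_smul, mul_comm]

theorem sw_mul_assoc_inv (a b c : H) :
    (sw (Δ a) fun a₁ a₂ => sw (Δ b) fun b₁ b₂ => sw (Δ c) fun c₁ c₂ =>
        ω⁻(a₁, b₁, c₁) • μ(a₂, μ(b₂, c₂))) =
      sw (Δ a) fun a₁ a₂ => sw (Δ b) fun b₁ b₂ => sw (Δ c) fun c₁ c₂ =>
        ω⁻(a₂, b₂, c₂) • μ(μ(a₁, b₁), c₁) := by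
  have e := LinearMap.congr_fun (CoquasiBialgebra.mul_assoc (k := k) (H := H))
  simp only [convR_apply, convL_apply] at e
  have h := conv_inv_comm (Units.inv_mul (CoquasiBialgebra.omegaUnit (k := k) (H := H)))
    (Units.mul_inv _) e (a ⊗ₜ[k] (b ⊗ₜ[k] c))
  simp (disch := fun_prop) only [sw_comul_tmul] at h
  exact h

end Bialgebra

section Hopf

variable [CoquasiHopfAlgebra k H]

local notation "S" => antipode k H
local notation "β" => beta k H
local notation "α" => alpha k H

theorem mid_alpha (a : H) : (mid α a fun x z => μ(S x, z)) = α a • oneH k H :=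
  sw_antipode_alpha a

theorem mid_beta (a : H) : (mid β a fun x z => μ(x, S z)) = β a • oneH k H :=
  sw_beta_antipode a

/-- The functional `c ⊗ h ↦ ω(c₁ β(c₂), S(c₃), h)`. -/
noncomputable def omegaBeta (c h : H) : k := mid β c fun x z => ω(x, S z, h)

@[fun_prop]
theorem Lin.omegaBeta_left {X : Type*} [AddCommGroup X] [Module k X] {c : X → H} (hc : Lin k c)
    (h : H) : Lin k fun x => omegaBeta (k := k) (c x) h := by
  unfold omegaBeta
  fun_prop

@[fun_prop]
theorem Lin.omegaBeta_right {X : Type*} [AddCommGroup X] [Module k X] {h : X → H} (hh : Lin k h)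
    (c : H) : Lin k fun x => omegaBeta (k := k) c (h x) := by
  unfold omegaBeta
  fun_prop

theorem mid_omegaBeta (a : H) : (mid α a fun x z => omegaBeta (k := k) x z) = ϵ a := by
  rw [← sw_omega_antipode a]
  simp (disch := fun_prop) only [mid, omegaBeta, smul_eq_mul, mul_sw]
  trans sw (Δ a) fun x r => sw (Δ x) fun u v => sw (Δ v) fun p q => sw (Δ r) fun y z =>
    α y * (β p * ω(u, S q, z))
  · refine sw_congr fun x r => ?_
    rw [sw_comm]
    refine sw_congr fun u v => ?_
    rw [sw_comm]
  · simp (disch := fun_prop) only [sw_coassoc]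
    refine sw_congr fun x r => sw_congr fun u v => sw_congr fun p q => sw_congr fun y z => ?_
    ring

/-- Quasi-associativity for `c₁, S(c₃), h` weighted by `β(c₂)`. Since `S` reverses the
comultiplication, on one side the inner legs form `omegaBeta`, on the other they meet in a product
`x S(z)` that `β` collapses to a multiple of `1`. It is what makes `cofreeAct` colinear. -/
theorem sw_omegaBeta_mul (c h : H) :
    (sw (Δ c) fun c₁ r => sw (Δ r) fun c₂ c₃ => sw (Δ h) fun h₁ h₂ =>
      omegaBeta (k := k) c₂ h₂ • μ(c₁, μ(S c₃, h₁))) =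
      sw (Δ h) fun h₁ h₂ => omegaBeta (k := k) c h₁ • h₂ := by
  have e := mid_congr (f := β) (c := c) fun x z => sw_mul_assoc (k := k) x (S z) h
  simp (disch := fun_prop) only [sw_comul_antipode] at e
  rw [mid_split (G := fun a₁ a₂ a₃ a₄ => sw (Δ h) fun h₁ h₂ =>
      ω(a₂, S a₃, h₂) • μ(a₁, μ(S a₄, h₁))) _ _ (by fun_prop) (by fun_prop) (by fun_prop)
      (by fun_prop), mid_split (G := fun a₁ a₂ a₃ a₄ => sw (Δ h) fun h₁ h₂ =>
      ω(a₁, S a₄, h₁) • μ(μ(a₂, S a₃), h₂)) _ _ (by fun_prop) (by fun_prop) (by fun_prop)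
      (by fun_prop)] at e
  refine Eq.trans ?_ (e.trans ?_)
  · refine sw_congr fun c₁ r => sw_congr fun c₂ c₃ => ?_
    rw [← sw_mid]
    refine sw_congr fun h₁ h₂ => ?_
    rw [omegaBeta, mid_smul]
  · trans mid β c fun x z => sw (Δ h) fun h₁ h₂ => ω(x, S z, h₁) • h₂
    · refine sw_congr fun x r => sw_congr fun s z => ?_
      rw [← sw_mid, smul_sw]
      refine sw_congr fun h₁ h₂ => ?_
      rw [← smul_mid, ← map_mid (L := fun a => μ(a, h₂)) (by fun_prop), mid_beta,
        ← TensorProduct.smul_tmul', map_smul, one_mulH, smul_comm]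
    · rw [← sw_mid]
      refine sw_congr fun h₁ h₂ => ?_
      rw [omegaBeta, mid_smul]

/-- The antipode axiom for `ω` at `1`. It makes `β(1)` a nonzero scalar, by which the unit half of
the theorem divides. -/
theorem beta_one_mul_alpha_one : β (oneH k H) * α (oneH k H) = 1 := by
  have e := sw_omega_antipode (k := k) (oneH k H)
  simp (disch := fun_prop) only [comul_one, sw_tmul, omega_left, counit_one, counit_antipode,
    mul_one] at e
  exact e

variable (k H) in
theorem antipode_one : S (oneH k H) = oneH k H := by
  have e := mid_alpha (k := k) (oneH k H)
  simp (disch := fun_prop) only [mid, comul_one, sw_tmul, mulH_one] at e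
  have h0 : α (oneH k H) ≠ 0 := right_ne_zero_of_mul_eq_one (beta_one_mul_alpha_one (k := k))
  exact smul_right_injective H h0 e

/-- The functional `g ⊗ l ↦ ω⁻¹(g, l₁ β(l₂), S(l₃))`. -/
noncomputable def omegaInvBeta (g l : H) : k := mid β l fun x z => ω⁻(g, x, S z)

@[fun_prop]
theorem Lin.omegaInvBeta_left {X : Type*} [AddCommGroup X] [Module k X] {c : X → H}
    (hc : Lin k c) (h : H) : Lin k fun x => omegaInvBeta (k := k) (c x) h := by
  unfold omegaInvBeta
  fun_prop

@[fun_prop]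
theorem Lin.omegaInvBeta_right {X : Type*} [AddCommGroup X] [Module k X] {h : X → H}
    (hh : Lin k h) (c : H) : Lin k fun x => omegaInvBeta (k := k) c (h x) := by
  unfold omegaInvBeta
  fun_prop

/-- The counterpart of `sw_omegaBeta_mul` for `ω⁻¹`, obtained in the same way from the inverted
quasi-associativity at `c, d₁, S(d₃)`. -/
theorem sw_omegaInvBeta_mul (c d : H) :
    (sw (Δ c) fun c₁ c₂ => sw (Δ d) fun d₁ r => sw (Δ r) fun d₂ d₃ =>
      omegaInvBeta (k := k) c₂ d₂ • μ(μ(c₁, d₁), S d₃)) =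
      sw (Δ c) fun c₁ c₂ => omegaInvBeta (k := k) c₁ d • c₂ := by
  have e := mid_congr (f := β) (c := d) fun x z => sw_mul_assoc_inv (k := k) c x (S z)
  simp (disch := fun_prop) only [sw_comul_antipode, ← sw_mid] at e
  refine (sw_congr fun c₁ c₂ => ?_).trans (e.symm.trans (sw_congr fun c₁ c₂ => ?_))
  · rw [mid_split (G := fun a₁ a₂ a₃ a₄ => ω⁻(c₂, a₂, S a₃) • μ(μ(c₁, a₁), S a₄)) _ _
      (by fun_prop) (by fun_prop) (by fun_prop) (by fun_prop)]
    refine sw_congr fun d₁ r => sw_congr fun d₂ d₃ => ?_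
    rw [omegaInvBeta, mid_smul]
  · rw [mid_split (G := fun a₁ a₂ a₃ a₄ => ω⁻(c₁, a₁, S a₄) • μ(c₂, μ(a₂, S a₃))) _ _
      (by fun_prop) (by fun_prop) (by fun_prop) (by fun_prop), omegaInvBeta, mid_smul]
    refine sw_congr fun d₁ r => sw_congr fun d₂ d₃ => ?_
    rw [← smul_mid, ← map_mid (L := fun a => μ(c₂, a)) (by fun_prop), mid_beta,
      TensorProduct.tmul_smul, map_smul, mulH_one, smul_comm]

theorem mid_counit (f : H →ₗ[k] k) (c : H) : (mid f c fun u v => ϵ u * ϵ v) = f c := by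
  rw [← sw_counit_left (k := k) (F := fun z => f z) (by fun_prop) c]
  refine sw_congr fun x r => ?_
  rw [← sw_counit_right (k := k) (F := fun z => f z) (by fun_prop) r, smul_sw]
  refine sw_congr fun y z => ?_
  simp only [smul_eq_mul]
  ring

theorem mulTwo_mul_counitOne_apply (φ ψ : H ⊗[k] (H ⊗[k] H) →ₗ[k] k) (a b c d : H) :
    (mulTwo k H φ * counitOne k H ψ).ofConv (a ⊗ₜ[k] (b ⊗ₜ[k] (c ⊗ₜ[k] d))) =
      sw (Δ b) fun b₁ b₂ => sw (Δ c) fun c₁ c₂ => sw (Δ d) fun d₁ d₂ =>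
        φ (a ⊗ₜ[k] (μ(b₁, c₁) ⊗ₜ[k] d₁)) * ψ (b₂ ⊗ₜ[k] (c₂ ⊗ₜ[k] d₂)) := by
  rw [convMul_tmul₄, ← sw_counit_right (F := fun a => sw (Δ b) fun b₁ b₂ => sw (Δ c) fun c₁ c₂ =>
    sw (Δ d) fun d₁ d₂ => φ (a ⊗ₜ[k] (μ(b₁, c₁) ⊗ₜ[k] d₁)) * ψ (b₂ ⊗ₜ[k] (c₂ ⊗ₜ[k] d₂)))
    (by fun_prop) a]
  refine sw_congr fun a₁ a₂ => ?_
  simp only [smul_sw]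
  refine sw_congr fun b₁ b₂ => sw_congr fun c₁ c₂ => sw_congr fun d₁ d₂ => ?_
  simp only [mulTwo_apply, counitOne_apply, smul_eq_mul]
  ring

/-! ### Identities that involve the inverse `T` of the antipode -/

section Inverse

variable {T : H →ₗ[k] H} (hT : ∀ a, T (antipode k H a) = a) (hS : ∀ a, antipode k H (T a) = a)
include hT hS

theorem sw_comul_inv {F : H → H → W} (h₁ : ∀ v, Lin k fun u => F u v)
    (h₂ : ∀ u, Lin k fun v => F u v) (a : H) :
    sw (Δ (T a)) F = sw (Δ a) fun a₁ a₂ => F (T a₂) (T a₁) := by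
  conv_rhs => rw [← hS a]
  rw [sw_comul_antipode (by fun_prop) (by fun_prop)]
  simp only [hT]

theorem counit_inv (a : H) : ϵ (T a) = ϵ a := by
  rw [← counit_antipode, hS]

/-- The axiom for `β` at `T a`; its three legs appear in reversed order because `T` is an
antihomomorphism of coalgebras. -/
theorem mid_beta_inv (a : H) :
    (mid (β ∘ₗ T) a fun x z => μ(T z, x)) = β (T a) • oneH k H := by
  rw [← mid_beta (T a)]
  simp only [mid]
  conv_lhs => rw [← hS a]
  simp (disch := fun_prop) only [sw_comul_antipode, hT, LinearMap.comp_apply]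
  rw [← sw_coassoc (by fun_prop) (by fun_prop) (by fun_prop)]

/-- Because `T` and `S` reverse the comultiplication, in a convolution product the left factor
receives the outermost legs of `g` and `l`, and the right factor the inner legs together with the
weights `β`. So the right factor can be collapsed first. -/
theorem mid_mid_conv (φ ψ : WithConv (H ⊗[k] (H ⊗[k] (H ⊗[k] H)) →ₗ[k] k)) (g l : H) :
    (mid (β ∘ₗ T) g fun p q => mid β l fun u v =>
        (φ * ψ).ofConv (T q ⊗ₜ[k] (p ⊗ₜ[k] (u ⊗ₜ[k] S v)))) =
      sw (Δ g) fun g₁ r => sw (Δ r) fun g₂ g₃ => sw (Δ l) fun l₁ s => sw (Δ s) fun l₂ l₃ =>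
        φ.ofConv (T g₃ ⊗ₜ[k] (g₁ ⊗ₜ[k] (l₁ ⊗ₜ[k] S l₃))) *
          mid (β ∘ₗ T) g₂ fun p q => mid β l₂ fun u v =>
            ψ.ofConv (T q ⊗ₜ[k] (p ⊗ₜ[k] (u ⊗ₜ[k] S v))) := by
  simp (disch := fun_prop) only [convMul_tmul₄, sw_comul_inv hT hS, sw_comul_antipode]
  simp only [← sw_mid]
  trans mid (β ∘ₗ T) g fun p q => sw (Δ p) fun p₁ p₂ => sw (Δ q) fun q₁ q₂ => mid β l fun u v =>
      sw (Δ u) fun u₁ u₂ => sw (Δ v) fun v₁ v₂ =>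
        φ.ofConv (T q₂ ⊗ₜ[k] (p₁ ⊗ₜ[k] (u₁ ⊗ₜ[k] S v₂))) *
          ψ.ofConv (T q₁ ⊗ₜ[k] (p₂ ⊗ₜ[k] (u₂ ⊗ₜ[k] S v₁)))
  · refine mid_congr fun p q => ?_
    rw [sw_comm]
  rw [mid_split (G := fun p₁ p₂ q₁ q₂ => mid β l fun u v =>
      sw (Δ u) fun u₁ u₂ => sw (Δ v) fun v₁ v₂ =>
        φ.ofConv (T q₂ ⊗ₜ[k] (p₁ ⊗ₜ[k] (u₁ ⊗ₜ[k] S v₂))) *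
          ψ.ofConv (T q₁ ⊗ₜ[k] (p₂ ⊗ₜ[k] (u₂ ⊗ₜ[k] S v₁)))) _ _ (by fun_prop) (by fun_prop)
          (by fun_prop) (by fun_prop)]
  refine sw_congr fun g₁ r => sw_congr fun g₂ g₃ => ?_
  simp only [mul_mid, sw_mid]
  refine mid_congr fun p q => ?_
  rw [mid_split (G := fun u₁ u₂ v₁ v₂ => φ.ofConv (T g₃ ⊗ₜ[k] (g₁ ⊗ₜ[k] (u₁ ⊗ₜ[k] S v₂))) *
          ψ.ofConv (T q ⊗ₜ[k] (p ⊗ₜ[k] (u₂ ⊗ₜ[k] S v₁)))) _ _ (by fun_prop) (by fun_prop)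
          (by fun_prop) (by fun_prop)]

/-- In the right factor `T(q)p` collapses to a multiple of `1`, where `ω` is trivial by
`omega_left`. This leaves the weights next to the left factor, in which `u S(v)` collapses and
`omega_right` applies. -/
theorem mid_mid_mulThree_mulOne (g l : H) :
    (mid (β ∘ₗ T) g fun p q => mid β l fun u v =>
        (mulThree k H (omega k H) * mulOne k H (omega k H)).ofConv
          (T q ⊗ₜ[k] (p ⊗ₜ[k] (u ⊗ₜ[k] S v)))) = β (T g) * β l := by
  have e : ∀ g l : H, (mid (β ∘ₗ T) g fun p q => mid β l fun u v => ω(μ(T q, p), u, S v)) =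
      β (T g) * β l := by
    intro g l
    rw [← map_mid (L := fun z => mid β l fun u v => ω(z, u, S v)) (by fun_prop),
      mid_beta_inv hT hS]
    simp only [← TensorProduct.smul_tmul', map_smul, omega_left, counit_antipode, smul_eq_mul]
    rw [← mul_mid, mid_counit]
  have e' : ∀ q p : H, (mid β l fun u v => ω(T q, p, μ(u, S v))) = β l * (ϵ p * ϵ q) := by
    intro q p
    rw [← map_mid (L := fun z => ω(T q, p, z)) (by fun_prop), mid_beta]
    simp only [TensorProduct.tmul_smul, map_smul, omega_right, counit_inv hT hS, smul_eq_mul]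
    ring
  rw [mid_mid_conv hT hS]
  simp only [mulOne_apply, mulThree_apply, e]
  trans mid (β ∘ₗ T) g fun p q => mid β l fun u v => ω(T q, p, μ(u, S v))
  · refine sw_congr fun g₁ r => sw_congr fun g₂ g₃ => ?_
    simp only [mid, smul_sw, LinearMap.comp_apply]
    refine sw_congr fun l₁ t => sw_congr fun l₂ l₃ => ?_
    simp only [smul_eq_mul]
    ring
  · simp only [e']
    rw [← mul_mid, mid_counit, mul_comm]
    rfl

/-- The identity that removes the reassociator from the canonical map. -/
theorem mid_omega_eq (g l : H) :
    (mid (β ∘ₗ T) g fun p q => sw (Δ l) fun l₁ l₂ => ω(T q, p, l₁) * β l₂) =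
      sw (Δ g) fun g₁ r => sw (Δ r) fun g₂ s => sw (Δ s) fun g₃ g₄ =>
        sw (Δ l) fun l₁ t => sw (Δ t) fun l₂ l₃ =>
          β (T g₃) * (ω⁻(T g₄, μ(g₁, l₁), S l₃) * omegaInvBeta (k := k) g₂ l₂) := by
  -- A counit on a third leg of `l` makes the left side a value of the last factor of the cocycle
  -- identity.
  trans mid (β ∘ₗ T) g fun p q => mid β l fun u v =>
    (counitFour k H (omega k H)).ofConv (T q ⊗ₜ[k] (p ⊗ₜ[k] (u ⊗ₜ[k] S v)))
  · refine mid_congr fun p q => sw_congr fun l₁ r => ?_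
    rw [← sw_counit_right (F := fun z => ω(T q, p, l₁) * β z) (by fun_prop) r]
    refine sw_congr fun y z => ?_
    simp only [counitFour_apply, counit_antipode, smul_eq_mul]
    ring
  -- Solving the cocycle identity for this factor leaves a product whose right part collapses to a
  -- product of values of `β`; only the two inverse reassociators survive.
  rw [counitFour_omega, mid_mid_conv hT hS]
  simp (disch := fun_prop) only [mid_mid_mulThree_mulOne hT hS, mulTwo_mul_counitOne_apply,
    sw_comul_antipode]
  trans sw (Δ g) fun g₁ r => sw (Δ g₁) fun b₁ b₂ => sw (Δ r) fun g₂ g₃ => sw (Δ l) fun l₁ s =>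
    sw (Δ l₁) fun c₁ c₂ => sw (Δ s) fun l₂ l₃ => sw (Δ l₃) fun d₁ d₂ =>
      β (T g₂) * (ω⁻(T g₃, μ(b₁, c₁), S d₂) * (β l₂ * ω⁻(b₂, c₂, S d₁)))
  · refine sw_congr fun g₁ r => ?_
    conv_rhs => rw [sw_comm]
    refine sw_congr fun g₂ g₃ => ?_
    simp only [sw_mul]
    simp only [sw_comm _ (Δ g₁)]
    refine sw_congr fun b₁ b₂ => sw_congr fun l₁ t => ?_
    rw [sw_comm]
    refine sw_congr fun c₁ c₂ => sw_congr fun l₂ l₃ => sw_congr fun d₁ d₂ => ?_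
    ring
  · simp (disch := fun_prop) only [omegaInvBeta, mid, mul_sw, sw_coassoc, smul_eq_mul]

end Inverse

end Hopf

end HopfIdentities

/-! ### Colinear maps, the canonical map and coinvariant elements -/

section HopfModules

set_option linter.unusedSectionVars false

variable {k H A M W : Type*} [Field k] [AddCommGroup H] [Module k H] [Coalgebra k H]
  [CoquasiHopfAlgebra k H] [AddCommGroup A] [Module k A] [ComoduleAlgebra k H A]
  [AddCommGroup M] [Module k M] [HopfModule k H A M] [AddCommGroup W] [Module k W]

local notation "Δ" => Coalgebra.comul (R := k)
local notation "μ(" a "," b ")" => mulH k H (a ⊗ₜ[k] b)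
local notation "ω(" a "," b "," c ")" => omega k H (a ⊗ₜ[k] (b ⊗ₜ[k] c))
local notation "ω⁻(" a "," b "," c ")" => omegaInv k H (a ⊗ₜ[k] (b ⊗ₜ[k] c))
local notation "S" => antipode k H
local notation "β" => beta k H
local notation "α" => alpha k H
local notation "act(" m "," a ")" => actM k H A M (m ⊗ₜ[k] a)
local notation "mul(" a "," b ")" => mulA k H A (a ⊗ₜ[k] b)

/-- The property of a linear map `H → M` to be colinear. -/
def IsColinear {M : Type*} [AddCommGroup M] [Module k M] [RightComodule k H M]
    (f : H →ₗ[k] M) : Prop :=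
  ∀ h, rho k H M (f h) = sw (Δ h) fun h₁ h₂ => f h₁ ⊗ₜ[k] h₂

theorem IsColinear.sw_rho {M : Type*} [AddCommGroup M] [Module k M] [RightComodule k H M]
    {f : H →ₗ[k] M} (hf : IsColinear f) {F : M → H → W}
    (h₁ : ∀ v, Lin k fun u => F u v) (h₂ : ∀ u, Lin k fun v => F u v) (h : H) :
    sw (rho k H M (f h)) F = sw (Δ h) fun a b => F (f a) b := by
  rw [hf, sw_sw h₁ h₂]
  exact sw_congr fun a b => sw_tmul h₁ h₂ _ _

theorem IsTotalIntegral.isColinear {γ : H →ₗ[k] A} (hγ : IsTotalIntegral k H A γ) :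
    IsColinear γ := by
  intro h
  refine (LinearMap.congr_fun hγ.colinear h).trans ?_
  conv_lhs => rw [LinearMap.comp_apply, ← sw_tmul_self (Δ h)]
  simp only [linearMap_sw, LinearMap.rTensor_tmul]

theorem sw_smul_tmul {U V : Type*} [AddCommGroup U] [Module k U] [AddCommGroup V] [Module k V]
    {F : U → V → W} (h₁ : ∀ v, Lin k fun u => F u v)
    (h₂ : ∀ u, Lin k fun v => F u v) (c : k) (u : U) (v : V) :
    sw (c • (u ⊗ₜ[k] v)) F = c • F u v := by
  rw [← sw_tmul h₁ h₂]
  exact (Lin.sw_left (t := fun z : U ⊗[k] V => z) Lin.id h₁ h₂).map_smul c (u ⊗ₜ[k] v)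

theorem sw_rho_act {F : M → H → W} (h₁ : ∀ v, Lin k fun u => F u v)
    (h₂ : ∀ u, Lin k fun v => F u v) (m : M) (a : A) :
    sw (rho k H M (act(m, a))) F = sw (rho k H M m) fun m₀ m₁ => sw (rho k H A a) fun a₀ a₁ =>
      F (act(m₀, a₀)) (μ(m₁, a₁)) := by
  rw [rho_act, sw_sw h₁ h₂]
  simp (disch := assumption) only [sw_sw, sw_tmul]

theorem sw_rho_mul {F : A → H → W} (h₁ : ∀ v, Lin k fun u => F u v)
    (h₂ : ∀ u, Lin k fun v => F u v) (a b : A) :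
    sw (rho k H A (mul(a, b))) F = sw (rho k H A a) fun a₀ a₁ => sw (rho k H A b) fun b₀ b₁ =>
      F (mul(a₀, b₀)) (μ(a₁, b₁)) :=
  sw_rho_act (k := k) (H := H) (A := A) (M := A) h₁ h₂ a b

/-! ### The colinear maps `H → M` that a total integral provides -/

section Retraction

/-- The map `m ⊗ h ↦ m₀ γ(S(m₄) h₁) ω(m₁ β(m₂), S(m₃), h₂)`. -/
noncomputable def cofreeAct (γ : H →ₗ[k] A) (m : M) (h : H) : M :=
  sw (rho k H M m) fun m₀ c => sw (Δ c) fun c₁ c₂ => sw (Δ h) fun h₁ h₂ =>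
    omegaBeta (k := k) c₁ h₂ • act(m₀, γ (μ(S c₂, h₁)))

@[fun_prop]
theorem Lin.cofreeAct_left {X : Type*} [AddCommGroup X] [Module k X] (γ : H →ₗ[k] A) {m : X → M}
    (hm : Lin k m) (h : H) : Lin k fun x => cofreeAct γ (m x) h := by
  unfold cofreeAct
  fun_prop

@[fun_prop]
theorem Lin.cofreeAct_right {X : Type*} [AddCommGroup X] [Module k X] (γ : H →ₗ[k] A) {h : X → H}
    (hh : Lin k h) (m : M) : Lin k fun x => cofreeAct γ m (h x) := by
  unfold cofreeAct
  fun_prop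

variable {γ : H →ₗ[k] A} (hγ : IsTotalIntegral k H A γ)
include hγ

/-- Coacting on `m₀ γ(S(c)h)` produces a factor `m₁(S(c)h)` in `H`; with the weight `omegaBeta` this
is the left side of `sw_omegaBeta_mul`. -/
theorem rho_cofreeAct (m : M) (h : H) :
    rho k H M (cofreeAct γ m h) = sw (Δ h) fun h₁ h₂ => cofreeAct γ m h₁ ⊗ₜ[k] h₂ := by
  trans sw (rho k H M m) fun m₀ c => sw (rho k H M m₀) fun m₀₀ m₀₁ => sw (Δ c) fun c₁ c₂ =>
    sw (Δ c₂) fun d₁ d₂ => sw (Δ h) fun h₁ h₂ => sw (Δ h₁) fun e₁ e₂ =>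
      omegaBeta (k := k) c₁ h₂ • (act(m₀₀, γ (μ(S d₂, e₁))) ⊗ₜ[k] μ(m₀₁, μ(S d₁, e₂)))
  · simp (disch := fun_prop) only [cofreeAct, linearMap_sw, map_smul, rho_act,
      hγ.isColinear.sw_rho, sw_comul_mul, sw_comul_antipode, smul_sw]
    refine sw_congr fun m₀ c => ?_
    simp only [sw_comm _ (rho k H M m₀)]
    refine sw_congr fun _ _ => sw_congr fun c₁ c₂ => ?_
    rw [sw_comm]
  trans sw (rho k H M m) fun m₀ c => sw (Δ c) fun d c₂ => sw (Δ d) fun d₁ r => sw (Δ r) fun d₂ d₃ =>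
    sw (Δ h) fun h₁ e => sw (Δ e) fun e₁ e₂ =>
      omegaBeta (k := k) d₂ e₂ • (act(m₀, γ (μ(S c₂, h₁))) ⊗ₜ[k] μ(d₁, μ(S d₃, e₁)))
  · simp (disch := fun_prop) only [sw_coassoc, sw_rho_coassoc]
  trans sw (rho k H M m) fun m₀ c => sw (Δ c) fun d c₂ => sw (Δ h) fun h₁ e => sw (Δ e) fun e₁ e₂ =>
      omegaBeta (k := k) d e₁ • (act(m₀, γ (μ(S c₂, h₁))) ⊗ₜ[k] e₂)
  · refine sw_congr fun m₀ c => sw_congr fun d c₂ => ?_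
    simp only [sw_comm _ (Δ h)]
    refine sw_congr fun h₁ e => ?_
    simp only [← TensorProduct.tmul_smul, ← sw_tmul_right, sw_omegaBeta_mul]
  · simp (disch := fun_prop) only [cofreeAct, sw_tmul_left]
    simp only [sw_comm (Δ h)]
    refine sw_congr fun m₀ c => sw_congr fun c₁ c₂ => ?_
    simp (disch := fun_prop) only [sw_coassoc, TensorProduct.smul_tmul']

/-- The functional `α` sits between the legs of `S(d₂)h₁` and collapses this product to a multiple
of `1`, where `γ` takes the value `1`. The remaining scalar is the counit by `mid_omegaBeta`. -/
theorem sw_cofreeAct (m : M) :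
    (sw (rho k H M m) fun m₀ c => sw (Δ c) fun c₁ c₂ => α c₁ • cofreeAct γ m₀ c₂) = m := by
  trans sw (rho k H M m) fun m₀ c => sw (Δ c) fun d₁ e => sw (Δ e) fun r h₂ =>
    mid α r fun d₂ h₁ => omegaBeta (k := k) d₁ h₂ • act(m₀, γ (μ(S d₂, h₁)))
  · trans sw (rho k H M m) fun m₀ c => sw (rho k H M m₀) fun m₀₀ d => sw (Δ d) fun d₁ d₂ =>
      sw (Δ c) fun c₁ c₂ => sw (Δ c₂) fun h₁ h₂ =>
        α c₁ • omegaBeta (k := k) d₁ h₂ • act(m₀₀, γ (μ(S d₂, h₁)))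
    · refine sw_congr fun m₀ c => ?_
      simp only [cofreeAct, smul_sw]
      simp only [sw_comm (Δ c)]
    · simp (disch := fun_prop) only [mid, sw_coassoc, sw_rho_coassoc]
  · have e : ∀ (m₀ : M) (d₁ r h₂ : H), (mid α r fun d₂ h₁ =>
        omegaBeta (k := k) d₁ h₂ • act(m₀, γ (μ(S d₂, h₁)))) =
        (α r * omegaBeta (k := k) d₁ h₂) • m₀ := by
      intro m₀ d₁ r h₂
      rw [← map_mid (L := fun z => omegaBeta (k := k) d₁ h₂ • act(m₀, γ z)) (by fun_prop),
        mid_alpha, map_smul, hγ.map_one, TensorProduct.tmul_smul, map_smul, actM_one, smul_smul,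
        mul_comm]
    simp only [e]
    conv_rhs => rw [← sw_rho_counit (k := k) (H := H) (F := fun z => z) (by fun_prop) m]
    refine sw_congr fun m₀ c => ?_
    rw [← mid_omegaBeta, mid_smul]
    simp only [mid, smul_smul]

/-- `cofreeAct γ m` as a linear map. -/
noncomputable def cofreeHom (γ : H →ₗ[k] A) (m : M) : H →ₗ[k] M :=
  Lin.toLin (f := fun h => cofreeAct γ m h) (by fun_prop)

theorem isColinear_cofreeHom (m : M) : IsColinear (cofreeHom γ m) := rho_cofreeAct hγ m

theorem cofreeAct_one_mem (m : M) : cofreeAct γ m (oneH k H) ∈ coinvariants k H M := by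
  rw [mem_coinvariants, rho_cofreeAct hγ]
  simp (disch := fun_prop) only [comul_one, sw_tmul]

/-- Evaluation at `1` is thus a projection onto the coinvariants only up to the scalar `β(1)`. -/
theorem cofreeAct_one_of_mem {m : M} (hm : m ∈ coinvariants k H M) :
    cofreeAct γ m (oneH k H) = β (oneH k H) • m := by
  unfold cofreeAct
  simp (disch := fun_prop) only [mem_coinvariants.1 hm, comul_one, sw_tmul, antipode_one, mulH_one,
    hγ.map_one, actM_one, omegaBeta, mid, omega_left, counit_one, smul_eq_mul, mul_one]

end Retraction

/-- The formula for `cofreeAct` uses only the coaction and the action, so it commutes with every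
morphism of Hopf modules. -/
theorem map_cofreeAct {N : Type*} [AddCommGroup N] [Module k N] [HopfModule k H A N]
    {φ : M →ₗ[k] N} (h₁ : ∀ m, rho k H N (φ m) = LinearMap.rTensor H φ (rho k H M m))
    (h₂ : ∀ m a, φ (act(m, a)) = actM k H A N (φ m ⊗ₜ[k] a)) (γ : H →ₗ[k] A) (m : M) (h : H) :
    φ (cofreeAct γ m h) = cofreeAct γ (φ m) h := by
  unfold cofreeAct
  rw [h₁]
  simp (disch := fun_prop) only [LinearMap.rTensor, sw_map, linearMap_sw, map_smul, h₂,
    LinearMap.id_apply]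

section BetaCoaction

/-- The map `m ↦ m₀ ⊗ β(m₁) m₂`. -/
noncomputable def betaCoact (m : M) : M ⊗[k] H :=
  sw (rho k H M m) fun m₀ c => sw (Δ c) fun c₁ c₂ => β c₁ • (m₀ ⊗ₜ[k] c₂)

@[fun_prop]
theorem Lin.betaCoact {X : Type*} [AddCommGroup X] [Module k X] {m : X → M}
    (hm : Lin k m) : Lin k fun x => betaCoact (k := k) (H := H) (A := A) (m x) := by
  unfold CoquasiHopf.betaCoact
  fun_prop

/-- A left inverse is `m ⊗ l ↦ ω(m₁, S(l₁), α(l₂)l₃) m₀`: on `m₀ ⊗ β(m₁)m₂` the antipode axiom for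
`ω` turns the coefficient into the counit. -/
theorem betaCoact_injective :
    Function.Injective (betaCoact (k := k) (H := H) (A := A) (M := M)) := by
  refine Function.LeftInverse.injective (g := fun z => sw z fun m l =>
    sw (rho k H M m) fun m₀ c => mid α l fun p q => ω(c, S p, q) • m₀) fun m => ?_
  show sw (betaCoact (k := k) (H := H) (A := A) m) _ = m
  simp (disch := fun_prop) only [betaCoact, sw_sw, sw_smul_tmul]
  trans sw (rho k H M m) fun m₀ c => sw (rho k H M m₀) fun m₀₀ d => sw (Δ c) fun c₁ c₂ =>
    β c₁ • mid α c₂ fun p q => ω(d, S p, q) • m₀₀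
  · refine sw_congr fun m₀ c => ?_
    simp only [smul_sw]
    rw [sw_comm]
  · conv_rhs => rw [← sw_rho_counit (k := k) (H := H) (F := fun z => z) (by fun_prop) m]
    simp (disch := fun_prop) only [mid, sw_rho_coassoc, smul_sw, ← sw_omega_antipode,
      sw_smul, smul_smul]

end BetaCoaction

/-! ### The canonical map and the coaction of the left tensor factor -/

section CanonicalMap

theorem canTwist_tmul (h g : H) : canTwist k H (h ⊗ₜ[k] g) =
    sw (Δ g) fun g₁ g₂ => omegaInvBeta (k := k) h g₁ • g₂ := by
  let L : H ⊗[k] (H ⊗[k] H) →ₗ[k] H := (TensorProduct.lid k H).toLinearMap ∘ₗ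
    LinearMap.rTensor H (omegaInv k H) ∘ₗ (TensorProduct.assoc k H (H ⊗[k] H) H).symm.toLinearMap ∘ₗ
    TensorProduct.mk k H _ h ∘ₗ (TensorProduct.assoc k H H H).symm.toLinearMap ∘ₗ
    TensorProduct.map (convR LinearMap.id (beta k H)) (LinearMap.rTensor H (antipode k H))
  have hL : ∀ a b c : H, L (a ⊗ₜ[k] (b ⊗ₜ[k] c)) =
      sw (Δ a) fun a₁ a₂ => (β a₂ * ω⁻(h, a₁, S b)) • c := by
    intro a b c
    show ω⁻(h, convR LinearMap.id (beta k H) a, S b) • c = _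
    simp only [convR_apply, sw_tmul_left, sw_tmul_right, linearMap_sw, ← TensorProduct.smul_tmul',
      TensorProduct.tmul_smul, map_smul, smul_eq_mul, sw_smul, LinearMap.id_apply]
  show L (comul₃ k H g) = _
  rw [comul₃_apply, linearMap_sw]
  trans sw (Δ g) fun a b => sw (Δ a) fun a₁ a₂ => sw (Δ b) fun b₁ b₂ =>
    (β a₂ * ω⁻(h, a₁, S b₁)) • b₂
  · refine sw_congr fun a b => ?_
    conv_lhs => rw [← sw_tmul_self (Δ b)]
    simp only [sw_tmul_right, linearMap_sw, hL]
    rw [sw_comm]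
  · simp (disch := fun_prop) only [omegaInvBeta, mid, sw_smul, sw_coassoc, smul_eq_mul]

/-- Sweedler form of the canonical map. -/
theorem canPre_tmul (x y : A) : canPre k H A (x ⊗ₜ[k] y) =
    sw (rho k H A x) fun x₀ c => sw (rho k H A y) fun y₀ d => sw (Δ d) fun d₁ d₂ =>
      omegaInvBeta (k := k) c d₁ • (mul(x₀, y₀) ⊗ₜ[k] d₂) := by
  refine (linearMap_tmul (TensorProduct.map (mulA k H A) (canTwist k H) ∘ₗ
    (TensorProduct.tensorTensorTensorComm k A H A H).toLinearMap) _ _).trans ?_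
  refine sw_congr fun x₀ c => sw_congr fun y₀ d => ?_
  show mul(x₀, y₀) ⊗ₜ[k] canTwist k H (c ⊗ₜ[k] d) = _
  simp only [canTwist_tmul, sw_tmul_right, TensorProduct.tmul_smul]

/-- The coaction on `A ⊗ H` that is transported by the canonical map from the coaction on the
left tensor factor. -/
noncomputable def leftCoact (z : A ⊗[k] H) : (A ⊗[k] H) ⊗[k] H :=
  sw z fun a l => sw (rho k H A a) fun a₀ a₁ => sw (Δ l) fun l₁ l₂ =>
    (a₀ ⊗ₜ[k] l₂) ⊗ₜ[k] μ(a₁, S l₁)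

@[fun_prop]
theorem Lin.leftCoact {X : Type*} [AddCommGroup X] [Module k X] {z : X → A ⊗[k] H}
    (hz : Lin k z) : Lin k fun x => leftCoact (z x) := by
  unfold CoquasiHopf.leftCoact
  fun_prop

/-- The last leg of the left side is `(c₁d₁)S(d₃)` weighted by `omegaInvBeta`, which
`sw_omegaInvBeta_mul` simplifies. Hence `x₁` can be read off from `can(x ⊗ y)`. -/
theorem leftCoact_canPre (x y : A) : leftCoact (canPre k H A (x ⊗ₜ[k] y)) =
    sw (rho k H A x) fun x₀ c => canPre k H A (x₀ ⊗ₜ[k] y) ⊗ₜ[k] c := by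
  simp (disch := fun_prop) only [canPre_tmul, leftCoact, sw_sw, sw_smul_tmul, sw_rho_mul,
    sw_tmul_left, smul_sw]
  trans sw (rho k H A x) fun x₀ c => sw (rho k H A x₀) fun x₀₀ x₀₁ => sw (rho k H A y) fun y₀ d =>
    sw (rho k H A y₀) fun y₀₀ y₀₁ => sw (Δ d) fun d₁ d₂ => sw (Δ d₂) fun l₁ l₂ =>
      omegaInvBeta (k := k) c d₁ • ((mul(x₀₀, y₀₀) ⊗ₜ[k] l₂) ⊗ₜ[k] μ(μ(x₀₁, y₀₁), S l₁))
  · refine sw_congr fun x₀ c => ?_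
    simp only [sw_comm _ (rho k H A x₀)]
    refine sw_congr fun x₀₀ x₀₁ => sw_congr fun y₀ d => ?_
    rw [sw_comm]
  trans sw (rho k H A x) fun x₀ c => sw (Δ c) fun c₁ c₂ => sw (rho k H A y) fun y₀ d =>
    sw (Δ d) fun e l => sw (Δ e) fun d₁ r => sw (Δ r) fun d₂ d₃ =>
      omegaInvBeta (k := k) c₂ d₂ • ((mul(x₀, y₀) ⊗ₜ[k] l) ⊗ₜ[k] μ(μ(c₁, d₁), S d₃))
  · simp (disch := fun_prop) only [sw_coassoc, sw_rho_coassoc]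
  trans sw (rho k H A x) fun x₀ c => sw (Δ c) fun c₁ c₂ => sw (rho k H A y) fun y₀ d =>
    sw (Δ d) fun e l => omegaInvBeta (k := k) c₁ e • ((mul(x₀, y₀) ⊗ₜ[k] l) ⊗ₜ[k] c₂)
  · refine sw_congr fun x₀ c => ?_
    simp only [sw_comm (Δ c)]
    refine sw_congr fun y₀ d => sw_congr fun e l => ?_
    simp only [← TensorProduct.tmul_smul, ← sw_tmul_right]
    rw [← sw_omegaInvBeta_mul]
    simp only [sw_comm (Δ c)]
  · simp (disch := fun_prop) only [sw_rho_coassoc, TensorProduct.smul_tmul']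

end CanonicalMap

/-! ### Coinvariant elements obtained from a colinear map -/

section Coinvariants

variable {T : H →ₗ[k] H} (hT : ∀ a, T (antipode k H a) = a) (hS : ∀ a, antipode k H (T a) = a)
  {f : H →ₗ[k] M} (hf : IsColinear f)

/-- The map `x ↦ f(S⁻¹(x₂)) β(S⁻¹(x₁)) x₀`, where `T` is the inverse of the antipode. -/
noncomputable def translate (T : H →ₗ[k] H) (f : H →ₗ[k] M) (x : A) : M :=
  sw (rho k H A x) fun x₀ c => sw (Δ c) fun c₁ c₂ => β (T c₁) • act(f (T c₂), x₀)

@[fun_prop]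
theorem Lin.translate {X : Type*} [AddCommGroup X] [Module k X] (T : H →ₗ[k] H) (f : H →ₗ[k] M)
    {x : X → A} (hx : Lin k x) : Lin k fun z => translate T f (x z) := by
  unfold CoquasiHopf.translate
  fun_prop

section

include hT hS hf

/-- The coaction adds the factor `T(q)p` with `β` on the leg between `p` and `q`, which
`mid_beta_inv` collapses to a multiple of `1`. -/
theorem translate_mem (x : A) : translate T f x ∈ coinvariants k H M := by
  rw [mem_coinvariants]
  trans sw (rho k H A x) fun x₀ c => sw (Δ c) fun e d => mid (β ∘ₗ T) e fun p q =>
    act(f (T d), x₀) ⊗ₜ[k] μ(T q, p)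
  · trans sw (rho k H A x) fun x₀ c => sw (rho k H A x₀) fun x₀₀ x₀₁ => sw (Δ c) fun c₁ c₂ =>
      sw (Δ c₂) fun d₁ d₂ => β (T c₁) • (act(f (T d₂), x₀₀) ⊗ₜ[k] μ(T d₁, x₀₁))
    · simp (disch := fun_prop) only [translate, linearMap_sw, map_smul, rho_act,
        hf.sw_rho, sw_comul_inv hT hS, smul_sw]
      refine sw_congr fun x₀ c => ?_
      simp only [sw_comm _ (rho k H A x₀)]
    · simp (disch := fun_prop) only [mid, sw_coassoc, sw_rho_coassoc, LinearMap.comp_apply]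
  · simp (disch := fun_prop) only [translate, sw_tmul_left]
    refine sw_congr fun x₀ c => sw_congr fun e d => ?_
    rw [← map_mid (L := fun z => act(f (T d), x₀) ⊗ₜ[k] z) (by fun_prop), mid_beta_inv hT hS,
      TensorProduct.tmul_smul, TensorProduct.smul_tmul']

end

/-- The map `(a ⊗ l) ⊗ g ↦ β(S⁻¹(g₁)) ω⁻¹(S⁻¹(g₂), a₁, S(l₁)) f(S⁻¹(g₃)) a₀ ⊗ l₂`. -/
noncomputable def untwist (T : H →ₗ[k] H) (f : H →ₗ[k] M) (w : (A ⊗[k] H) ⊗[k] H) : M ⊗[k] H :=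
  sw w fun z g => sw z fun a l => sw (rho k H A a) fun a₀ a₁ => sw (Δ l) fun l₁ l₂ =>
    sw (Δ g) fun g₁ r => sw (Δ r) fun g₂ g₃ =>
      (β (T g₁) * ω⁻(T g₂, a₁, S l₁)) • (act(f (T g₃), a₀) ⊗ₜ[k] l₂)

@[fun_prop]
theorem Lin.untwist {X : Type*} [AddCommGroup X] [Module k X] (T : H →ₗ[k] H) (f : H →ₗ[k] M)
    {w : X → (A ⊗[k] H) ⊗[k] H} (hw : Lin k w) : Lin k fun x => untwist T f (w x) := by
  unfold CoquasiHopf.untwist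
  fun_prop

include hT hS hf

/-- The reassociator created by `(f(-)x)y` is rewritten by `mid_omega_eq` as two inverse
reassociators. One of them is the twist in the canonical map, the other is the coefficient in
`untwist`. -/
theorem betaCoact_translate_act (x y : A) :
    betaCoact (k := k) (H := H) (A := A) (act(translate T f x, y)) =
      untwist T f (sw (rho k H A x) fun x₀ c => canPre k H A (x₀ ⊗ₜ[k] y) ⊗ₜ[k] c) := by
  -- The translated element is coinvariant, so only `y` contributes to the coaction.
  trans sw (rho k H A y) fun y₀ d => sw (Δ d) fun d₁ d₂ =>
    β d₁ • (act(translate T f x, y₀) ⊗ₜ[k] d₂)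
  · simp (disch := fun_prop) only [betaCoact, sw_rho_act,
      mem_coinvariants.1 (translate_mem hT hS hf x), sw_tmul, one_mulH]
  trans sw (rho k H A x) fun x₀ c => sw (rho k H A x₀) fun x₀₀ x₀₁ => sw (Δ c) fun c₁ c₂ =>
    sw (Δ c₂) fun e₁ e₂ => sw (rho k H A y) fun y₀ d => sw (rho k H A y₀) fun y₀₀ y₀₁ =>
      sw (Δ d) fun d₁ d₂ => (β (T c₁) * (ω(T e₁, x₀₁, y₀₁) * β d₁)) •
        (act(f (T e₂), mul(x₀₀, y₀₀)) ⊗ₜ[k] d₂)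
  · simp (disch := fun_prop) only [translate, sw_tmul_left, linearMap_sw,
      ← TensorProduct.smul_tmul', map_smul, act_act, hf.sw_rho, sw_comul_inv hT hS, smul_sw,
      smul_smul]
    simp only [sw_comm _ (rho k H A x)]
    refine sw_congr fun x₀ c => ?_
    simp only [sw_comm _ (rho k H A x₀)]
    refine sw_congr fun x₀₀ x₀₁ => ?_
    simp only [sw_comm _ (Δ c)]
    refine sw_congr fun c₁ c₂ => ?_
    simp only [sw_comm _ (Δ c₂)]
    refine sw_congr fun e₁ e₂ => sw_congr fun y₀ d => ?_
    rw [sw_comm]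
    refine sw_congr fun y₀₀ y₀₁ => sw_congr fun d₁ d₂ => ?_
    ring_nf
  -- The legs are regrouped so that all scalars form the left side of `mid_omega_eq` at `e, e'`.
  trans sw (rho k H A x) fun x₀ c => sw (Δ c) fun e g => sw (rho k H A y) fun y₀ d =>
    sw (Δ d) fun e' l => (mid (β ∘ₗ T) e fun p q => sw (Δ e') fun l₁ l₂ =>
      ω(T q, p, l₁) * β l₂) • (act(f (T g), mul(x₀, y₀)) ⊗ₜ[k] l)
  · trans sw (rho k H A x) fun x₀ c => sw (Δ c) fun e g => sw (Δ e) fun p r => sw (Δ r) fun t q =>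
      sw (rho k H A y) fun y₀ d => sw (Δ d) fun e' l => sw (Δ e') fun l₁ l₂ =>
        (β (T t) * (ω(T q, p, l₁) * β l₂)) • (act(f (T g), mul(x₀, y₀)) ⊗ₜ[k] l)
    · simp (disch := fun_prop) only [sw_coassoc, sw_rho_coassoc]
    · refine sw_congr fun x₀ c => sw_congr fun e g => ?_
      simp only [mid, mul_sw, sw_smul, LinearMap.comp_apply, smul_eq_mul]
      simp only [sw_comm _ (Δ e)]
      refine sw_congr fun p r => ?_
      simp only [sw_comm _ (Δ r)]
  trans sw (rho k H A x) fun x₀ c => sw (rho k H A x₀) fun x₀₀ x₀₁ =>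
    sw (rho k H A x₀₀) fun x₁ x₂ => sw (Δ c) fun g₁ r => sw (Δ r) fun g₂ g₃ =>
    sw (rho k H A y) fun y₀ d => sw (rho k H A y₀) fun y₀₀ y₀₁ => sw (Δ d) fun d₁ d₂ =>
    sw (Δ d₂) fun l₁ l₂ => (β (T g₁) * (ω⁻(T g₂, μ(x₂, y₀₁), S l₁) *
      omegaInvBeta (k := k) x₀₁ d₁)) • (act(f (T g₃), mul(x₁, y₀₀)) ⊗ₜ[k] l₂)
  · simp (disch := fun_prop) only [mid_omega_eq hT hS, sw_smul]
    trans sw (rho k H A x) fun x₀ c => sw (Δ c) fun e g => sw (Δ e) fun g₁ r => sw (Δ r) fun g₂ s =>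
      sw (Δ s) fun g₃ g₄ => sw (rho k H A y) fun y₀ d => sw (Δ d) fun e' l => sw (Δ e') fun l₁ t =>
        sw (Δ t) fun l₂ l₃ => (β (T g₃) * (ω⁻(T g₄, μ(g₁, l₁), S l₃) *
          omegaInvBeta (k := k) g₂ l₂)) • (act(f (T g), mul(x₀, y₀)) ⊗ₜ[k] l)
    · refine sw_congr fun x₀ c => sw_congr fun e g => ?_
      simp only [sw_comm _ (Δ e)]
      refine sw_congr fun g₁ r => ?_
      simp only [sw_comm _ (Δ r)]
      refine sw_congr fun g₂ s => ?_
      simp only [sw_comm _ (Δ s)]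
    · simp (disch := fun_prop) only [sw_coassoc, sw_rho_coassoc]
  · simp (disch := fun_prop) only [canPre_tmul, untwist, sw_tmul_left, sw_sw, sw_smul_tmul,
      ← TensorProduct.smul_tmul', sw_tmul, sw_rho_mul, smul_sw, smul_smul]
    refine sw_congr fun x₀ c => sw_congr fun x₀₀ x₀₁ => ?_
    simp only [sw_comm _ (rho k H A x₀₀)]
    refine sw_congr fun x₁ x₂ => ?_
    simp only [sw_comm _ (Δ c)]
    refine sw_congr fun g₁ r => ?_
    simp only [sw_comm _ (Δ r)]
    refine sw_congr fun g₂ g₃ => sw_congr fun y₀ d => ?_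
    conv_lhs => rw [sw_comm]
    refine sw_congr fun d₁ d₂ => sw_congr fun y₀₀ y₀₁ => sw_congr fun l₁ l₂ => ?_
    ring_nf

-- Over `1 ⊗ h` the inverse reassociator has `1` in the middle and is trivial, and `T` cancels the
-- antipode in `leftCoact`; what remains is `f(h₁) ⊗ β(h₂)h₃`.
omit hf hS in
theorem untwist_leftCoact_one (hf : IsColinear f) (h : H) :
    untwist T f (leftCoact (oneA k H A ⊗ₜ[k] h)) = betaCoact (k := k) (H := H) (A := A) (f h) := by
  have h1 : rho k H A (oneA k H A) = oneA k H A ⊗ₜ[k] oneH k H := mem_coinvariants.1 oneA_mem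
  simp (disch := fun_prop) only [leftCoact, h1, sw_tmul, one_mulH, untwist, sw_sw,
    sw_comul_antipode, hT, omegaInv_middle, actM_one, betaCoact, hf.sw_rho]
  trans sw (Δ h) fun x y => sw (Δ x) fun a₁ a₂ => β a₂ • (f a₁ ⊗ₜ[k] y)
  · refine sw_congr fun x y => ?_
    rw [sw_comm]
    refine sw_congr fun a₁ a₂ => ?_
    rw [sw_comm, ← sw_counit_right (F := fun z => β a₂ • (f z ⊗ₜ[k] y)) (by fun_prop) a₁]
    refine sw_congr fun u₁ u₂ => ?_
    rw [← sw_counit_left (F := fun z => β a₂ • (f u₁ ⊗ₜ[k] z)) (by fun_prop) y, smul_sw]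
    refine sw_congr fun l₁ l₂ => ?_
    rw [counit_antipode, smul_smul, smul_smul, mul_comm, mul_assoc]
  · simp (disch := fun_prop) only [sw_coassoc]

/-- After `betaCoact` the left side is `untwist T f (leftCoact (canPre k H A z))`, so `z` enters
only through `1 ⊗ h`. -/
theorem sw_translate_act {z : A ⊗[k] A} {h : H} (hz : canPre k H A z = oneA k H A ⊗ₜ[k] h) :
    (sw z fun x y => act(translate T f x, y)) = f h := by
  apply betaCoact_injective (k := k) (H := H) (A := A)
  rw [← untwist_leftCoact_one (A := A) hT hf, ← hz]
  conv_rhs => rw [← sw_tmul_self z, linearMap_sw]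
  rw [map_sw (f := fun z => betaCoact (k := k) (H := H) (A := A) z) (by fun_prop),
    map_sw (f := fun z => untwist T f (leftCoact z)) (by fun_prop)]
  exact sw_congr fun x y => by rw [betaCoact_translate_act hT hS hf, leftCoact_canPre]

end Coinvariants

end HopfModules

/-! ### Bijectivity of the unit and of the counit -/

section Equivalence

set_option linter.unusedSectionVars false

variable {k H A M N : Type*} [Field k] [AddCommGroup H] [Module k H] [Coalgebra k H]
  [CoquasiHopfAlgebra k H] [AddCommGroup A] [Module k A] [ComoduleAlgebra k H A]
  [AddCommGroup M] [Module k M] [HopfModule k H A M] [AddCommGroup N] [Module k N]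
  [Module (coinvariants k H A)ᵐᵒᵖ N] [IsScalarTower k (coinvariants k H A)ᵐᵒᵖ N]

local notation "Δ" => Coalgebra.comul (R := k)
local notation "S" => antipode k H
local notation "β" => beta k H
local notation "α" => alpha k H
local notation "act(" m "," a ")" => actM k H A M (m ⊗ₜ[k] a)
local notation "mul(" a "," b ")" => mulA k H A (a ⊗ₜ[k] b)
local notation "cls(" n "," a ")" => tensorBMk k H A N (n ⊗ₜ[k] a)

variable (k H) in
theorem beta_one_ne_zero : β (oneH k H) ≠ 0 :=
  left_ne_zero_of_mul_eq_one (beta_one_mul_alpha_one (k := k))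

theorem one_mulA (a : A) : mul(oneA k H A, a) = a := ComoduleAlgebra.one_mul (H := H) a

theorem mulA_one (a : A) : mul(a, oneA k H A) = a := ComoduleAlgebra.mul_one (H := H) a

theorem tensorB_act (n : N) (a c : A) :
    actM k H A (TensorB k H A N) (cls(n, a) ⊗ₜ[k] c) = cls(n, mul(a, c)) := rfl

section Unit

variable {γ : H →ₗ[k] A} (hγ : IsTotalIntegral k H A γ)
include hγ

/-- The projection `A → B` that a total integral provides. -/
noncomputable def trace (a : A) : coinvariants k H A :=
  ⟨cofreeAct γ a (oneH k H), cofreeAct_one_mem hγ a⟩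

/-- Naturality of `cofreeAct` along the morphism of Hopf modules `a ↦ n ⊗_B a`; the coinvariant
`trace hγ a` then moves across the tensor sign. -/
theorem cofreeAct_tensorBMk (n : N) (a : A) :
    cofreeAct γ (cls(n, a)) (oneH k H) = cls(MulOpposite.op (trace hγ a) • n, oneA k H A) := by
  rw [tensorBMk_balanced, mulA_one]
  refine (map_cofreeAct (φ := tensorBMk k H A N ∘ₗ TensorProduct.mk k N A n) (fun a => ?_)
    (fun a b => rfl) γ a (oneH k H)).symm
  exact rho_tensorB n a

theorem exists_cofreeAct_eq (z : TensorB k H A N) :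
    ∃ n : N, cofreeAct γ z (oneH k H) = cls(n, oneA k H A) := by
  have hl : Lin k fun z : TensorB k H A N => cofreeAct γ z (oneH k H) := by fun_prop
  obtain ⟨y, rfl⟩ := Submodule.mkQ_surjective _ z
  induction y with
  | zero => exact ⟨0, by simpa using hl.map_zero⟩
  | add y z hy hz =>
    obtain ⟨n, hn⟩ := hy
    obtain ⟨p, hp⟩ := hz
    refine ⟨n + p, ?_⟩
    rw [map_add, hl.map_add, hn, hp, TensorProduct.add_tmul, map_add]
  | tmul n a => exact ⟨_, cofreeAct_tensorBMk hγ n a⟩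

theorem exists_tensorBMk_eq {z : TensorB k H A N} (hz : z ∈ coinvariants k H (TensorB k H A N)) :
    ∃ n : N, cls(n, oneA k H A) = z := by
  obtain ⟨n, hn⟩ := exists_cofreeAct_eq hγ z
  rw [cofreeAct_one_of_mem hγ hz] at hn
  refine ⟨(β (oneH k H))⁻¹ • n, ?_⟩
  rw [← TensorProduct.smul_tmul', map_smul, ← hn, inv_smul_smul₀ (beta_one_ne_zero k H)]

/-- Left multiplication by a coinvariant is an endomorphism of the Hopf module `A`, so naturality
applies. -/
theorem trace_mul (b : coinvariants k H A) (a : A) :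
    trace hγ (mul(b.1, a)) = b * trace hγ a := by
  refine Subtype.ext (map_cofreeAct (φ := mulA k H A ∘ₗ TensorProduct.mk k A A b.1) (fun a => ?_)
    (fun a c => ?_) γ a (oneH k H)).symm
  · exact rho_mul_coinv b a
  · exact (mulA_assoc_left b.2 a c).symm

theorem trace_one : trace hγ (oneA k H A) = β (oneH k H) • (1 : coinvariants k H A) :=
  Subtype.ext (cofreeAct_one_of_mem hγ oneA_mem)

theorem tensorBMk_one_injective : Function.Injective fun n : N => cls(n, oneA k H A) := by
  have := IsScalarTower.to_smulCommClass (R := k) (A := (coinvariants k H A)ᵐᵒᵖ) (M := N)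
  let g : N →ₗ[k] A →ₗ[k] N := LinearMap.mk₂ k (fun n a => MulOpposite.op (trace hγ a) • n)
    (fun n p a => smul_add _ _ _) (fun c n a => smul_comm _ _ _)
    (fun n a b => by
      rw [← add_smul, ← MulOpposite.op_add]
      congr 2
      exact Subtype.ext ((Lin.cofreeAct_left γ Lin.id (oneH k H)).map_add a b))
    (fun c n a => by
      rw [← smul_assoc, ← MulOpposite.op_smul]
      congr 2
      exact Subtype.ext ((Lin.cofreeAct_left γ Lin.id (oneH k H)).map_smul c a))
  -- The map `n ⊗_B a ↦ n t(a)`, balanced by left `B`-linearity of the trace, is a left inverse of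
  -- `n ↦ n ⊗_B 1` up to the scalar `β(1)`.
  let P : TensorB k H A N →ₗ[k] N := tensorBLift (TensorProduct.lift g) (by
    intro n b a
    show MulOpposite.op (trace hγ a) • MulOpposite.op b • n =
      MulOpposite.op (trace hγ (mul(b.1, a))) • n
    rw [trace_mul, MulOpposite.op_mul, mul_smul])
  have hP : ∀ n, P (cls(n, oneA k H A)) = β (oneH k H) • n := by
    intro n
    show MulOpposite.op (trace hγ (oneA k H A)) • n = _
    rw [trace_one, MulOpposite.op_smul, smul_assoc, MulOpposite.op_one, one_smul]
  intro n p h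
  have h' := congrArg P h
  simp only [hP] at h'
  exact smul_right_injective N (beta_one_ne_zero k H) h'

end Unit

section Counit

/-- The map `n ⊗_B a ↦ e(n) a` for an isomorphism `e` of `N` with the coinvariants of `M`. -/
def counitMap (e : N ≃ₗ[k] coinvariants k H M)
    (he : ∀ (b : coinvariants k H A) n, e (MulOpposite.op b • n) = MulOpposite.op b • e n) :
    TensorB k H A N →ₗ[k] M :=
  tensorBLift (actM k H A M ∘ₗ LinearMap.rTensor A ((coinvariants k H M).subtype ∘ₗ e.toLinearMap))
    (by
      intro n b a
      show act((e (MulOpposite.op b • n)).1, a) = act((e n).1, mul(b.1, a))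
      rw [he]
      exact actM_actM_coinv (e n).1 b.2 a)

-- The isomorphism `e` is a parameter since the `k`-linear structure of the categorical coinvariants
-- comes from `k → B`, not by definition from the subspace of `M`.
variable (e : N ≃ₗ[k] coinvariants k H M)
  (he : ∀ (b : coinvariants k H A) n, e (MulOpposite.op b • n) = MulOpposite.op b • e n)

theorem counitMap_mk (n : N) (a : A) : counitMap e he (cls(n, a)) = act((e n).1, a) := rfl

theorem counitMap_act (z : TensorB k H A N) (a : A) :
    counitMap e he (actM k H A (TensorB k H A N) (z ⊗ₜ[k] a)) = act(counitMap e he z, a) := by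
  obtain ⟨y, rfl⟩ := Submodule.mkQ_surjective _ z
  induction y with
  | zero => simp
  | add y z hy hz => simp only [TensorProduct.add_tmul, map_add, hy, hz]
  | tmul n c =>
    show act((e n).1, mul(c, a)) = act(act((e n).1, c), a)
    rw [actM_actM, reassociator_left (e n).2]
    rfl

theorem rho_counitMap (z : TensorB k H A N) :
    rho k H M (counitMap e he z) =
      LinearMap.rTensor H (counitMap e he) (rho k H (TensorB k H A N) z) := by
  refine LinearMap.congr_fun (f := rho k H M ∘ₗ counitMap e he)
    (g := LinearMap.rTensor H (counitMap e he) ∘ₗ rho k H (TensorB k H A N))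
    (tensorB_ext fun n a => ?_) z
  show rho k H M (act((e n).1, a)) = LinearMap.rTensor H (counitMap e he) (rho k H _ (cls(n, a)))
  rw [rho_act, mem_coinvariants.1 (e n).2, rho_tensorB]
  conv_rhs => rw [← sw_tmul_self (rho k H A a)]
  simp (disch := fun_prop) only [sw_tmul, one_mulH, linearMap_sw]
  rfl

variable {γ : H →ₗ[k] A} (hγ : IsTotalIntegral k H A γ)
  {T : H →ₗ[k] H} (hT : ∀ a, T (antipode k H a) = a) (hS : ∀ a, antipode k H (T a) = a)
  {σ : H →ₗ[k] A ⊗[k] A} (hσ : ∀ h, canPre k H A (σ h) = oneA k H A ⊗ₜ[k] h)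

@[fun_prop]
theorem Lin.translate_cofreeHom {X : Type*} [AddCommGroup X] [Module k X] (T : H →ₗ[k] H)
    (γ : H →ₗ[k] A) {m : X → M} (hm : Lin k m) (x : A) :
    Lin k fun z => CoquasiHopf.translate T (cofreeHom γ (m z)) x := by
  unfold CoquasiHopf.translate
  show Lin k fun z => sw (rho k H A x) fun x₀ c => sw (Δ c) fun c₁ c₂ =>
    β (T c₁) • act(cofreeAct γ (m z) (T c₂), x₀)
  fun_prop

/-- The coinvariant element `∑ f(S⁻¹(x₂)) β(S⁻¹(x₁)) x₀` for the colinear map `f` given by `m`. -/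
noncomputable def translateCoinv (m : M) (x : A) : coinvariants k H M :=
  ⟨translate T (cofreeHom γ m) x, translate_mem hT hS (isColinear_cofreeHom hγ m) x⟩

@[fun_prop]
theorem Lin.translateCoinv_left {X : Type*} [AddCommGroup X] [Module k X] {m : X → M}
    (hm : Lin k m) (x : A) : Lin k fun z => translateCoinv hγ hT hS (m z) x :=
  ⟨⟨fun a b => Subtype.ext ((Lin.translate_cofreeHom T γ hm x).map_add a b),
    fun c a => Subtype.ext ((Lin.translate_cofreeHom T γ hm x).map_smul c a)⟩⟩

@[fun_prop]
theorem Lin.translateCoinv_right {X : Type*} [AddCommGroup X] [Module k X] {x : X → A}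
    (hx : Lin k x) (m : M) : Lin k fun z => translateCoinv hγ hT hS m (x z) :=
  ⟨⟨fun a b => Subtype.ext ((Lin.translate T (cofreeHom γ m) hx).map_add a b),
    fun c a => Subtype.ext ((Lin.translate T (cofreeHom γ m) hx).map_smul c a)⟩⟩

include hσ in
theorem sw_translateCoinv_act (m : M) :
    (sw (rho k H M m) fun m₀ c => sw (Δ c) fun c₁ c₂ => α c₁ • sw (σ c₂) fun x y =>
      act((translateCoinv hγ hT hS m₀ x).1, y)) = m := by
  conv_rhs => rw [← sw_cofreeAct hγ m]
  refine sw_congr fun m₀ c => sw_congr fun c₁ c₂ => congrArg (fun z => α c₁ • z) ?_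
  exact sw_translate_act hT hS (isColinear_cofreeHom hγ m₀) (hσ c₂)

/-- Naturality again: `translate` uses only the action and `cofreeAct`, and the counit respects
both. -/
theorem map_translateCoinv (z : TensorB k H A N) (x : A) :
    counitMap e he (translateCoinv hγ hT hS z x).1 =
      (translateCoinv hγ hT hS (counitMap e he z) x).1 := by
  show counitMap e he (translate T (cofreeHom γ z) x) = translate T (cofreeHom γ _) x
  unfold translate
  simp only [linearMap_sw, map_smul, counitMap_act]
  refine sw_congr fun x₀ c => sw_congr fun c₁ c₂ => ?_
  have h := map_cofreeAct (rho_counitMap e he) (counitMap_act e he) γ z (T c₂)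
  exact congrArg (fun z => β (T c₁) • act(z, x₀)) h

include hγ hT hS hσ in
theorem counitMap_bijective : Function.Bijective (counitMap e he) := by
  -- The formula of `sw_translateCoinv_act` with the action replaced by the tensor product over `B`.
  let P : M → TensorB k H A N := fun m => sw (rho k H M m) fun m₀ c => sw (Δ c) fun c₁ c₂ =>
    α c₁ • sw (σ c₂) fun x y => cls(e.symm (translateCoinv hγ hT hS m₀ x), y)
  refine ⟨Function.LeftInverse.injective (g := P) fun z => ?_,
    Function.RightInverse.surjective (g := P) fun m => ?_⟩
  · conv_rhs => rw [← sw_translateCoinv_act (A := A) hγ hT hS hσ z]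
    show sw (rho k H M (counitMap e he z)) _ = _
    rw [rho_counitMap]
    simp (disch := fun_prop) only [LinearMap.rTensor, sw_map, LinearMap.id_apply]
    refine sw_congr fun z₀ c => sw_congr fun c₁ c₂ => congrArg (fun z => α c₁ • z) ?_
    refine sw_congr fun x y => ?_
    -- By the unit half this coinvariant of `N ⊗_B A` is `n ⊗_B 1`. Its image under the counit is `e
    -- n`, so `P` recovers the same `n`.
    obtain ⟨n, hn⟩ := exists_tensorBMk_eq hγ (translateCoinv hγ hT hS z₀ x).2
    have h : translateCoinv hγ hT hS (counitMap e he z₀) x = e n := by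
      refine Subtype.ext ((map_translateCoinv e he hγ hT hS z₀ x).symm.trans ?_)
      rw [← hn, counitMap_mk, actM_one]
    rw [h, e.symm_apply_apply, ← hn, tensorB_act, one_mulA]
  · conv_rhs => rw [← sw_translateCoinv_act (A := A) hγ hT hS hσ m]
    simp only [P, linearMap_sw, map_smul, counitMap_mk, e.apply_symm_apply]

end Counit

end Equivalence

/-! ### Natural isomorphisms between the functors -/

section Categories

variable {k H : Type*} {A : Type v} [Field k] [AddCommGroup H] [Module k H] [Coalgebra k H]
  [AddCommGroup A] [Module k A]

/-- A bijective morphism of relative Hopf modules is an isomorphism. -/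
noncomputable def isoOfBijective [CoquasiBialgebra k H] [ComoduleAlgebra k H A]
    {M N : HopfModuleCat.{w} k H A} (f : M ⟶ N)
    (hf : Function.Bijective (HopfModuleCat.lin f)) : M ≅ N :=
  let e : M.carrier ≃ₗ[k] N.carrier := LinearEquiv.ofBijective (HopfModuleCat.lin f) hf
  { hom := f
    inv := HopfModuleHom.mk (M := N) (N := M) e.symm.toLinearMap
      (by
        refine LinearMap.ext fun n => ?_
        obtain ⟨m, rfl⟩ := e.surjective n
        have h : rho k H N.carrier (e m) = LinearMap.rTensor H e.toLinearMap (rho k H M.carrier m) :=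
          LinearMap.congr_fun (HopfModuleHom.colinear f) m
        show rho k H M.carrier (e.symm (e m)) =
          LinearMap.rTensor H e.symm.toLinearMap (rho k H N.carrier (e m))
        rw [h, ← LinearMap.rTensor_comp_apply, LinearEquiv.symm_apply_apply,
          LinearEquiv.symm_comp, LinearMap.rTensor_id, LinearMap.id_apply])
      (by
        refine TensorProduct.ext' fun n a => ?_
        obtain ⟨m, rfl⟩ := e.surjective n
        show e.symm (actM k H A N.carrier (e m ⊗ₜ[k] a)) =
          actM k H A M.carrier (e.symm (e m) ⊗ₜ[k] a)
        rw [LinearEquiv.symm_apply_apply, LinearEquiv.symm_apply_eq]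
        exact (HopfModuleCat.lin_act f m a).symm)
    hom_inv_id := HopfModuleHom.ext (LinearMap.ext fun m => e.symm_apply_apply m)
    inv_hom_id := HopfModuleHom.ext (LinearMap.ext fun n => e.apply_symm_apply n) }

variable [CoquasiHopfAlgebra k H] [ComoduleAlgebra k H A]

section Unit

open scoped ModuleCat

/-- The map `n ↦ n ⊗_B 1` from a right `B`-module `N` to the coinvariants of `N ⊗_B A`. -/
def unitMap (N : ModuleCat.{max v w} (coinvariants k H A)ᵐᵒᵖ) :
    N →ₗ[(coinvariants k H A)ᵐᵒᵖ] coinvariants k H (inducedObj.{v, w} k H A N).carrier where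
  toFun n := ⟨inducedMk.{v, w} N n (oneA k H A), by
    refine (rho_tensorB n (oneA k H A)).trans ?_
    rw [mem_coinvariants.1 oneA_mem]
    rfl⟩
  map_add' n p := Subtype.ext <| by
    show tensorBMk k H A N ((n + p) ⊗ₜ[k] oneA k H A) = _
    rw [TensorProduct.add_tmul, map_add]
    rfl
  map_smul' b n := Subtype.ext <| by
    show tensorBMk k H A N ((MulOpposite.op b.unop • n) ⊗ₜ[k] oneA k H A) =
      tensorBMk k H A N (n ⊗ₜ[k] mulA k H A (oneA k H A ⊗ₜ[k] b.unop.1))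
    rw [tensorBMk_balanced, mulA_one, one_mulA]

theorem unitMap_bijective {γ : H →ₗ[k] A} (hγ : IsTotalIntegral k H A γ)
    (N : ModuleCat.{max v w} (coinvariants k H A)ᵐᵒᵖ) :
    Function.Bijective (unitMap.{v, w} N) :=
  ⟨fun n p h => tensorBMk_one_injective hγ (congrArg Subtype.val h), fun z => by
    obtain ⟨n, hn⟩ := exists_tensorBMk_eq hγ z.2
    exact ⟨n, Subtype.ext hn⟩⟩

/-- The unit `n ↦ n ⊗_B 1` of the adjunction, as a natural isomorphism. -/
noncomputable def unitIso {γ : H →ₗ[k] A} (hγ : IsTotalIntegral k H A γ) :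
    𝟭 (ModuleCat.{max v w} (coinvariants k H A)ᵐᵒᵖ) ≅
      inductionFunctor.{v, w} k H A ⋙ coinvariantsFunctor.{max v w} k H A :=
  NatIso.ofComponents
    (fun N => LinearEquiv.toModuleIso
      (LinearEquiv.ofBijective (unitMap.{v, w} N) (unitMap_bijective.{v, w} hγ N)))
    (fun _ => rfl)

end Unit

section Counit

open scoped ModuleCat

/-- The identity of `M^{coH}`, where the source carries the `k`-linear structure that comes from
`k → B`. -/
def coinvariantsEquiv (M : HopfModuleCat.{max v w} k H A) :
    (coinvariantsFunctor.{max v w} k H A).obj M ≃ₗ[k] coinvariants k H M.carrier where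
  toFun m := m
  invFun m := m
  left_inv _ := rfl
  right_inv _ := rfl
  map_add' _ _ := rfl
  map_smul' c m := Subtype.ext <| by
    show actM k H A M.carrier (Subtype.val (p := (· ∈ coinvariants k H M.carrier)) m ⊗ₜ[k]
      (algebraMap k (coinvariants k H A) c).1) =
      c • Subtype.val (p := (· ∈ coinvariants k H M.carrier)) m
    rw [Algebra.algebraMap_eq_smul_one]
    show actM k H A M.carrier (_ ⊗ₜ[k] (c • oneA k H A)) = _
    rw [TensorProduct.tmul_smul, map_smul, actM_one]

/-- The morphism `m ⊗_B a ↦ ma` from `M^{coH} ⊗_B A` to `M`. -/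
def counitHom (M : HopfModuleCat.{max v w} k H A) :
    inducedObj.{v, w} k H A ((coinvariantsFunctor.{max v w} k H A).obj M) ⟶ M :=
  HopfModuleHom.mk
    (M := inducedObj.{v, w} k H A ((coinvariantsFunctor.{max v w} k H A).obj M)) (N := M)
    (counitMap (coinvariantsEquiv.{v, w} M) fun _ _ => rfl)
    (LinearMap.ext (rho_counitMap _ _)) (TensorProduct.ext' (counitMap_act _ _))

theorem canPre_surjective (hcan : Function.Surjective (can k H A)) :
    Function.Surjective (canPre k H A) := fun y => by
  obtain ⟨x, rfl⟩ := hcan y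
  obtain ⟨z, rfl⟩ := Submodule.mkQ_surjective _ x
  exact ⟨z, rfl⟩

theorem counitHom_bijective (hS : Function.Bijective (antipode k H)) {γ : H →ₗ[k] A}
    (hγ : IsTotalIntegral k H A γ) (hcan : Function.Surjective (can k H A))
    (M : HopfModuleCat.{max v w} k H A) :
    Function.Bijective (HopfModuleCat.lin (counitHom.{v, w} M)) := by
  let T : H ≃ₗ[k] H := LinearEquiv.ofBijective (antipode k H) hS
  -- Over a field the surjection `A ⊗ A → A ⊗ H` has a linear section; only its values at `1 ⊗ h`
  -- are used.
  obtain ⟨σ, hσ⟩ := (canPre k H A).exists_rightInverse_of_surjective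
    (LinearMap.range_eq_top.2 (canPre_surjective hcan))
  exact counitMap_bijective (T := T.symm.toLinearMap) (σ := σ ∘ₗ TensorProduct.mk k A H (oneA k H A))
    (coinvariantsEquiv.{v, w} M) (fun _ _ => rfl) hγ T.symm_apply_apply T.apply_symm_apply fun h => LinearMap.congr_fun hσ _

/-- The counit `m ⊗_B a ↦ ma` of the adjunction, as a natural isomorphism. -/
noncomputable def counitIso (hS : Function.Bijective (antipode k H)) {γ : H →ₗ[k] A}
    (hγ : IsTotalIntegral k H A γ) (hcan : Function.Surjective (can k H A)) :
    coinvariantsFunctor.{max v w} k H A ⋙ inductionFunctor.{v, w} k H A ≅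
      𝟭 (HopfModuleCat.{max v w} k H A) :=
  NatIso.ofComponents
    (fun M => isoOfBijective (counitHom.{v, w} M) (counitHom_bijective.{v, w} hS hγ hcan M))
    (fun f => HopfModuleHom.ext (tensorB_ext fun m a => (HopfModuleCat.lin_act f m.1 a).symm))

end Counit

end Categories

end CoquasiHopf

theorem mainTheorem4 (k : Type u₁) (H : Type u₂) (A : Type v) [Field k]
    [AddCommGroup H] [Module k H] [Coalgebra k H] [CoquasiHopf.CoquasiHopfAlgebra k H]
    [AddCommGroup A] [Module k A] [CoquasiHopf.ComoduleAlgebra k H A]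
    (hS : Function.Bijective (CoquasiHopf.antipode k H))
    (hγ : ∃ γ : H →ₗ[k] A, CoquasiHopf.IsTotalIntegral k H A γ)
    (hcan : Function.Surjective (CoquasiHopf.can k H A)) :
    ∃ (η : 𝟭 (ModuleCat.{max v w} (CoquasiHopf.coinvariants k H A)ᵐᵒᵖ) ≅
        CoquasiHopf.inductionFunctor.{v, w} k H A ⋙
          CoquasiHopf.coinvariantsFunctor.{max v w} k H A)
      (ε : CoquasiHopf.coinvariantsFunctor.{max v w} k H A ⋙
          CoquasiHopf.inductionFunctor.{v, w} k H A ≅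
        𝟭 (CoquasiHopf.HopfModuleCat.{max v w} k H A)),
      (∀ (N : ModuleCat.{max v w} (CoquasiHopf.coinvariants k H A)ᵐᵒᵖ) (n : N),
        ((η.hom.app N).hom n).1 =
          CoquasiHopf.inducedMk.{v, w} N n (CoquasiHopf.oneA k H A)) ∧
      (∀ (M : CoquasiHopf.HopfModuleCat.{max v w} k H A)
        (m : CoquasiHopf.coinvariants k H M.carrier) (a : A),
        CoquasiHopf.HopfModuleCat.lin (ε.hom.app M)
          (CoquasiHopf.inducedMk.{v, w}
            ((CoquasiHopf.coinvariantsFunctor.{max v w} k H A).obj M) m a) =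
          CoquasiHopf.actM k H A M.carrier (m.1 ⊗ₜ[k] a)) := by
  obtain ⟨γ, hγ⟩ := hγ
  exact ⟨CoquasiHopf.unitIso.{v, w} hγ, CoquasiHopf.counitIso.{v, w} hS hγ hcan,
    fun _ _ => rfl, fun _ _ _ => rfl⟩
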